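/- Let $M$ be a complete smooth $n$-dimensional Riemannian manifold and let $D\subset M$ be a connected bounded open set with smooth boundary. Let $V\in C^2(\bar D)$, let $\mathrm{d}x$ be the Riemannian volume, $\mathrm{d}\mu=e^V\,\mathrm{d}x$, and let $\mathrm{d}A$ be the area measure of $\partial D$. Let $N$ be the inward unit normal field on $\partial D$ and $\mathrm{II}(X,Y)=-\langle\nabla_X N,Y\rangle$ (for $X,Y$ tangent to $\partial D$) the second fundamental form of $\partial D$. Put $$L=\Delta+\nabla V\cdot\nabla,\qquad \Gamma(f,g)=\nabla f\cdot\nabla g,\qquad \Gamma_2(f,g)=\tfrac12\big[L\Gamma(f,g)-\Gamma(Lf,g)-\Gamma(f,Lg)\big],$$ and $\Gamma(f)=\Gamma(f,f)$, $\Gamma_2(f)=\Gamma_2(f,f)$. Let $\Phi:\mathcal I\to\mathbb R$ be a smooth convex function on an interval $\mathcal I\subset\mathbb R$ with $\Phi''>0$ such that $\Phi''$ and $-1/\Phi''$ are also convex. For $f\in C^\infty(\bar D)$ with values in $\mathcal I$ put $$q_\Phi(f)=\int_D\Phi''(f)\,\Gamma(f)\,\mathrm{d}\mu,\qquad C_\Phi(f)=\int_D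 f^2\,\Phi''(f)\,\mathrm{d}\mu .$$ Let $K\in\mathbb R$ and $m>0$. Suppose that $D$ is convex, i.e. $\mathrm{II}\ge 0$ on $\partial D$, and that the pointwise curvature-dimension condition $CD(K,m)$ holds on $D$: $$\Gamma_2(\varphi)\ \ge\ K\,\Gamma(\varphi)+\frac1m\,(L\varphi)^2\quad\text{on } D,\ \text{ for all } \varphi\in C^\infty(M).$$ Then the integral form curvature-dimension condition with boundary term holds: for every $f\in C^\infty(\bar D)$ with values in $\mathcal I$ and $Nf=0$ on $\partial D$, $$\int_D\bigg[\frac{2\,\Gamma_2(\Phi'(f))}{\Phi''(f)}-\Big(\frac1{\Phi''}\Big)''(f)\,\big(\Phi''(f)\Gamma(f)\big)^2\bigg]\mathrm{d}\mu+2\int_{\partial D}e^V\,\Phi''(f)\,\mathrm{II}(\nabla f,\nabla f)\,\mathrm{d}A\ \ge\ 2K\,q_\Phi(f)+\frac{2\,q_\Phi(f)^2}{m\,C_\Phi(f)},$$ where the last quotient is read as $0$ if $f\equiv 0$ on $D$. -/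

import Mathlib

open scoped Manifold ContDiff MeasureTheory Bundle
open Set

noncomputable section

namespace RiemannDomain

variable (n : ℕ) {M : Type*} [MetricSpace M]
  [ChartedSpace (EuclideanSpace ℝ (Fin n)) M] [IsManifold (𝓡 n) ∞ M]
  [Bundle.RiemannianBundle (fun x : M => TangentSpace (𝓡 n) x)]

/-! ### Gradient, coordinate frames, divergence, Laplace–Beltrami operator, volume -/

instance finiteDimensional_tangentSpace (x : M) :
    FiniteDimensional ℝ (TangentSpace (𝓡 n) x) :=
  inferInstanceAs (FiniteDimensional ℝ (EuclideanSpace ℝ (Fin n)))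

instance completeSpace_tangentSpace (x : M) : CompleteSpace (TangentSpace (𝓡 n) x) :=
  FiniteDimensional.complete ℝ _

/-- The Riemannian gradient `∇f(x)`: the tangent vector representing the differential `df(x)`. -/
def grad (f : M → ℝ) (x : M) : TangentSpace (𝓡 n) x :=
  (InnerProductSpace.toDual ℝ (TangentSpace (𝓡 n) x)).symm (mvfderiv (𝓡 n) f x)

/-- The gradient at `x` of a function that is differentiable within the set `s`; for `s` the closure
of a smooth domain this is the gradient up to the boundary. -/
def gradWithin (s : Set M) (f : M → ℝ) (x : M) : TangentSpace (𝓡 n) x :=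
  (InnerProductSpace.toDual ℝ (TangentSpace (𝓡 n) x)).symm (mvfderivWithin (𝓡 n) f s x)

/-- The `i`-th coordinate vector field of the chart at `α`, at the point with coordinates `y`. -/
def coordVector (α : M) (y : EuclideanSpace ℝ (Fin n)) (i : Fin n) :
    TangentSpace (𝓡 n) ((extChartAt (𝓡 n) α).symm y) :=
  mfderiv (𝓡 n) (𝓡 n) (extChartAt (𝓡 n) α).symm y (EuclideanSpace.single i (1 : ℝ))

/-- The matrix `g_ij(y)` of the metric in the chart at `α`. -/
def metricMatrix (α : M) (y : EuclideanSpace ℝ (Fin n)) : Matrix (Fin n) (Fin n) ℝ :=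
  Matrix.of fun i j => inner ℝ (coordVector n α y i) (coordVector n α y j)

/-- The volume density `√det (g_ij(y))` in the chart at `α`. -/
def volumeDensity (α : M) (y : EuclideanSpace ℝ (Fin n)) : ℝ :=
  √(metricMatrix n α y).det

/-- The components `y ↦ (X¹(y), …, Xⁿ(y))` of a vector field in the chart at `α`. -/
def coordField (α : M) (X : ∀ x : M, TangentSpace (𝓡 n) x) (y : EuclideanSpace ℝ (Fin n)) :
    EuclideanSpace ℝ (Fin n) :=
  mfderiv (𝓡 n) (𝓡 n) (extChartAt (𝓡 n) α) ((extChartAt (𝓡 n) α).symm y)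
    (X ((extChartAt (𝓡 n) α).symm y))

/-- The Riemannian divergence `(1/√g) ∑ᵢ ∂ᵢ (√g Xⁱ)`, evaluated at `x` in the chart at `x`. -/
def divergence (X : ∀ x : M, TangentSpace (𝓡 n) x) (x : M) : ℝ :=
  (volumeDensity n x (extChartAt (𝓡 n) x x))⁻¹ *
    ∑ i, fderiv ℝ (fun y => volumeDensity n x y * coordField n x X y i)
      (extChartAt (𝓡 n) x x) (EuclideanSpace.single i (1 : ℝ))

/-- The Laplace–Beltrami operator `Δf = div ∇f`. -/
def laplaceBeltrami (f : M → ℝ) (x : M) : ℝ := divergence n (grad n f) x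

/-- The measure `√g dy` of the chart at `α`, transported to the domain of that chart in `M`. -/
def chartVolume [MeasurableSpace M] (α : M) : MeasureTheory.Measure M :=
  ((MeasureTheory.volume.restrict (extChartAt (𝓡 n) α).target).withDensity
    (fun y => ENNReal.ofReal (volumeDensity n α y))).map (extChartAt (𝓡 n) α).symm

variable (M) in
/-- The Riemannian volume measure `dx`. The measures `chartVolume α` agree on overlaps of charts;
their supremum is the measure that restricts to `chartVolume α` on the domain of each chart. -/
def riemannianVolume [MeasurableSpace M] : MeasureTheory.Measure M :=
  ⨆ α : M, chartVolume n α

/-! ### The diffusion operator `L = Δ + ∇V·∇` and its iterated carré du champ -/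

/-- `L f = Δ f + ∇V · ∇f`. -/
def diffusion (V f : M → ℝ) (x : M) : ℝ :=
  laplaceBeltrami n f x + inner ℝ (grad n V x) (grad n f x)

/-- The carré du champ `Γ(f, g) = ∇f · ∇g`. -/
def carreDuChamp (f g : M → ℝ) (x : M) : ℝ := inner ℝ (grad n f x) (grad n g x)

/-- `Γ₂(f, g) = ½ [L Γ(f, g) - Γ(L f, g) - Γ(f, L g)]`. -/
def gammaTwo (V f g : M → ℝ) (x : M) : ℝ :=
  (1 / 2) * (diffusion n V (carreDuChamp n f g) x - carreDuChamp n (diffusion n V f) g x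
    - carreDuChamp n f (diffusion n V g) x)

/-- The pointwise curvature-dimension condition `CD(K, m)` for `L = Δ + ∇V·∇` on `D`:
`Γ₂(φ) ≥ K Γ(φ) + (L φ)² / m` at every point of `D`, for all `φ ∈ C^∞(M)`. -/
def CurvatureDimension (V : M → ℝ) (D : Set M) (K m : ℝ) : Prop :=
  ∀ φ : M → ℝ, ContMDiff (𝓡 n) 𝓘(ℝ, ℝ) ∞ φ → ∀ x ∈ D,
    K * carreDuChamp n φ φ x + (1 / m) * diffusion n V φ x ^ 2 ≤ gammaTwo n V φ φ x

/-! ### Smooth domains and the second fundamental form of the boundary -/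

/-- `ρ` is smooth without critical points on a neighbourhood `U` of `p`, and
`D ∩ U = {q ∈ U | ρ q > 0}`. -/
def IsLocalDefiningFunction (D : Set M) (p : M) (ρ : M → ℝ) : Prop :=
  ∃ U : Set M, IsOpen U ∧ p ∈ U ∧ ContMDiffOn (𝓡 n) 𝓘(ℝ, ℝ) ∞ ρ U ∧
    (∀ q ∈ U, mvfderiv (𝓡 n) ρ q ≠ 0) ∧ D ∩ U = {q ∈ U | 0 < ρ q}

/-- A connected bounded open set with smooth boundary. -/
structure IsBoundedSmoothDomain (D : Set M) : Prop where
  isOpen : IsOpen D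
  isConnected : IsConnected D
  isBounded : Bornology.IsBounded D
  smooth_boundary : ∀ p ∈ frontier D, ∃ ρ : M → ℝ, IsLocalDefiningFunction n D p ρ

open Classical in
/-- A local defining function of `D` at the boundary point `p` (the zero function if there is
none). -/
def definingFunction (D : Set M) (p : M) : M → ℝ :=
  if h : ∃ ρ : M → ℝ, IsLocalDefiningFunction n D p ρ then h.choose else 0

/-- The unit field `∇ρ / |∇ρ|` for `ρ` a defining function of `D` at `p`. At the points of the
boundary near `p` it is the inward unit normal, whatever `ρ` is. -/
def unitNormalField (D : Set M) (p : M) (q : M) : TangentSpace (𝓡 n) q :=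
  ‖grad n (definingFunction n D p) q‖⁻¹ • grad n (definingFunction n D p) q

/-- The inward unit normal `N` at the boundary point `p`. -/
def inwardNormal (D : Set M) (p : M) : TangentSpace (𝓡 n) p := unitNormalField n D p p

/-- `⟨∇_u Y, w⟩` at `x` for the Levi-Civita connection, by the Koszul formula
`2⟨∇_U Y, W⟩ = U⟨Y, W⟩ + Y⟨U, W⟩ - W⟨U, Y⟩ + ⟨[U, Y], W⟩ - ⟨[U, W], Y⟩ - ⟨[Y, W], U⟩`,
with `U`, `W` any smooth fields near `x` that extend `u`, `w`. -/
def leviCivitaInner (Y : ∀ x : M, TangentSpace (𝓡 n) x) (x : M) (u w : TangentSpace (𝓡 n) x) : ℝ :=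
  let U : ∀ x : M, TangentSpace (𝓡 n) x := FiberBundle.extend (EuclideanSpace ℝ (Fin n)) u
  let W : ∀ x : M, TangentSpace (𝓡 n) x := FiberBundle.extend (EuclideanSpace ℝ (Fin n)) w
  (1 / 2) *
    (mvfderiv (𝓡 n) (fun q => inner ℝ (Y q) (W q)) x u
      + mvfderiv (𝓡 n) (fun q => inner ℝ (U q) (W q)) x (Y x)
      - mvfderiv (𝓡 n) (fun q => inner ℝ (U q) (Y q)) x w
      + inner ℝ (VectorField.mlieBracket (𝓡 n) U Y x) w
      - inner ℝ (VectorField.mlieBracket (𝓡 n) U W x) (Y x)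
      - inner ℝ (VectorField.mlieBracket (𝓡 n) Y W x) u)

/-- The second fundamental form `II(u, v) = -⟨∇_u N, v⟩` of the boundary at `p` with respect to the
inward unit normal `N`, for `u`, `v` tangent to the boundary. -/
def secondFundamentalForm (D : Set M) (p : M) (u v : TangentSpace (𝓡 n) p) : ℝ :=
  -leviCivitaInner n (unitNormalField n D p) p u v

/-- Convexity of the domain: `II ≥ 0` on all tangent spaces of the boundary. -/
def IsConvexDomain (D : Set M) : Prop :=
  ∀ p ∈ frontier D, ∀ u : TangentSpace (𝓡 n) p, inner ℝ (inwardNormal n D p) u = 0 →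
    0 ≤ secondFundamentalForm n D p u u

/-- The area measure `dA` of the boundary: the `(n-1)`-dimensional Hausdorff measure of the
Riemannian distance, normalized to agree with Lebesgue measure on `ℝ^(n-1)`. -/
def boundaryArea [MeasurableSpace M] [BorelSpace M] (D : Set M) : MeasureTheory.Measure M :=
  (μHE[n - 1] : MeasureTheory.Measure M).restrict (frontier D)

/-! ### Integral functionals -/

/-- `∫_D F dμ` with `dμ = e^V dx`. -/
def weightedIntegral [MeasurableSpace M] (V : M → ℝ) (D : Set M) (F : M → ℝ) : ℝ :=
  ∫ x in D, F x * Real.exp (V x) ∂(riemannianVolume n M)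

/-- The second derivative of a function on the interval `J` (one-sided at end points in `J`). -/
def secondDeriv (J : Set ℝ) (Φ : ℝ → ℝ) : ℝ → ℝ := iteratedDerivWithin 2 Φ J

/-- `q_Φ(f) = ∫_D Φ''(f) Γ(f) dμ`. -/
def qPhi [MeasurableSpace M] (V : M → ℝ) (D : Set M) (J : Set ℝ) (Φ : ℝ → ℝ) (f : M → ℝ) : ℝ :=
  weightedIntegral n V D fun x => secondDeriv J Φ (f x) * carreDuChamp n f f x

/-- `C_Φ(f) = ∫_D f² Φ''(f) dμ`. -/
def cPhi [MeasurableSpace M] (V : M → ℝ) (D : Set M) (J : Set ℝ) (Φ : ℝ → ℝ) (f : M → ℝ) : ℝ :=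
  weightedIntegral n V D fun x => f x ^ 2 * secondDeriv J Φ (f x)

/-- The integral form curvature-dimension condition with boundary term for all
`f ∈ C^∞(D̄)` with values in `J` and `N f = 0` on the boundary:
`∫_D [2 Γ₂(Φ'(f)) / Φ''(f) - (1/Φ'')''(f) (Φ''(f) Γ(f))²] dμ + 2 ∫_∂D e^V Φ''(f) II(∇f, ∇f) dA
  ≥ 2 K q_Φ(f) + 2 q_Φ(f)² / (m C_Φ(f))`. -/
def IntegralCurvatureDimension [MeasurableSpace M] [BorelSpace M] (V : M → ℝ) (D : Set M)
    (J : Set ℝ) (Φ : ℝ → ℝ) (K m : ℝ) : Prop :=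
  ∀ f : M → ℝ, ContMDiffOn (𝓡 n) 𝓘(ℝ, ℝ) ∞ f (closure D) → MapsTo f (closure D) J →
    (∀ p ∈ frontier D, mvfderivWithin (𝓡 n) f (closure D) p (inwardNormal n D p) = 0) →
    2 * K * qPhi n V D J Φ f + 2 / (m * cPhi n V D J Φ f) * qPhi n V D J Φ f ^ 2 ≤
      weightedIntegral n V D (fun x =>
          2 * gammaTwo n V (fun y => derivWithin Φ J (f y)) (fun y => derivWithin Φ J (f y)) x
              / secondDeriv J Φ (f x)
            - secondDeriv J (fun r => 1 / secondDeriv J Φ r) (f x)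
              * (secondDeriv J Φ (f x) * carreDuChamp n f f x) ^ 2)
        + 2 * ∫ p, Real.exp (V p) * secondDeriv J Φ (f p)
            * secondFundamentalForm n D p (gradWithin n (closure D) f p)
              (gradWithin n (closure D) f p) ∂(boundaryArea n D)

end RiemannDomain

end

noncomputable section

set_option linter.unusedSectionVars false

namespace RiemannDomain

open Filter Topology MeasureTheory

/-! ### Jacobi's formula and the invariance of the divergence under coordinate changes. -/

section Jacobi

variable {n : ℕ}

local notation "E" => EuclideanSpace ℝ (Fin n)

/-! Put `u = Φ'(f)`. Then `∇u = Φ''(f) ∇f` and `Γ(u) = Φ''(f)² Γ(f)`, so the pointwise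
curvature-dimension condition for `u`, multiplied by `2 / Φ''(f)`, reads `2 Γ₂(u) / Φ''(f) ≥ 2K
Φ''(f) Γ(f) + (2/m) (Lu)² / Φ''(f)`. The term with `(1/Φ'')''` contributes nonnegatively because
`1/Φ''` is concave, and the boundary integral is nonnegative because `∇f` is tangent to the boundary
of a convex domain. After integration it remains to see that `∫ (Lu)² / Φ''(f) dμ ≥ q² / C`. The
Neumann condition passes from `f` to `u`, so Green's formula gives `∫ f Lu dμ = -∫ Γ(f, u) dμ = -q`,
and Cauchy-Schwarz for `f √Φ''(f)` and `Lu / √Φ''(f)` finishes. This is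
`integralCurvatureDimension_of_curvatureDimension`.

The substantial input is Green's formula `integral_green` for functions smooth up to the boundary,
in the case where no boundary term appears. It is proved without surface measure. In a chart the
flux field `Y = √g e^V f ∇u` is multiplied by cutoffs `η_k(ρ)`, with `ρ` a defining function of `D`.
The field then has compact support in the open set and its divergence integrates to zero. The error
term `η_k'(ρ) dρ(Y)` is uniformly bounded, since `dρ(Y) = O(ρ)`
(`abs_le_mul_of_tendsto_zero_boundary`) while `η_k'` is of size `k` on a layer of width `1/k`. It
tends to zero pointwise, so dominated convergence applies (`integral_divergence_of_tangent`). The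
input `dρ(Y) → 0` at the boundary comes from `Nf = 0` through `tendsto_carreDuChamp_of_normal`.

Globalization needs four facts: the divergence, defined in the chart centred at each point, can be
computed in any fixed chart (`divergence_chart`); the supremum of the chart measures restricts to
each of them on its chart domain (`riemannianVolume_apply_of_subset`); the closure of `D` is
compact, by a Hopf-Rinow argument (`isCompact_closure_of_isBounded`); and a smooth partition of
unity glues the local identities. Integrability is uniform in style: every function built from `f`,
`V` and `Φ` has a limit along `D` at each point of the closure (`HasLimits`), which follows from the
calculus of `C^k` extensions (`ExtendsC`). -/

theorem clm_det_eq_matrix_det (A : E →L[ℝ] E) :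
    A.det = (Matrix.of fun i j => A (EuclideanSpace.single j 1) i).det := by
  rw [ContinuousLinearMap.det, ← LinearMap.det_toMatrix (EuclideanSpace.basisFun (Fin n) ℝ).toBasis]
  congr 1

theorem clm_trace_eq_sum (A : E →L[ℝ] E) :
    LinearMap.trace ℝ E A = ∑ i, A (EuclideanSpace.single i 1) i := by
  rw [LinearMap.trace_eq_matrix_trace ℝ (EuclideanSpace.basisFun (Fin n) ℝ).toBasis]
  simp [Matrix.trace, LinearMap.toMatrix_apply]

theorem clm_det_comp (A B : E →L[ℝ] E) : (A.comp B).det = A.det * B.det :=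
  LinearMap.det_comp _ _

theorem clm_trace_comp_comm (A B : E →L[ℝ] E) :
    LinearMap.trace ℝ E (A.comp B) = LinearMap.trace ℝ E (B.comp A) :=
  LinearMap.trace_comp_comm' (B : E →ₗ[ℝ] E) (A : E →ₗ[ℝ] E)

theorem contDiff_clm_det : ContDiff ℝ ∞ (fun A : E →L[ℝ] E => A.det) := by
  simp only [clm_det_eq_matrix_det, Matrix.det_apply, Matrix.of_apply]
  refine ContDiff.sum fun σ _ => ContDiff.const_smul _ (contDiff_prod fun i _ => ?_)
  have h : (fun A : E →L[ℝ] E => A (EuclideanSpace.single i 1) (σ i)) =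
      ((EuclideanSpace.proj (𝕜 := ℝ) (σ i)).comp
        (ContinuousLinearMap.apply ℝ E (EuclideanSpace.single i (1 : ℝ)))) := by
    ext; simp
  rw [h]
  exact ContinuousLinearMap.contDiff _

/-- Jacobi's formula at an invertible `A`: factor `A + tC = A (1 + t B C)` and expand `det (1 + tM)`
to first order in `t`. -/
theorem fderiv_clm_det {A B C : E →L[ℝ] E} (hB' : A.comp B = .id ℝ E) :
    fderiv ℝ (fun A : E →L[ℝ] E => A.det) A C = A.det * LinearMap.trace ℝ E (B.comp C) := by
  have h1 : HasFDerivAt (fun A : E →L[ℝ] E => A.det) (fderiv ℝ (fun A : E →L[ℝ] E => A.det) A) A :=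
    (contDiff_clm_det.differentiable (by simp)).differentiableAt.hasFDerivAt
  have h2 := h1.hasLineDerivAt C
  rw [HasLineDerivAt] at h2
  refine h2.unique ?_
  have h3 : ∀ t : ℝ, (A + t • C).det = A.det * (1 +
      t • LinearMap.toMatrix (EuclideanSpace.basisFun (Fin n) ℝ).toBasis
        (EuclideanSpace.basisFun (Fin n) ℝ).toBasis (B.comp C)).det := by
    intro t
    have : A + t • C = A.comp (.id ℝ E + t • (B.comp C)) := by
      rw [ContinuousLinearMap.comp_add, ContinuousLinearMap.comp_smul,
        ← ContinuousLinearMap.comp_assoc, hB']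
      simp
    rw [this, clm_det_comp]
    congr 1
    rw [ContinuousLinearMap.det,
      ← LinearMap.det_toMatrix (EuclideanSpace.basisFun (Fin n) ℝ).toBasis]
    congr 1
    simp
    exact (EuclideanSpace.basisFun (Fin n) ℝ).toBasis.toMatrix_self
  simp only [h3]
  set M := LinearMap.toMatrix (EuclideanSpace.basisFun (Fin n) ℝ).toBasis
        (EuclideanSpace.basisFun (Fin n) ℝ).toBasis (B.comp C) with hM
  simp only [Matrix.det_one_add_smul _ M]
  have ht : LinearMap.trace ℝ E (B.comp C) = M.trace := by
    rw [LinearMap.trace_eq_matrix_trace ℝ (EuclideanSpace.basisFun (Fin n) ℝ).toBasis]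
  rw [ht]
  refine HasDerivAt.const_mul _ ?_
  -- The remainder in `Matrix.det_one_add_smul` is `p(t) t²`, whose derivative at `0` vanishes.
  set p := (Matrix.det (1 + (Polynomial.X : Polynomial ℝ) • M.map Polynomial.C)).divX.divX
  have e1 := (hasDerivAt_id (0:ℝ)).const_mul M.trace
  have e2 := (p.hasDerivAt (0:ℝ)).mul ((hasDerivAt_id (0:ℝ)).pow 2)
  convert! ((hasDerivAt_const (0:ℝ) (1:ℝ)).add e1).add e2 using 1
  simp

/-- The coordinate divergence `(1/w) ∑ᵢ ∂ᵢ (w Xⁱ)` written without coordinates. -/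
theorem weighted_divergence_eq {w : E → ℝ} {X : E → E} {y : E} (hw : DifferentiableAt ℝ w y)
    (hX : DifferentiableAt ℝ X y) :
    ∑ i, fderiv ℝ (fun z => w z * X z i) y (EuclideanSpace.single i (1 : ℝ)) =
      fderiv ℝ w y (X y) + w y * LinearMap.trace ℝ E (fderiv ℝ X y) := by
  have hXi : ∀ i, HasFDerivAt (fun z => X z i)
      ((EuclideanSpace.proj (𝕜 := ℝ) i).comp (fderiv ℝ X y)) y := fun i =>
    (EuclideanSpace.proj (𝕜 := ℝ) i).hasFDerivAt.comp y hX.hasFDerivAt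
  have h1 : ∀ i, fderiv ℝ (fun z => w z * X z i) y (EuclideanSpace.single i (1 : ℝ)) =
      w y * fderiv ℝ X y (EuclideanSpace.single i 1) i +
        X y i * fderiv ℝ w y (EuclideanSpace.single i 1) := by
    intro i
    rw [(hw.hasFDerivAt.fun_mul (hXi i)).fderiv]
    simp
  simp only [h1, Finset.sum_add_distrib, clm_trace_eq_sum, Finset.mul_sum]
  rw [add_comm]
  congr 1
  have hsum : X y = ∑ i, X y i • EuclideanSpace.single i (1 : ℝ) := by
    have := (EuclideanSpace.basisFun (Fin n) ℝ).sum_repr (X y)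
    simpa using this.symm
  conv_rhs => rw [hsum]
  simp [map_sum]

/-- Invariance of the coordinate divergence under a change of coordinates `ψ`. -/
theorem weighted_divergence_change {ψ : E → E} {y : E} (hψ : ContDiffAt ℝ 2 ψ y)
    {B : E →L[ℝ] E} (hB : B.comp (fderiv ℝ ψ y) = .id ℝ E) (hB' : (fderiv ℝ ψ y).comp B = .id ℝ E)
    {wa wb : E → ℝ} {Xa Xb : E → E}
    (hw : wa =ᶠ[𝓝 y] fun z => |(fderiv ℝ ψ z).det| * wb (ψ z))
    (hX : (fun z => Xb (ψ z)) =ᶠ[𝓝 y] fun z => fderiv ℝ ψ z (Xa z))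
    (hwb : DifferentiableAt ℝ wb (ψ y)) (hwb0 : wb (ψ y) ≠ 0)
    (hXa : DifferentiableAt ℝ Xa y) (hXb : DifferentiableAt ℝ Xb (ψ y)) :
    (wa y)⁻¹ * ∑ i, fderiv ℝ (fun z => wa z * Xa z i) y (EuclideanSpace.single i (1 : ℝ)) =
    (wb (ψ y))⁻¹ * ∑ i, fderiv ℝ (fun z => wb z * Xb z i) (ψ y)
      (EuclideanSpace.single i (1 : ℝ)) := by
  have hψ1 : DifferentiableAt ℝ ψ y := hψ.differentiableAt (by simp)
  have hdψ : DifferentiableAt ℝ (fderiv ℝ ψ) y :=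
    (hψ.fderiv_right (m := 1) (by norm_num)).differentiableAt (by simp)
  set A := fderiv ℝ ψ y with hA
  set H := fderiv ℝ (fderiv ℝ ψ) y with hH
  have hsymm : ∀ u v, H u v = H v u := by
    intro u v
    exact (hψ.isSymmSndFDerivAt (by simp)).eq u v
  have hdet0 : A.det ≠ 0 := by
    intro h0
    have := congrArg ContinuousLinearMap.det hB
    rw [clm_det_comp, h0] at this
    simp [ContinuousLinearMap.det] at this
  -- derivative of the determinant
  have hdet : HasFDerivAt (fun z => (fderiv ℝ ψ z).det)
      ((fderiv ℝ (fun A : E →L[ℝ] E => A.det) A).comp H) y :=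
    HasFDerivAt.comp (g := fun A : E →L[ℝ] E => A.det) y
      ((contDiff_clm_det.differentiable (by simp)).differentiableAt.hasFDerivAt)
      hdψ.hasFDerivAt
  have hdet' : ∀ v, ((fderiv ℝ (fun A : E →L[ℝ] E => A.det) A).comp H) v =
      A.det * LinearMap.trace ℝ E (B.comp (H v)) := fun v => fderiv_clm_det hB'
  -- The sign `s` of the Jacobian is constant near `y`, so the absolute value can be differentiated
  -- away.
  obtain ⟨s, hs, hs1⟩ : ∃ s : ℝ, |A.det| = s * A.det ∧
      (fun z => |(fderiv ℝ ψ z).det|) =ᶠ[𝓝 y] fun z => s * (fderiv ℝ ψ z).det := by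
    have hc : ContinuousAt (fun z => (fderiv ℝ ψ z).det) y := hdet.continuousAt
    rcases lt_or_gt_of_ne hdet0 with h | h
    · refine ⟨-1, by simp [abs_of_neg h], ?_⟩
      filter_upwards [hc.eventually (gt_mem_nhds h)] with z hz
      rw [abs_of_neg hz]; ring
    · refine ⟨1, by simp [abs_of_pos h], ?_⟩
      filter_upwards [hc.eventually (lt_mem_nhds h)] with z hz
      rw [abs_of_pos hz]; ring
  have hs0 : s * A.det ≠ 0 := by rw [← hs]; simpa using hdet0
  have hwa : HasFDerivAt wa ((s * A.det) • (fderiv ℝ wb (ψ y)).comp A +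
      wb (ψ y) • (s • (fderiv ℝ (fun A : E →L[ℝ] E => A.det) A).comp H)) y := by
    have h1 : wa =ᶠ[𝓝 y] fun z => (s * (fderiv ℝ ψ z).det) * wb (ψ z) := by
      filter_upwards [hw, hs1] with z h1 h2
      rw [h1, h2]
    refine HasFDerivAt.congr_of_eventuallyEq ?_ h1
    exact (hdet.const_mul s).mul (hwb.hasFDerivAt.comp y hψ1.hasFDerivAt)
  have hway : wa y = s * A.det * wb (ψ y) := by rw [hw.eq_of_nhds, ← hs]
  have hXby : Xb (ψ y) = A (Xa y) := hX.eq_of_nhds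
  -- derivative of the field
  have hX' : (fderiv ℝ Xb (ψ y)).comp A = A.comp (fderiv ℝ Xa y) + H.flip (Xa y) := by
    have h1 : HasFDerivAt (fun z => Xb (ψ z)) ((fderiv ℝ Xb (ψ y)).comp A) y :=
      hXb.hasFDerivAt.comp y hψ1.hasFDerivAt
    have h2 := hdψ.hasFDerivAt.clm_apply hXa.hasFDerivAt
    exact h1.unique (h2.congr_of_eventuallyEq hX)
  -- The second-order term `tr (B ∘ H(Xa))` produced here equals the logarithmic derivative of the
  -- Jacobian along `Xa`. The identification uses the symmetry of the second derivative `H`.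
  have htr : LinearMap.trace ℝ E (fderiv ℝ Xb (ψ y)) =
      LinearMap.trace ℝ E (fderiv ℝ Xa y) + LinearMap.trace ℝ E (B.comp (H (Xa y))) := by
    have e1 : fderiv ℝ Xb (ψ y) = (A.comp (fderiv ℝ Xa y) + H.flip (Xa y)).comp B := by
      rw [← hX', ContinuousLinearMap.comp_assoc, hB', ContinuousLinearMap.comp_id]
    have e2 : H.flip (Xa y) = H (Xa y) := by
      ext1 v
      exact hsymm v (Xa y)
    rw [e1, e2, clm_trace_comp_comm, ContinuousLinearMap.comp_add,
      ← ContinuousLinearMap.comp_assoc, hB, ContinuousLinearMap.id_comp]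
    simp
  rw [weighted_divergence_eq hwa.differentiableAt hXa, weighted_divergence_eq hwb hXb, hwa.fderiv,
    htr, hXby, hway]
  simp only [add_apply, smul_apply, hdet' (Xa y),
    ContinuousLinearMap.comp_apply, smul_eq_mul]
  have hs2 : s ≠ 0 := left_ne_zero_of_mul hs0
  field_simp
  ring

end Jacobi

/-! ### The divergence theorem in `ℝⁿ` for fields tangent to the boundary. -/

section EuclideanDivergence

theorem exists_deriv_smoothTransition_bound :
    ∃ C : ℝ, 0 ≤ C ∧ ∀ x, |deriv Real.smoothTransition x| ≤ C := by
  have hc : Continuous (deriv Real.smoothTransition) :=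
    (Real.smoothTransition.contDiff (n := 1)).continuous_deriv (by simp)
  have hs : HasCompactSupport (deriv Real.smoothTransition) := by
    refine HasCompactSupport.of_support_subset_isCompact (isCompact_Icc (a := (0 : ℝ)) (b := 1)) ?_
    intro x hx
    by_contra hx'
    apply hx
    rw [mem_Icc, not_and_or, not_le, not_le] at hx'
    rcases hx' with h | h
    · have : Real.smoothTransition =ᶠ[𝓝 x] fun _ => 0 := by
        filter_upwards [gt_mem_nhds h] with y hy using Real.smoothTransition.zero_of_nonpos hy.le
      rw [this.deriv_eq]; simp
    · have : Real.smoothTransition =ᶠ[𝓝 x] fun _ => 1 := by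
        filter_upwards [lt_mem_nhds h] with y hy using Real.smoothTransition.one_of_one_le hy.le
      rw [this.deriv_eq]; simp
  obtain ⟨C, hC⟩ := hc.bounded_above_of_compact_support hs
  exact ⟨C, (norm_nonneg _).trans (hC 0), hC⟩

theorem deriv_smoothTransition_of_one_lt {x : ℝ} (h : 1 < x) :
    deriv Real.smoothTransition x = 0 := by
  have : Real.smoothTransition =ᶠ[𝓝 x] fun _ => 1 := by
    filter_upwards [lt_mem_nhds h] with y hy using Real.smoothTransition.one_of_one_le hy.le
  rw [this.deriv_eq]; simp

variable {n : ℕ}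

local notation "E" => EuclideanSpace ℝ (Fin n)

/-- Integration by parts against the constant function `1`. -/
theorem integral_fderiv_apply_eq_zero {Z : E → ℝ} (hZ : ContDiff ℝ 1 Z) (hc : HasCompactSupport Z)
    (v : E) : ∫ x, fderiv ℝ Z x v = 0 := by
  have hZ' : Continuous fun x => fderiv ℝ Z x v :=
    (hZ.continuous_fderiv (by simp)).clm_apply continuous_const
  have hc' : HasCompactSupport fun x => fderiv ℝ Z x v := hc.fderiv_apply (𝕜 := ℝ) v
  have h := integral_bilinear_hasLineDerivAt_right_eq_neg_left_of_integrable
    (μ := (volume : Measure E)) (f := fun _ : E => (1 : ℝ)) (f' := fun _ => 0) (g := Z)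
    (g' := fun x => fderiv ℝ Z x v) (v := v) (B := ContinuousLinearMap.mul ℝ ℝ)
    (by simp) (by simpa using hZ'.integrable_of_hasCompactSupport hc')
    (by simpa using hZ.continuous.integrable_of_hasCompactSupport hc)
    (fun x _ => by simpa using (hasFDerivAt_const (𝕜 := ℝ) (1 : ℝ) x).hasLineDerivAt v)
    (fun x _ => ((hZ.differentiable (by simp)) x).hasFDerivAt.hasLineDerivAt v)
  simpa using h

theorem integral_trace_fderiv_eq_zero {Z : E → E} (hZ : ContDiff ℝ 1 Z)
    (hc : HasCompactSupport Z) : ∫ x, LinearMap.trace ℝ E (fderiv ℝ Z x) = 0 := by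
  have hi : ∀ i, ContDiff ℝ 1 fun z => Z z i := fun i =>
    (EuclideanSpace.proj (𝕜 := ℝ) i).contDiff.comp hZ
  have hci : ∀ i, HasCompactSupport fun z => Z z i := fun i =>
    hc.comp_left (g := fun u : E => u i) rfl
  have hd : ∀ x i, fderiv ℝ Z x (EuclideanSpace.single i 1) i =
      fderiv ℝ (fun z => Z z i) x (EuclideanSpace.single i 1) := by
    intro x i
    have := ((EuclideanSpace.proj (𝕜 := ℝ) i).hasFDerivAt.comp x
      ((hZ.differentiable (by simp)) x).hasFDerivAt)
    have h2 := this.fderiv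
    have h3 : (⇑(EuclideanSpace.proj i : E →L[ℝ] ℝ) ∘ Z) = fun z => Z z i := rfl
    rw [h3] at h2
    rw [h2]; rfl
  simp only [clm_trace_eq_sum, hd]
  rw [integral_finsetSum]
  · exact Finset.sum_eq_zero fun i _ => integral_fderiv_apply_eq_zero (hi i) (hci i) _
  · intro i _
    exact (((hi i).continuous_fderiv (by simp)).clm_apply
      continuous_const).integrable_of_hasCompactSupport ((hci i).fderiv_apply (𝕜 := ℝ) _)

theorem trace_fderiv_smul {c : E → ℝ} {Y : E → E} {z : E} (hc : DifferentiableAt ℝ c z)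
    (hY : DifferentiableAt ℝ Y z) :
    LinearMap.trace ℝ E (fderiv ℝ (fun z => c z • Y z) z) =
      c z * LinearMap.trace ℝ E (fderiv ℝ Y z) + fderiv ℝ c z (Y z) := by
  have hX : DifferentiableAt ℝ (fun z => c z • Y z) z := hc.smul hY
  have h := weighted_divergence_eq (w := fun _ => 1) (differentiableAt_const _) hX
  have h' := weighted_divergence_eq hc hY
  simp only [one_mul, fderiv_fun_const, Pi.zero_apply, zero_apply,
    zero_add] at h
  rw [← h, add_comm, ← h']
  rfl

/-- The divergence theorem near a boundary point `{ρ = 0}`, for a field tangent to the boundary. -/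
theorem integral_divergence_of_tangent {Ω W : Set E} (hΩ : IsOpen Ω) (hW : IsOpen W) {ρ : E → ℝ}
    (hρ : ContDiffOn ℝ 1 ρ W) (hΩW : Ω ∩ W = {z ∈ W | 0 < ρ z}) {Y : E → E}
    (hY : ContDiffOn ℝ 1 Y (Ω ∩ W)) {C : ℝ} (hYC : ∀ z ∈ Ω ∩ W, ‖Y z‖ ≤ C)
    (hdC : ∀ z ∈ Ω ∩ W, |LinearMap.trace ℝ E (fderiv ℝ Y z)| ≤ C)
    (hρC : ∀ z ∈ Ω ∩ W, |fderiv ℝ ρ z (Y z)| ≤ C * ρ z) {χ : E → ℝ} (hχ : ContDiff ℝ 1 χ)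
    (hχc : HasCompactSupport χ) (hχW : tsupport χ ⊆ W) :
    ∫ z in Ω, (χ z * LinearMap.trace ℝ E (fderiv ℝ Y z) + fderiv ℝ χ z (Y z)) = 0 := by
  have hO : IsOpen (Ω ∩ W) := hΩ.inter hW
  obtain ⟨Cs, hCs0, hCs⟩ := exists_deriv_smoothTransition_bound
  obtain ⟨C1, hC1⟩ := hχ.continuous.bounded_above_of_compact_support hχc
  obtain ⟨C2, hC2⟩ := (hχ.continuous_fderiv (by simp)).bounded_above_of_compact_support
    (hχc.fderiv (𝕜 := ℝ))
  have hC10 : 0 ≤ C1 := (norm_nonneg _).trans (hC1 0)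
  have hC20 : 0 ≤ C2 := (norm_nonneg _).trans (hC2 0)
  -- The cutoff is `0` for `t ≤ 1/(2(k+1))` and `1` for `t ≥ 1/(k+1)`. Vanishing on a neighbourhood
  -- of `t ≤ 0`, and not only there, is what lets `Z k` be extended by zero across the boundary.
  let η : ℕ → ℝ → ℝ := fun k t => Real.smoothTransition (2 * (k + 1) * t - 1)
  have hη : ∀ k, ContDiff ℝ 1 (η k) := fun k =>
    Real.smoothTransition.contDiff.comp ((contDiff_const.mul contDiff_id).sub contDiff_const)
  have hηd : ∀ k t, deriv (η k) t =
      2 * (k + 1) * deriv Real.smoothTransition (2 * (k + 1) * t - 1) := by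
    intro k t
    have h1 : HasDerivAt (fun t : ℝ => 2 * ((k : ℝ) + 1) * t - 1) (2 * (k + 1)) t := by
      simpa using ((hasDerivAt_id t).const_mul (2 * ((k : ℝ) + 1))).sub_const 1
    have h2 : HasDerivAt Real.smoothTransition (deriv Real.smoothTransition (2 * (k + 1) * t - 1))
        (2 * (k + 1) * t - 1) :=
      ((Real.smoothTransition.contDiff (n := 1)).differentiable (by simp)).differentiableAt.hasDerivAt
    rw [mul_comm]
    exact (h2.comp t h1).deriv
  let c : ℕ → E → ℝ := fun k z => χ z * η k (ρ z)
  let Z : ℕ → E → E := fun k => (Ω ∩ W).indicator fun z => c k z • Y z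
  have hρat : ∀ z ∈ W, ContDiffAt ℝ 1 ρ z := fun z hz => hρ.contDiffAt (hW.mem_nhds hz)
  have hcat : ∀ k, ∀ z ∈ W, ContDiffAt ℝ 1 (c k) z := fun k z hz =>
    hχ.contDiffAt.mul ((hη k).contDiffAt.comp z (hρat z hz))
  have hYat : ∀ z ∈ Ω ∩ W, ContDiffAt ℝ 1 Y z := fun z hz => hY.contDiffAt (hO.mem_nhds hz)
  have hZin : ∀ k, ∀ z ∈ Ω ∩ W, Z k =ᶠ[𝓝 z] fun z => c k z • Y z := by
    intro k z hz
    filter_upwards [hO.mem_nhds hz] with u hu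
    simp only [Z, indicator_of_mem hu]
  have hχ0 : ∀ z, z ∉ tsupport χ → χ =ᶠ[𝓝 z] fun _ => 0 := fun z hz =>
    notMem_tsupport_iff_eventuallyEq.1 hz
  have hZK : ∀ k z, z ∉ tsupport χ → Z k =ᶠ[𝓝 z] fun _ => 0 := by
    intro k z hz
    filter_upwards [hχ0 z hz] with u hu
    by_cases hu' : u ∈ Ω ∩ W
    · simp [Z, indicator_of_mem hu', c, hu]
    · simp [Z, indicator_of_notMem hu']
  have hZout : ∀ k, ∀ z, z ∉ Ω ∩ W → Z k =ᶠ[𝓝 z] fun _ => 0 := by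
    intro k z hz
    by_cases hzK : z ∈ tsupport χ
    · have hzW := hχW hzK
      have hzρ : ρ z ≤ 0 := by
        by_contra h
        exact hz (hΩW ▸ ⟨hzW, not_le.1 h⟩)
      have hlt : ρ z < 1 / (2 * (k + 1)) := hzρ.trans_lt (by positivity)
      filter_upwards [(hρat z hzW).continuousAt.eventually (gt_mem_nhds hlt)] with u hu
      have : η k (ρ u) = 0 := by
        apply Real.smoothTransition.zero_of_nonpos
        rw [lt_div_iff₀ (by positivity)] at hu
        linarith
      by_cases hu' : u ∈ Ω ∩ W
      · simp [Z, indicator_of_mem hu', c, this]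
      · simp [Z, indicator_of_notMem hu']
    · exact hZK k z hzK
  have hZC : ∀ k, ContDiff ℝ 1 (Z k) := by
    intro k
    rw [contDiff_iff_contDiffAt]
    intro z
    by_cases hz : z ∈ Ω ∩ W
    · exact ((hcat k z hz.2).smul (hYat z hz)).congr_of_eventuallyEq (hZin k z hz)
    · exact contDiffAt_const.congr_of_eventuallyEq (hZout k z hz)
  have hZc : ∀ k, HasCompactSupport (Z k) := by
    intro k
    refine HasCompactSupport.of_support_subset_isCompact hχc ?_
    intro z hz
    by_contra h
    exact hz ((hZK k z h).eq_of_nhds)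
  let g : ℕ → E → ℝ := fun k z => LinearMap.trace ℝ E (fderiv ℝ (Z k) z)
  have hgc : ∀ k, Continuous (g k) := by
    intro k
    simp only [g, clm_trace_eq_sum]
    refine continuous_finsetSum _ fun i _ => ?_
    exact (EuclideanSpace.proj (𝕜 := ℝ) i).continuous.comp
      (((hZC k).continuous_fderiv (by simp)).clm_apply continuous_const)
  have hgint : ∀ k, ∫ z in Ω, g k z = 0 := by
    intro k
    rw [setIntegral_eq_integral_of_forall_compl_eq_zero, integral_trace_fderiv_eq_zero (hZC k) (hZc k)]
    intro z hz
    simp only [g]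
    rw [(hZout k z (fun h => hz h.1)).fderiv_eq]
    simp
  let G : E → ℝ := fun z => χ z * LinearMap.trace ℝ E (fderiv ℝ Y z) + fderiv ℝ χ z (Y z)
  have hG0 : ∀ z, z ∉ tsupport χ → G z = 0 := by
    intro z hz
    simp only [G]
    rw [(hχ0 z hz).fderiv_eq, (hχ0 z hz).eq_of_nhds]
    simp
  have hg0 : ∀ k z, z ∉ tsupport χ → g k z = 0 := by
    intro k z hz
    simp only [g]
    rw [(hZK k z hz).fderiv_eq]
    simp
  -- The second summand is the boundary layer term, the only one in which the cutoff is
  -- differentiated.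
  have hgin : ∀ k, ∀ z ∈ Ω ∩ W, g k z = η k (ρ z) * G z +
      χ z * (deriv (η k) (ρ z) * fderiv ℝ ρ z (Y z)) := by
    intro k z hz
    simp only [g]
    rw [(hZin k z hz).fderiv_eq, trace_fderiv_smul ((hcat k z hz.2).differentiableAt (by simp))
      ((hYat z hz).differentiableAt (by simp))]
    have h1 : HasFDerivAt (fun z => η k (ρ z)) (deriv (η k) (ρ z) • fderiv ℝ ρ z) z :=
      HasDerivAt.comp_hasFDerivAt (h₂ := η k) z
        ((hη k).differentiable (by simp)).differentiableAt.hasDerivAt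
        ((hρat z hz.2).differentiableAt (by simp)).hasFDerivAt
    have h2 := ((hχ.differentiable (by simp)).differentiableAt (x := z)).hasFDerivAt.fun_mul h1
    rw [h2.fderiv]
    simp only [c, G, add_apply, smul_apply, smul_eq_mul]
    ring
  have hGb : ∀ z ∈ Ω ∩ W, |G z| ≤ C1 * C + C2 * C := by
    intro z hz
    refine (abs_add_le _ _).trans (add_le_add ?_ ?_)
    · rw [abs_mul]
      exact mul_le_mul (hC1 z) (hdC z hz) (abs_nonneg _) hC10
    · refine ((fderiv ℝ χ z).le_opNorm _).trans ?_
      exact mul_le_mul (hC2 z) (hYC z hz) (norm_nonneg _) hC20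
  have hgb : ∀ k, ∀ z ∈ Ω ∩ W, |g k z| ≤ (C1 * C + C2 * C) + C1 * (2 * Cs * C) := by
    intro k z hz
    have hρ0 : 0 < ρ z := (hΩW ▸ hz : z ∈ {z ∈ W | 0 < ρ z}).2
    have hC0 : 0 ≤ C := (norm_nonneg _).trans (hYC z hz)
    rw [hgin k z hz]
    refine (abs_add_le _ _).trans (add_le_add ?_ ?_)
    · rw [abs_mul, abs_of_nonneg (Real.smoothTransition.nonneg _)]
      calc η k (ρ z) * |G z| ≤ 1 * |G z| :=
            mul_le_mul_of_nonneg_right (Real.smoothTransition.le_one _) (abs_nonneg _)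
        _ ≤ _ := by rw [one_mul]; exact hGb z hz
    · rw [abs_mul]
      refine mul_le_mul (hC1 z) ?_ (abs_nonneg _) hC10
      rw [abs_mul]
      -- The derivative of `η k` grows like `k` but vanishes for `ρ > 1/(k+1)`, so its product with
      -- `ρ` is bounded independently of `k`.
      have h1 : |deriv (η k) (ρ z)| * ρ z ≤ 2 * Cs := by
        rw [hηd, abs_mul, abs_of_nonneg (by positivity : (0:ℝ) ≤ 2 * (k + 1))]
        by_cases h : 1 < 2 * (k + 1) * ρ z - 1
        · rw [deriv_smoothTransition_of_one_lt h]; simpa using hCs0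
        · have h2 : 2 * (k + 1) * ρ z ≤ 2 := by linarith
          calc 2 * ((k:ℝ) + 1) * |deriv Real.smoothTransition (2 * (k + 1) * ρ z - 1)| * ρ z
              = (2 * (k + 1) * ρ z) * |deriv Real.smoothTransition (2 * (k + 1) * ρ z - 1)| := by
                ring
            _ ≤ 2 * Cs := mul_le_mul h2 (hCs _) (abs_nonneg _) (by norm_num)
      calc |deriv (η k) (ρ z)| * |fderiv ℝ ρ z (Y z)|
          ≤ |deriv (η k) (ρ z)| * (C * ρ z) :=
            mul_le_mul_of_nonneg_left (hρC z hz) (abs_nonneg _)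
        _ = (|deriv (η k) (ρ z)| * ρ z) * C := by ring
        _ ≤ 2 * Cs * C := mul_le_mul_of_nonneg_right h1 hC0
  have hlim : ∀ z ∈ Ω, Tendsto (fun k => g k z) atTop (𝓝 (G z)) := by
    intro z hz
    by_cases hzK : z ∈ tsupport χ
    · have hzO : z ∈ Ω ∩ W := ⟨hz, hχW hzK⟩
      have hρ0 : 0 < ρ z := (hΩW ▸ hzO : z ∈ {z ∈ W | 0 < ρ z}).2
      -- At a fixed point with `ρ z > 0` the sequence is eventually constant: once `1/(k+1) < ρ z`,
      -- the cutoff is `1` with zero derivative.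
      refine tendsto_const_nhds.congr' ?_
      filter_upwards [(tendsto_natCast_atTop_atTop (R := ℝ)).eventually_gt_atTop (1 / ρ z)]
        with k hk
      have h1 : 1 < 2 * ((k : ℝ) + 1) * ρ z - 1 := by
        rw [div_lt_iff₀ hρ0] at hk
        nlinarith
      rw [hgin k z hzO, hηd, deriv_smoothTransition_of_one_lt h1]
      simp only [η, Real.smoothTransition.one_of_one_le h1.le]
      ring
    · simp only [hG0 z hzK, hg0 _ z hzK]
      exact tendsto_const_nhds
  have hdom := tendsto_integral_of_dominated_convergence (μ := volume.restrict Ω) (F := g) (f := G)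
    ((tsupport χ).indicator fun _ => (C1 * C + C2 * C) + C1 * (2 * Cs * C))
    (fun k => (hgc k).aestronglyMeasurable)
    (by
      refine Integrable.mono_measure ?_ Measure.restrict_le_self
      rw [integrable_indicator_iff (isClosed_tsupport χ).measurableSet]
      exact integrableOn_const hχc.measure_lt_top.ne)
    (fun k => by
      filter_upwards [ae_restrict_mem hΩ.measurableSet] with z hz
      by_cases hzK : z ∈ tsupport χ
      · rw [indicator_of_mem hzK]
        exact hgb k z ⟨hz, hχW hzK⟩
      · rw [indicator_of_notMem hzK, hg0 k z hzK]; simp)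
    (by
      filter_upwards [ae_restrict_mem hΩ.measurableSet] with z hz
      exact hlim z hz)
  simp only [hgint] at hdom
  exact (tendsto_nhds_unique hdom tendsto_const_nhds)

/-- A function vanishing on the boundary `{ρ = 0}` with bounded derivative is `O(ρ)`. -/
theorem abs_le_mul_of_tendsto_zero_boundary {F : Type*} [NormedAddCommGroup F] [NormedSpace ℝ F]
    {Ω U : Set F} {y : F} {ρ h : F → ℝ}
    (hU : U ∈ 𝓝 y) (hρ : ContDiffAt ℝ 1 ρ y) (hρ0 : ρ y = 0) (hdρ : fderiv ℝ ρ y ≠ 0)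
    (hΩ : Ω ∩ U = {z ∈ U | 0 < ρ z}) {C : ℝ}
    (hh : ∀ z ∈ Ω ∩ U, DifferentiableAt ℝ h z) (hC : ∀ z ∈ Ω ∩ U, ‖fderiv ℝ h z‖ ≤ C)
    (hlim : ∀ z ∈ U, ρ z = 0 → Tendsto h (𝓝[Ω] z) (𝓝 0)) :
    ∃ C', ∃ W ∈ 𝓝 y, ∀ z ∈ Ω ∩ W, |h z| ≤ C' * ρ z := by
  obtain ⟨v, hv⟩ : ∃ v, 0 < fderiv ℝ ρ y v := by
    by_contra! H
    apply hdρ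
    ext v
    have h1 := H v
    have h2 := H (-v)
    simp only [map_neg] at h2
    simpa using le_antisymm h1 (by linarith)
  -- From `z`, move along `-v`: `ρ` decreases at rate at least `c`, so the boundary is reached at a
  -- time `t0 ≤ ρ z / c`. Integrating the derivative of `h` along this segment gives the bound.
  set c := fderiv ℝ ρ y v / 2 with hc
  have hc0 : 0 < c := by positivity
  have hcont : ∀ᶠ z in 𝓝 y, c < fderiv ℝ ρ z v := by
    have h1 : ContinuousAt (fun z => fderiv ℝ ρ z v) y :=
      (hρ.fderiv_right (m := 0) (by norm_num)).continuousAt.clm_apply continuousAt_const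
    exact h1.eventually (lt_mem_nhds (by rw [hc]; linarith))
  have hdiff : ∀ᶠ z in 𝓝 y, DifferentiableAt ℝ ρ z := by
    filter_upwards [hρ.eventually (by simp)] with z hz using hz.differentiableAt (by simp)
  obtain ⟨r, hr, hball⟩ : ∃ r > 0, Metric.ball y r ⊆
      {z | z ∈ U ∧ c < fderiv ℝ ρ z v ∧ DifferentiableAt ℝ ρ z} :=
    Metric.mem_nhds_iff.1 (Filter.Eventually.and hU (hcont.and hdiff))
  -- `T` keeps the segment from the half ball inside the full ball; the restriction `ρ z < c * T` on
  -- `W` then forces `ρ` to vanish before time `T`.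
  set T := r / (2 * (‖v‖ + 1)) with hT
  have hT0 : 0 < T := by positivity
  have hTv : T * ‖v‖ < r / 2 := by
    have h0 : 0 < 2 * (‖v‖ + 1) := by positivity
    have : T * (2 * (‖v‖ + 1)) = r := by rw [hT]; field_simp
    nlinarith
  have hsmall : ∀ᶠ z in 𝓝 y, ρ z < c * T := by
    refine hρ.continuousAt.eventually (gt_mem_nhds ?_)
    rw [hρ0]; positivity
  refine ⟨C * ‖v‖ / c, Metric.ball y (r / 2) ∩ {z | ρ z < c * T},
    inter_mem (Metric.ball_mem_nhds y (by positivity)) hsmall, ?_⟩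
  rintro z ⟨hzΩ, hzb, hzs⟩
  have hseg : ∀ t ∈ Icc 0 T, z - t • v ∈ Metric.ball y r := by
    intro t ht
    rw [Metric.mem_ball, dist_eq_norm] at hzb ⊢
    calc ‖z - t • v - y‖ = ‖(z - y) - t • v‖ := by congr 1; abel
      _ ≤ ‖z - y‖ + ‖t • v‖ := norm_sub_le _ _
      _ ≤ ‖z - y‖ + T * ‖v‖ := by
        rw [norm_smul, Real.norm_of_nonneg ht.1]
        gcongr
        exact ht.2
      _ < r := by linarith
  have hline : ∀ t, HasDerivAt (fun t : ℝ => z - t • v) (-v) t := by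
    intro t
    simpa using ((hasDerivAt_id t).smul_const v).const_sub z
  let g : ℝ → ℝ := fun t => ρ (z - t • v)
  have hg : ∀ t ∈ Icc 0 T, HasDerivAt g (-(fderiv ℝ ρ (z - t • v) v)) t := by
    intro t ht
    have := ((hball (hseg t ht)).2.2.hasFDerivAt).comp_hasDerivAt t (hline t)
    rw [map_neg] at this
    exact this
  have hgle : ∀ s ∈ Icc 0 T, ∀ t ∈ Icc 0 T, s ≤ t → g t - g s ≤ -c * (t - s) := by
    refine Convex.image_sub_le_mul_sub_of_deriv_le (convex_Icc 0 T)
      (fun t ht => (hg t ht).continuousAt.continuousWithinAt)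
      (fun t ht => (hg t (interior_subset ht)).differentiableAt.differentiableWithinAt) ?_
    intro t ht
    rw [(hg t (interior_subset ht)).deriv]
    linarith [(hball (hseg t (interior_subset ht))).2.1]
  have hg0 : g 0 = ρ z := by simp [g]
  have hρz : 0 < ρ z := by
    have : z ∈ Ω ∩ U := ⟨hzΩ, by simpa using (hball (hseg 0 ⟨le_rfl, hT0.le⟩)).1⟩
    exact (hΩ ▸ this : z ∈ {z ∈ U | 0 < ρ z}).2
  have hgT : g T < 0 := by
    have := hgle 0 ⟨le_rfl, hT0.le⟩ T ⟨hT0.le, le_rfl⟩ hT0.le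
    rw [hg0] at this
    have hzs' : ρ z < c * T := hzs
    linarith
  obtain ⟨t0, ht0, hgt0⟩ : ∃ t0 ∈ Icc 0 T, g t0 = 0 :=
    intermediate_value_Icc' hT0.le (fun t ht => (hg t ht).continuousAt.continuousWithinAt)
      ⟨hgT.le, by rw [hg0]; exact hρz.le⟩
  have ht0pos : 0 < t0 := by
    rcases ht0.1.lt_or_eq with h | h
    · exact h
    · rw [← h, hg0] at hgt0; exact absurd hgt0 hρz.ne'
  have ht0c : t0 ≤ ρ z / c := by
    have := hgle 0 ⟨le_rfl, hT0.le⟩ t0 ht0 ht0.1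
    rw [hg0, hgt0] at this
    rw [le_div_iff₀ hc0]; linarith
  have hin : ∀ t ∈ Ico 0 t0, z - t • v ∈ Ω ∩ U := by
    intro t ht
    have htT : t ∈ Icc 0 T := ⟨ht.1, ht.2.le.trans ht0.2⟩
    rw [hΩ]
    refine ⟨(hball (hseg t htT)).1, ?_⟩
    have := hgle t htT t0 ht0 ht.2.le
    rw [hgt0] at this
    have h3 : 0 < c * (t0 - t) := mul_pos hc0 (sub_pos.2 ht.2)
    change 0 < g t
    linarith
  have hC0 : 0 ≤ C := (norm_nonneg _).trans (hC _ (hin 0 ⟨le_rfl, ht0pos⟩))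
  have hb : ∀ t ∈ Ico 0 t0, |h z| ≤ |h (z - t • v)| + C * ‖v‖ * t0 := by
    intro t ht
    have hd : ∀ s ∈ Icc 0 t, HasDerivWithinAt (fun s => h (z - s • v))
        (-(fderiv ℝ h (z - s • v) v)) (Icc 0 t) s := by
      intro s hs
      have := ((hh _ (hin s ⟨hs.1, hs.2.trans_lt ht.2⟩)).hasFDerivAt).comp_hasDerivAt s (hline s)
      rw [map_neg] at this
      exact this.hasDerivWithinAt
    have hb' : ∀ s ∈ Ico 0 t, ‖-(fderiv ℝ h (z - s • v) v)‖ ≤ C * ‖v‖ := by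
      intro s hs
      rw [norm_neg]
      exact (ContinuousLinearMap.le_opNorm _ _).trans
        (mul_le_mul_of_nonneg_right (hC _ (hin s ⟨hs.1, hs.2.trans ht.2⟩)) (norm_nonneg _))
    have := norm_image_sub_le_of_norm_deriv_le_segment' hd hb' t ⟨ht.1, le_rfl⟩
    simp only [zero_smul, sub_zero, Real.norm_eq_abs] at this
    have h2 : C * ‖v‖ * t ≤ C * ‖v‖ * t0 := mul_le_mul_of_nonneg_left ht.2.le (by positivity)
    have h3 := abs_sub_abs_le_abs_sub (h z) (h (z - t • v))
    rw [abs_sub_comm] at h3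
    linarith
  -- The mean value estimate holds only for `t < t0`, since `h` is controlled inside `Ω` only; the
  -- boundary value enters as a limit from within.
  have htend : Tendsto (fun t : ℝ => z - t • v) (𝓝[<] t0) (𝓝[Ω] (z - t0 • v)) := by
    refine tendsto_nhdsWithin_iff.2 ⟨((hline t0).continuousAt.tendsto).mono_left inf_le_left, ?_⟩
    filter_upwards [Ico_mem_nhdsLT ht0pos] with t ht using (hin t ht).1
  have hlim0 := (hlim (z - t0 • v) (hball (hseg t0 ht0)).1 hgt0).comp htend
  have hfin : |h z| ≤ |(0 : ℝ)| + C * ‖v‖ * t0 := by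
    refine ge_of_tendsto ((hlim0.abs).add_const (C * ‖v‖ * t0)) ?_
    filter_upwards [Ico_mem_nhdsLT ht0pos] with t ht using hb t ht
  rw [abs_zero, zero_add] at hfin
  calc |h z| ≤ C * ‖v‖ * t0 := hfin
    _ ≤ C * ‖v‖ * (ρ z / c) := mul_le_mul_of_nonneg_left ht0c (by positivity)
    _ = C * ‖v‖ / c * ρ z := by ring

end EuclideanDivergence

/-! ### Compactness of bounded closed sets in a complete Riemannian manifold. -/

section HopfRinow

/-- In a complete locally compact metric space in which distances split approximately, bounded
closed sets are compact. -/
theorem isCompact_closedBall_of_dist_split {M : Type*} [MetricSpace M] [CompleteSpace M]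
    [LocallyCompactSpace M]
    (hsplit : ∀ (x z : M) (a b : ℝ), 0 < a → 0 < b → dist x z < a + b →
      ∃ y, dist x y < a ∧ dist y z < b) (p : M) (r : ℝ) : IsCompact (Metric.closedBall p r) := by
  -- A compact ball has a compact neighbourhood, which contains a thickening of the ball. Splitting
  -- distances shows that this thickening contains a larger ball; radius `0` is separate because the
  -- splitting hypothesis requires positive radii.
  have step : ∀ s : ℝ, 0 ≤ s → IsCompact (Metric.closedBall p s) →
      ∃ δ > 0, IsCompact (Metric.closedBall p (s + δ)) := by
    intro s hs hK
    obtain ⟨L, hL, hKL⟩ := exists_compact_superset hK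
    obtain ⟨δ, hδ, hδL⟩ := hK.exists_thickening_subset_open isOpen_interior hKL
    refine ⟨δ / 2, by positivity, hL.of_isClosed_subset Metric.isClosed_closedBall ?_⟩
    intro z hz
    rw [Metric.mem_closedBall, dist_comm] at hz
    apply interior_subset
    apply hδL
    rcases hs.lt_or_eq with h | h
    · obtain ⟨y, hy1, hy2⟩ := hsplit p z s δ h hδ (by linarith)
      exact Metric.mem_thickening_iff.2 ⟨y, by
        rw [Metric.mem_closedBall, dist_comm]; exact hy1.le, by rw [dist_comm]; exact hy2⟩
    · subst h
      exact Metric.mem_thickening_iff.2 ⟨p, by simp, by rw [dist_comm]; linarith⟩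
  -- Each point of the limiting ball is within `ε/2` of a slightly smaller, compact ball, so a
  -- finite `ε/2`-net there is an `ε`-net here; completeness does the rest.
  have limit : ∀ s : ℝ, 0 < s → (∀ t, t < s → IsCompact (Metric.closedBall p t)) →
      IsCompact (Metric.closedBall p s) := by
    intro s hs H
    refine TotallyBounded.isCompact_of_isClosed ?_ Metric.isClosed_closedBall
    rw [Metric.totallyBounded_iff]
    intro ε hε
    -- The minimum with `s` keeps the smaller radius `s - ε' / 4` positive.
    set ε' := min ε s with hε'
    have hε0 : 0 < ε' := lt_min hε hs
    have hεs : ε' ≤ s := min_le_right _ _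
    obtain ⟨t, ht, htc⟩ := Metric.totallyBounded_iff.1
      (H (s - ε' / 4) (by linarith)).totallyBounded (ε / 2) (by positivity)
    refine ⟨t, ht, ?_⟩
    intro z hz
    rw [Metric.mem_closedBall, dist_comm] at hz
    obtain ⟨y, hy1, hy2⟩ := hsplit p z (s - ε' / 4) (ε / 2) (by linarith) (by positivity)
      (by have := min_le_left ε s; linarith)
    have hy : y ∈ Metric.closedBall p (s - ε' / 4) := by
      rw [Metric.mem_closedBall, dist_comm]; exact hy1.le
    obtain ⟨w, hw, hyw⟩ := mem_iUnion₂.1 (htc hy)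
    refine mem_iUnion₂.2 ⟨w, hw, ?_⟩
    rw [Metric.mem_ball] at hyw ⊢
    calc dist z w ≤ dist z y + dist y w := dist_triangle _ _ _
      _ < ε := by rw [dist_comm z y]; linarith
  by_contra hr
  set A := {s : ℝ | IsCompact (Metric.closedBall p s)} with hA
  have hdown : ∀ s ∈ A, ∀ t ≤ s, t ∈ A := fun s hs t ht =>
    IsCompact.of_isClosed_subset hs Metric.isClosed_closedBall (Metric.closedBall_subset_closedBall ht)
  have h0 : (0 : ℝ) ∈ A := by simp [hA]
  have hbdd : BddAbove A := ⟨r, fun s hs => by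
    by_contra h
    exact hr (hdown s hs r (not_le.1 h).le)⟩
  obtain ⟨δ, hδ, hδA⟩ := step 0 le_rfl h0
  have hsup0 : 0 < sSup A := lt_of_lt_of_le (by linarith : (0:ℝ) < 0 + δ) (le_csSup hbdd hδA)
  have hsup : sSup A ∈ A := by
    refine limit _ hsup0 fun t ht => ?_
    obtain ⟨s, hs, hts⟩ := exists_lt_of_lt_csSup ⟨0, h0⟩ ht
    exact hdown s hs t hts.le
  obtain ⟨δ', hδ', hδA'⟩ := step _ hsup0.le hsup
  have := le_csSup hbdd hδA'
  linarith

/-- Distance is an infimum of path lengths. On a path from `x` to `z` of length less than `a + b`,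
the intermediate value theorem yields a point at distance slightly less than `a` from `x`, and what
is left of the length is less than `b`. -/
theorem exists_dist_lt_dist_lt {n : ℕ} {M : Type*} [MetricSpace M]
    [ChartedSpace (EuclideanSpace ℝ (Fin n)) M]
    [Bundle.RiemannianBundle (fun x : M => TangentSpace (𝓡 n) x)]
    [IsRiemannianManifold (𝓡 n) M] (x z : M) (a b : ℝ) (ha : 0 < a) (hb : 0 < b)
    (h : dist x z < a + b) : ∃ y, dist x y < a ∧ dist y z < b := by
  by_cases hxa : dist x z < a
  · exact ⟨z, hxa, by simpa using hb⟩
  have h1 : Manifold.riemannianEDist (𝓡 n) x z < ENNReal.ofReal (a + b) := by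
    rw [← IsRiemannianManifold.out, edist_dist]
    exact (ENNReal.ofReal_lt_ofReal_iff (by positivity)).2 h
  obtain ⟨γ, hγ0, hγ1, hγ, hlen⟩ := Manifold.exists_lt_of_riemannianEDist_lt h1
  set ℓ := Manifold.pathELength (𝓡 n) γ 0 1 with hℓ
  have hℓtop : ℓ ≠ ⊤ := (hlen.trans ENNReal.ofReal_lt_top).ne
  have hℓab : ℓ.toReal < a + b := (ENNReal.lt_ofReal_iff_toReal_lt hℓtop).1 hlen
  -- `a' > ℓ - b` makes the remaining length `ℓ - a'` smaller than `b`.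
  obtain ⟨a', ha'1, ha'2⟩ := exists_between (show max 0 (ℓ.toReal - b) < a from
    max_lt ha (by linarith))
  have ha'0 : 0 < a' := (le_max_left _ _).trans_lt ha'1
  have ha'b : ℓ.toReal - b < a' := (le_max_right _ _).trans_lt ha'1
  have hcont : ContinuousOn (fun t => dist x (γ t)) (Icc 0 1) :=
    Continuous.comp_continuousOn (by fun_prop : Continuous fun y => dist x y) hγ.continuousOn
  obtain ⟨t, ht, hta⟩ := intermediate_value_Icc zero_le_one hcont
    (show a' ∈ Icc (dist x (γ 0)) (dist x (γ 1)) by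
      rw [hγ0, hγ1, dist_self]; exact ⟨ha'0.le, by linarith [not_lt.1 hxa]⟩)
  simp only at hta
  refine ⟨γ t, by rw [hta]; exact ha'2, ?_⟩
  have hadd := Manifold.pathELength_add (I := 𝓡 n) (γ := γ) ht.1 ht.2
  have e1 : edist x (γ t) ≤ Manifold.pathELength (𝓡 n) γ 0 t := by
    rw [IsRiemannianManifold.out (I := 𝓡 n) x (γ t)]
    exact Manifold.riemannianEDist_le_pathELength (hγ.mono (Icc_subset_Icc_right ht.2)) hγ0 rfl ht.1
  have e2 : edist (γ t) z ≤ Manifold.pathELength (𝓡 n) γ t 1 := by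
    rw [IsRiemannianManifold.out (I := 𝓡 n) (γ t) z]
    exact Manifold.riemannianEDist_le_pathELength (hγ.mono (Icc_subset_Icc_left ht.1)) rfl hγ1 ht.2
  have e3 : edist x (γ t) + edist (γ t) z ≤ ℓ := by
    rw [hℓ, ← hadd]; exact add_le_add e1 e2
  rw [edist_dist, edist_dist, ← ENNReal.ofReal_add dist_nonneg dist_nonneg] at e3
  have e4 := (ENNReal.ofReal_le_iff_le_toReal hℓtop).1 e3
  linarith

theorem isCompact_closure_of_isBounded {n : ℕ} {M : Type*} [MetricSpace M]
    [ChartedSpace (EuclideanSpace ℝ (Fin n)) M]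
    [Bundle.RiemannianBundle (fun x : M => TangentSpace (𝓡 n) x)]
    [IsRiemannianManifold (𝓡 n) M] [CompleteSpace M] {D : Set M} (hD : Bornology.IsBounded D) :
    IsCompact (closure D) := by
  rcases D.eq_empty_or_nonempty with rfl | ⟨p, hp⟩
  · simp
  have : LocallyCompactSpace M := ChartedSpace.locallyCompactSpace (EuclideanSpace ℝ (Fin n)) M
  obtain ⟨r, hr⟩ := hD.subset_closedBall p
  exact (isCompact_closedBall_of_dist_split (exists_dist_lt_dist_lt (n := n)) p r).of_isClosed_subset
    isClosed_closure (closure_minimal hr Metric.isClosed_closedBall)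

end HopfRinow

/-! ### Coordinate frames and the metric matrix. -/

section ChartGeometry

variable {n : ℕ} {M : Type*} [MetricSpace M]
  [ChartedSpace (EuclideanSpace ℝ (Fin n)) M] [IsManifold (𝓡 n) ∞ M]
  [Bundle.RiemannianBundle (fun x : M => TangentSpace (𝓡 n) x)]

local notation "E" => EuclideanSpace ℝ (Fin n)

theorem isOpen_chart_target (α : M) : IsOpen (extChartAt (𝓡 n) α).target :=
  isOpen_extChartAt_target α

theorem contMDiffOn_chart (α : M) :
    ContMDiffOn (𝓡 n) 𝓘(ℝ, E) ∞ (extChartAt (𝓡 n) α) (extChartAt (𝓡 n) α).source := by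
  rw [extChartAt_source]
  exact contMDiffOn_extChartAt

theorem contMDiffOn_chart_symm (α : M) :
    ContMDiffOn 𝓘(ℝ, E) (𝓡 n) ∞ (extChartAt (𝓡 n) α).symm (extChartAt (𝓡 n) α).target :=
  contMDiffOn_extChartAt_symm α

theorem contMDiffAt_chart_symm {α : M} {y : E} (hy : y ∈ (extChartAt (𝓡 n) α).target) :
    ContMDiffAt 𝓘(ℝ, E) (𝓡 n) ∞ (extChartAt (𝓡 n) α).symm y :=
  (contMDiffOn_chart_symm α).contMDiffAt ((isOpen_chart_target α).mem_nhds hy)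

theorem mdifferentiableAt_chart_symm {α : M} {y : E} (hy : y ∈ (extChartAt (𝓡 n) α).target) :
    MDifferentiableAt 𝓘(ℝ, E) (𝓡 n) (extChartAt (𝓡 n) α).symm y :=
  (contMDiffAt_chart_symm hy).mdifferentiableAt (by simp)

theorem mdifferentiableAt_chart {α x : M} (hx : x ∈ (extChartAt (𝓡 n) α).source) :
    MDifferentiableAt (𝓡 n) 𝓘(ℝ, E) (extChartAt (𝓡 n) α) x :=
  mdifferentiableAt_extChartAt (by rwa [extChartAt_source] at hx)

/-- The differential of the inverse chart. -/
def chartFrame (α : M) (y : E) : E →L[ℝ] TangentSpace (𝓡 n) ((extChartAt (𝓡 n) α).symm y) :=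
  mfderiv (𝓡 n) (𝓡 n) (extChartAt (𝓡 n) α).symm y

/-- The differential of the chart. -/
def chartCoframe (α : M) (x : M) : TangentSpace (𝓡 n) x →L[ℝ] E :=
  mfderiv (𝓡 n) (𝓡 n) (extChartAt (𝓡 n) α) x

theorem chartCoframe_chartFrame {α : M} {y : E} (hy : y ∈ (extChartAt (𝓡 n) α).target) (v : E) :
    chartCoframe α ((extChartAt (𝓡 n) α).symm y) (chartFrame α y v) = v := by
  have := mfderiv_extChartAt_comp_mfderivWithin_extChartAt_symm (I := 𝓡 n) hy
  rw [modelWithCornersSelf_coe, range_id, mfderivWithin_univ] at this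
  exact congrArg (fun L => L v) this

theorem chartFrame_chartCoframe {α : M} {y : E} (hy : y ∈ (extChartAt (𝓡 n) α).target)
    (v : TangentSpace (𝓡 n) ((extChartAt (𝓡 n) α).symm y)) :
    chartFrame α y (chartCoframe α ((extChartAt (𝓡 n) α).symm y) v) = v := by
  have := mfderivWithin_extChartAt_symm_comp_mfderiv_extChartAt (I := 𝓡 n) hy
  rw [modelWithCornersSelf_coe, range_id, mfderivWithin_univ] at this
  exact congrArg (fun L => L v) this

theorem coordVector_eq (α : M) (y : E) (i : Fin n) :
    coordVector n α y i = chartFrame α y (EuclideanSpace.single i 1) := rfl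

theorem coordField_eq (α : M) (X : ∀ x : M, TangentSpace (𝓡 n) x) (y : E) :
    coordField n α X y = chartCoframe α ((extChartAt (𝓡 n) α).symm y)
      (X ((extChartAt (𝓡 n) α).symm y)) := rfl

theorem chartFrame_eq_sum (α : M) (y v : E) :
    chartFrame α y v = ∑ i, v i • coordVector n α y i := by
  have hsum : v = ∑ i, v i • EuclideanSpace.single i (1 : ℝ) := by
    have := (EuclideanSpace.basisFun (Fin n) ℝ).sum_repr v
    simpa using this.symm
  conv_lhs => rw [hsum]
  simp only [map_sum, map_smul, coordVector_eq]

theorem inner_chartFrame (α : M) (y u v : E) :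
    inner ℝ (chartFrame α y u) (chartFrame α y v) =
      ∑ i, ∑ j, u i * metricMatrix n α y i j * v j := by
  rw [chartFrame_eq_sum, chartFrame_eq_sum, sum_inner]
  refine Finset.sum_congr rfl fun i _ => ?_
  rw [inner_sum]
  refine Finset.sum_congr rfl fun j _ => ?_
  rw [real_inner_smul_left, real_inner_smul_right]
  simp only [metricMatrix, Matrix.of_apply]
  ring

theorem metricMatrix_posDef {α : M} {y : E} (hy : y ∈ (extChartAt (𝓡 n) α).target) :
    (metricMatrix n α y).PosDef := by
  refine Matrix.PosDef.of_dotProduct_mulVec_pos ?_ ?_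
  · ext i j
    simp only [metricMatrix, Matrix.conjTranspose_apply, Matrix.of_apply, star_trivial]
    exact real_inner_comm _ _
  · intro v hv
    have h1 : 0 < inner ℝ (chartFrame α y (WithLp.toLp 2 v)) (chartFrame α y (WithLp.toLp 2 v)) := by
      rw [real_inner_self_pos]
      intro h0
      apply hv
      have := chartCoframe_chartFrame hy (WithLp.toLp 2 v)
      rw [h0, map_zero] at this
      simpa using congrArg WithLp.ofLp this.symm
    rw [inner_chartFrame] at h1
    simpa [dotProduct, Matrix.mulVec, Finset.mul_sum, mul_assoc] using h1

theorem metricMatrix_det_pos {α : M} {y : E} (hy : y ∈ (extChartAt (𝓡 n) α).target) :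
    0 < (metricMatrix n α y).det := (metricMatrix_posDef hy).det_pos

theorem volumeDensity_pos {α : M} {y : E} (hy : y ∈ (extChartAt (𝓡 n) α).target) :
    0 < volumeDensity n α y := Real.sqrt_pos.2 (metricMatrix_det_pos hy)

section Smooth

variable [IsContMDiffRiemannianBundle (𝓡 n) ∞ (EuclideanSpace ℝ (Fin n))
      (fun x : M => TangentSpace (𝓡 n) x)]

/-- The differential of the inverse chart is the inverse of the tangent bundle trivialization at
`α`, so a constant coordinate vector gives a smooth section. Smoothness of the metric then makes the
coefficients `g_ij` smooth. -/
theorem contMDiffAt_chartFrame {α : M} {y : E} (hy : y ∈ (extChartAt (𝓡 n) α).target) (v : E) :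
    ContMDiffAt 𝓘(ℝ, E) ((𝓡 n).prod 𝓘(ℝ, E)) ∞
      (fun z => (⟨(extChartAt (𝓡 n) α).symm z, chartFrame α z v⟩ : TangentBundle (𝓡 n) M)) y := by
  set e := trivializationAt E (TangentSpace (𝓡 n) : M → Type _) α with he
  have hmem : ∀ z ∈ (extChartAt (𝓡 n) α).target, (extChartAt (𝓡 n) α).symm z ∈ (chartAt E α).source := by
    intro z hz
    have := (extChartAt (𝓡 n) α).map_target hz
    rwa [extChartAt_source] at this
  have h1 : ContMDiffAt 𝓘(ℝ, E) ((𝓡 n).prod 𝓘(ℝ, E)) ∞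
      (fun z => ((extChartAt (𝓡 n) α).symm z, v)) y :=
    (contMDiffAt_chart_symm hy).prodMk contMDiffAt_const
  have h2 : ContMDiffAt ((𝓡 n).prod 𝓘(ℝ, E)) ((𝓡 n).prod 𝓘(ℝ, E)) ∞
      e.toOpenPartialHomeomorph.symm ((extChartAt (𝓡 n) α).symm y, v) := by
    refine (e.contMDiffOn_symm (IB := 𝓡 n) (n := ∞)).contMDiffAt ?_
    refine e.open_target.mem_nhds ?_
    rw [e.target_eq]
    exact ⟨by simpa [he] using hmem y hy, mem_univ _⟩
  refine (h2.comp y h1).congr_of_eventuallyEq ?_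
  filter_upwards [(isOpen_chart_target α).mem_nhds hy] with z hz
  have hb : (extChartAt (𝓡 n) α).symm z ∈ e.baseSet := by simpa [he] using hmem z hz
  rw [Function.comp_apply]
  have h3 := TangentBundle.symmL_trivializationAt (I := 𝓡 n) (hmem z hz)
  rw [modelWithCornersSelf_coe, range_id, mfderivWithin_univ,
    (extChartAt (𝓡 n) α).right_inv hz] at h3
  have h4 : chartFrame α z v = e.symm ((extChartAt (𝓡 n) α).symm z) v := by
    have := congrArg (fun L => L v) h3
    exact this.symm.trans (Bundle.Trivialization.symmL_apply (R := ℝ) _ hb v)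
  rw [h4]
  exact e.mk_symm hb v

theorem contDiffAt_metricMatrix {α : M} {y : E} (hy : y ∈ (extChartAt (𝓡 n) α).target)
    (i j : Fin n) : ContDiffAt ℝ ∞ (fun z => metricMatrix n α z i j) y := by
  rw [← contMDiffAt_iff_contDiffAt]
  exact ContMDiffAt.inner_bundle (contMDiffAt_chartFrame hy _) (contMDiffAt_chartFrame hy _)

end Smooth

end ChartGeometry

/-! ### Gradient, carré du champ and diffusion operator in a chart. -/

section ChartOperators

variable {n : ℕ} {M : Type*} [MetricSpace M]
  [ChartedSpace (EuclideanSpace ℝ (Fin n)) M] [IsManifold (𝓡 n) ∞ M]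
  [Bundle.RiemannianBundle (fun x : M => TangentSpace (𝓡 n) x)]

local notation "E" => EuclideanSpace ℝ (Fin n)

/-- The Riemannian gradient in the chart at `α`. -/
def chartGrad (α : M) (F : E → ℝ) (y : E) : E :=
  WithLp.toLp 2 (Matrix.mulVec (metricMatrix n α y)⁻¹
    fun j => fderiv ℝ F y (EuclideanSpace.single j 1))

/-- The carré du champ in the chart at `α`. -/
def chartGamma (α : M) (F G : E → ℝ) (y : E) : ℝ := fderiv ℝ F y (chartGrad α G y)

/-- The Riemannian divergence in the chart at `α`. -/
def chartDiv (α : M) (Y : E → E) (y : E) : ℝ :=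
  (volumeDensity n α y)⁻¹ *
    ∑ i, fderiv ℝ (fun z => volumeDensity n α z * Y z i) y (EuclideanSpace.single i (1 : ℝ))

/-- The diffusion operator in the chart at `α`. -/
def chartDiffusion (α : M) (V F : E → ℝ) (y : E) : ℝ :=
  chartDiv α (chartGrad α F) y + chartGamma α V F y

theorem chartGrad_congr {α : M} {F G : E → ℝ} {y : E} (h : F =ᶠ[𝓝 y] G) :
    chartGrad α F y = chartGrad α G y := by
  rw [chartGrad, h.fderiv_eq]; rfl

theorem chartGamma_congr {α : M} {F F' G G' : E → ℝ} {y : E} (h : F =ᶠ[𝓝 y] F')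
    (h' : G =ᶠ[𝓝 y] G') : chartGamma α F G y = chartGamma α F' G' y := by
  rw [chartGamma, h.fderiv_eq, chartGrad_congr h']; rfl

theorem chartDiv_congr {α : M} {Y Y' : E → E} {y : E} (h : Y =ᶠ[𝓝 y] Y') :
    chartDiv α Y y = chartDiv α Y' y := by
  unfold chartDiv
  congr 1
  refine Finset.sum_congr rfl fun i _ => ?_
  have : (fun z => volumeDensity n α z * Y z i) =ᶠ[𝓝 y] fun z => volumeDensity n α z * Y' z i := by
    filter_upwards [h] with z hz
    rw [hz]
  rw [this.fderiv_eq]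

theorem chartDiffusion_congr {α : M} {V F F' : E → ℝ} {y : E} (h : F =ᶠ[𝓝 y] F') :
    chartDiffusion α V F y = chartDiffusion α V F' y := by
  unfold chartDiffusion
  rw [chartGamma_congr EventuallyEq.rfl h]
  congr 1
  apply chartDiv_congr
  filter_upwards [h.eventuallyEq_nhds] with z hz using chartGrad_congr hz

theorem inner_grad (f : M → ℝ) (x : M) (v : TangentSpace (𝓡 n) x) :
    inner ℝ (grad n f x) v = mvfderiv (𝓡 n) f x v :=
  InnerProductSpace.toDual_symm_apply

theorem mdifferentiableAt_of_chart {α : M} {f : M → ℝ} {y : E}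
    (hy : y ∈ (extChartAt (𝓡 n) α).target)
    (hf : DifferentiableAt ℝ (fun z => f ((extChartAt (𝓡 n) α).symm z)) y) :
    MDifferentiableAt (𝓡 n) 𝓘(ℝ, ℝ) f ((extChartAt (𝓡 n) α).symm y) := by
  have hx := (extChartAt (𝓡 n) α).map_target hy
  have h1 : MDifferentiableAt 𝓘(ℝ, E) 𝓘(ℝ, ℝ) (fun z => f ((extChartAt (𝓡 n) α).symm z))
      (extChartAt (𝓡 n) α ((extChartAt (𝓡 n) α).symm y)) := by
    rw [(extChartAt (𝓡 n) α).right_inv hy]; exact hf.mdifferentiableAt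
  refine (h1.comp _ (mdifferentiableAt_chart hx)).congr_of_eventuallyEq ?_
  filter_upwards [(isOpen_extChartAt_source (I := 𝓡 n) α).mem_nhds hx] with z hz
  rw [Function.comp_apply, (extChartAt (𝓡 n) α).left_inv hz]

theorem mvfderiv_chartFrame {α : M} {f : M → ℝ} {y : E}
    (hy : y ∈ (extChartAt (𝓡 n) α).target)
    (hf : MDifferentiableAt (𝓡 n) 𝓘(ℝ, ℝ) f ((extChartAt (𝓡 n) α).symm y)) (v : E) :
    mvfderiv (𝓡 n) f ((extChartAt (𝓡 n) α).symm y) (chartFrame α y v) =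
      fderiv ℝ (fun z => f ((extChartAt (𝓡 n) α).symm z)) y v := by
  have h := mfderiv_comp (I := 𝓘(ℝ, E)) (I' := 𝓡 n) (I'' := 𝓘(ℝ, ℝ)) y hf
    (mdifferentiableAt_chart_symm hy)
  rw [← mfderiv_eq_fderiv]
  exact (congrArg (fun L => L v) h).symm

/-- Pairing the gradient with the coordinate vectors gives the linear system `g u = ∂f`, which is
solved by the inverse matrix. -/
theorem coordField_grad {α : M} {f : M → ℝ} {y : E}
    (hy : y ∈ (extChartAt (𝓡 n) α).target)
    (hf : DifferentiableAt ℝ (fun z => f ((extChartAt (𝓡 n) α).symm z)) y) :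
    coordField n α (grad n f) y = chartGrad α (fun z => f ((extChartAt (𝓡 n) α).symm z)) y := by
  have hf' := mdifferentiableAt_of_chart hy hf
  set u := coordField n α (grad n f) y with hu
  have hg : grad n f ((extChartAt (𝓡 n) α).symm y) = chartFrame α y u :=
    (chartFrame_chartCoframe hy _).symm
  have hdet : IsUnit (metricMatrix n α y).det := (metricMatrix_det_pos hy).ne'.isUnit
  have key : Matrix.mulVec (metricMatrix n α y) u.ofLp = fun j =>
      fderiv ℝ (fun z => f ((extChartAt (𝓡 n) α).symm z)) y (EuclideanSpace.single j 1) := by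
    funext j
    rw [← mvfderiv_chartFrame hy hf', ← inner_grad, hg, real_inner_comm, inner_chartFrame]
    simp [Matrix.mulVec, dotProduct, PiLp.single_apply]
  rw [chartGrad, ← key, Matrix.mulVec_mulVec, Matrix.nonsing_inv_mul _ hdet, Matrix.one_mulVec]

theorem grad_eq_chartFrame {α : M} {f : M → ℝ} {y : E}
    (hy : y ∈ (extChartAt (𝓡 n) α).target)
    (hf : DifferentiableAt ℝ (fun z => f ((extChartAt (𝓡 n) α).symm z)) y) :
    grad n f ((extChartAt (𝓡 n) α).symm y) =
      chartFrame α y (chartGrad α (fun z => f ((extChartAt (𝓡 n) α).symm z)) y) := by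
  rw [← coordField_grad hy hf]
  exact (chartFrame_chartCoframe hy _).symm

theorem carreDuChamp_chart {α : M} {f g : M → ℝ} {y : E}
    (hy : y ∈ (extChartAt (𝓡 n) α).target)
    (hf : DifferentiableAt ℝ (fun z => f ((extChartAt (𝓡 n) α).symm z)) y)
    (hg : DifferentiableAt ℝ (fun z => g ((extChartAt (𝓡 n) α).symm z)) y) :
    carreDuChamp n f g ((extChartAt (𝓡 n) α).symm y) =
      chartGamma α (fun z => f ((extChartAt (𝓡 n) α).symm z))
        (fun z => g ((extChartAt (𝓡 n) α).symm z)) y := by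
  rw [carreDuChamp, inner_grad, grad_eq_chartFrame hy hg,
    mvfderiv_chartFrame hy (mdifferentiableAt_of_chart hy hf)]
  rfl

theorem clm_eq_dotProduct (L : E →L[ℝ] ℝ) (v : E) :
    L v = (fun j => L (EuclideanSpace.single j 1)) ⬝ᵥ v.ofLp := by
  have hsum : v = ∑ i, v i • EuclideanSpace.single i (1 : ℝ) := by
    have := (EuclideanSpace.basisFun (Fin n) ℝ).sum_repr v
    simpa using this.symm
  conv_lhs => rw [hsum]
  simp [dotProduct, map_sum, mul_comm]

theorem chartGamma_comm {α : M} (F G : E → ℝ) {y : E}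
    (hy : y ∈ (extChartAt (𝓡 n) α).target) : chartGamma α F G y = chartGamma α G F y := by
  have hsymm : (metricMatrix n α y)⁻¹.transpose = (metricMatrix n α y)⁻¹ := by
    have h := (metricMatrix_posDef hy).inv.1
    rwa [Matrix.IsHermitian, Matrix.conjTranspose_eq_transpose_of_trivial] at h
  rw [chartGamma, chartGamma, clm_eq_dotProduct, clm_eq_dotProduct (fderiv ℝ G y)]
  simp only [chartGrad]
  rw [Matrix.dotProduct_mulVec, ← Matrix.mulVec_transpose, hsymm, dotProduct_comm]

theorem fderiv_chartGrad_self_pos {α : M} {F : E → ℝ} {y : E}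
    (hy : y ∈ (extChartAt (𝓡 n) α).target) (hF : fderiv ℝ F y ≠ 0) :
    0 < fderiv ℝ F y (chartGrad α F y) := by
  have hne : (fun j => fderiv ℝ F y (EuclideanSpace.single j 1)) ≠ 0 := by
    intro h0
    apply hF
    ext v
    rw [clm_eq_dotProduct, h0]; simp
  have h := (metricMatrix_posDef hy).inv.dotProduct_mulVec_pos hne
  rw [clm_eq_dotProduct]
  simpa [chartGrad] using h

end ChartOperators

/-! ### Change of charts, and the operators on the manifold in an arbitrary fixed chart. -/

section ChartChange

variable {n : ℕ} {M : Type*} [MetricSpace M]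
  [ChartedSpace (EuclideanSpace ℝ (Fin n)) M] [IsManifold (𝓡 n) ∞ M]
  [Bundle.RiemannianBundle (fun x : M => TangentSpace (𝓡 n) x)]

local notation "E" => EuclideanSpace ℝ (Fin n)

/-- The change of coordinates from the chart at `α` to the chart at `β`. -/
def chartChange (α β : M) (z : E) : E := extChartAt (𝓡 n) β ((extChartAt (𝓡 n) α).symm z)

/-- The set of coordinates, in the chart at `α`, of points of the chart domain at `β`. -/
def chartOverlap (α β : M) : Set E :=
  (extChartAt (𝓡 n) α).target ∩ (extChartAt (𝓡 n) α).symm ⁻¹' (extChartAt (𝓡 n) β).source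

theorem isOpen_chart_preimage (α : M) {U : Set M} (hU : IsOpen U) :
    IsOpen ((extChartAt (𝓡 n) α).target ∩ (extChartAt (𝓡 n) α).symm ⁻¹' U) :=
  (continuousOn_extChartAt_symm α).isOpen_inter_preimage (isOpen_chart_target α) hU

theorem isOpen_chartOverlap (α β : M) : IsOpen (chartOverlap (n := n) α β) :=
  isOpen_chart_preimage α (isOpen_extChartAt_source (I := 𝓡 n) β)

theorem contDiffAt_chartChange {α β : M} {z : E} (hz : z ∈ chartOverlap α β) :
    ContDiffAt ℝ ∞ (chartChange α β) z := by
  rw [← contMDiffAt_iff_contDiffAt]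
  have h1 : ContMDiffAt (𝓡 n) 𝓘(ℝ, E) ∞ (extChartAt (𝓡 n) β) ((extChartAt (𝓡 n) α).symm z) :=
    (contMDiffOn_chart β).contMDiffAt ((isOpen_extChartAt_source (I := 𝓡 n) β).mem_nhds hz.2)
  exact h1.comp z (contMDiffAt_chart_symm hz.1)

theorem chartChange_mem {α β : M} {z : E} (hz : z ∈ chartOverlap α β) :
    chartChange α β z ∈ chartOverlap β α := by
  refine ⟨(extChartAt (𝓡 n) β).map_source hz.2, ?_⟩
  rw [mem_preimage, chartChange, (extChartAt (𝓡 n) β).left_inv hz.2]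
  exact (extChartAt (𝓡 n) α).map_target hz.1

theorem chart_symm_chartChange {α β : M} {z : E} (hz : z ∈ chartOverlap α β) :
    (extChartAt (𝓡 n) β).symm (chartChange α β z) = (extChartAt (𝓡 n) α).symm z :=
  (extChartAt (𝓡 n) β).left_inv hz.2

theorem chartChange_chartChange {α β : M} {z : E} (hz : z ∈ chartOverlap α β) :
    chartChange β α (chartChange α β z) = z := by
  rw [chartChange, chart_symm_chartChange hz, (extChartAt (𝓡 n) α).right_inv hz.1]

theorem fderiv_chartChange {α β : M} {z : E} (hz : z ∈ chartOverlap α β) (v : E) :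
    fderiv ℝ (chartChange α β) z v =
      chartCoframe β ((extChartAt (𝓡 n) α).symm z) (chartFrame α z v) := by
  have h := mfderiv_comp (I := 𝓘(ℝ, E)) (I' := 𝓡 n) (I'' := 𝓘(ℝ, E)) z
    (mdifferentiableAt_chart hz.2) (mdifferentiableAt_chart_symm hz.1)
  rw [← mfderiv_eq_fderiv]
  exact congrArg (fun L => L v) h

theorem fderiv_chartChange_comp {α β : M} {z : E} (hz : z ∈ chartOverlap α β) :
    (fderiv ℝ (chartChange β α) (chartChange α β z)).comp (fderiv ℝ (chartChange α β) z) =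
      .id ℝ E := by
  have h1 := ((contDiffAt_chartChange (chartChange_mem hz)).differentiableAt (by simp)).hasFDerivAt.comp
    z ((contDiffAt_chartChange hz).differentiableAt (by simp)).hasFDerivAt
  refine h1.unique ((hasFDerivAt_id z).congr_of_eventuallyEq ?_)
  filter_upwards [(isOpen_chartOverlap α β).mem_nhds hz] with w hw
  exact chartChange_chartChange hw

theorem inner_eq_sum_metricMatrix {β x : M} (hx : x ∈ (extChartAt (𝓡 n) β).source)
    (u v : TangentSpace (𝓡 n) x) :
    inner ℝ u v = ∑ i, ∑ j, chartCoframe β x u i * metricMatrix n β (extChartAt (𝓡 n) β x) i j *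
      chartCoframe β x v j := by
  obtain ⟨w, hw, rfl⟩ : ∃ w ∈ (extChartAt (𝓡 n) β).target, (extChartAt (𝓡 n) β).symm w = x :=
    ⟨_, (extChartAt (𝓡 n) β).map_source hx, (extChartAt (𝓡 n) β).left_inv hx⟩
  rw [(extChartAt (𝓡 n) β).right_inv hw, ← inner_chartFrame, chartFrame_chartCoframe hw,
    chartFrame_chartCoframe hw]

theorem metricMatrix_chartChange {α β : M} {z : E} (hz : z ∈ chartOverlap α β) :
    metricMatrix n α z =
      (Matrix.of fun i j => fderiv ℝ (chartChange α β) z (EuclideanSpace.single j 1) i).transpose *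
      metricMatrix n β (chartChange α β z) *
      (Matrix.of fun i j => fderiv ℝ (chartChange α β) z (EuclideanSpace.single j 1) i) := by
  ext i j
  rw [Matrix.mul_assoc, Matrix.mul_apply]
  simp only [Matrix.mul_apply, Matrix.transpose_apply, Matrix.of_apply, Finset.mul_sum]
  have h := inner_eq_sum_metricMatrix hz.2 (coordVector n α z i) (coordVector n α z j)
  simp only [coordVector_eq, ← fderiv_chartChange hz] at h
  have h2 : metricMatrix n α z i j = inner ℝ (chartFrame α z (EuclideanSpace.single i 1))
    (chartFrame α z (EuclideanSpace.single j 1)) := rfl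
  rw [h2, h]
  refine Finset.sum_congr rfl fun k _ => Finset.sum_congr rfl fun l _ => ?_
  rw [mul_assoc]
  rfl

/-- The determinant of the congruence `g_α = Jᵀ g_β J`. -/
theorem volumeDensity_chartChange {α β : M} {z : E} (hz : z ∈ chartOverlap α β) :
    volumeDensity n α z =
      |(fderiv ℝ (chartChange α β) z).det| * volumeDensity n β (chartChange α β z) := by
  have h := congrArg Matrix.det (metricMatrix_chartChange hz)
  rw [Matrix.det_mul, Matrix.det_mul, Matrix.det_transpose, ← clm_det_eq_matrix_det] at h
  rw [volumeDensity, volumeDensity, h, ← Real.sqrt_sq_eq_abs, ← Real.sqrt_mul (sq_nonneg _)]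
  congr 1
  ring

theorem coordField_chartChange {α β : M} {z : E} (hz : z ∈ chartOverlap α β)
    (X : ∀ x : M, TangentSpace (𝓡 n) x) :
    coordField n β X (chartChange α β z) =
      fderiv ℝ (chartChange α β) z (coordField n α X z) := by
  rw [fderiv_chartChange hz, coordField_eq, coordField_eq, chartFrame_chartCoframe hz.1,
    chart_symm_chartChange hz]

section Smooth

variable [IsContMDiffRiemannianBundle (𝓡 n) ∞ (EuclideanSpace ℝ (Fin n))
      (fun x : M => TangentSpace (𝓡 n) x)]

theorem contDiffAt_metricMatrix_det {α : M} {y : E} (hy : y ∈ (extChartAt (𝓡 n) α).target) :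
    ContDiffAt ℝ ∞ (fun z => (metricMatrix n α z).det) y := by
  simp only [Matrix.det_apply]
  exact ContDiffAt.sum fun σ _ => ContDiffAt.const_smul _
    (contDiffAt_prod fun i _ => contDiffAt_metricMatrix hy _ _)

theorem contDiffAt_volumeDensity {α : M} {y : E} (hy : y ∈ (extChartAt (𝓡 n) α).target) :
    ContDiffAt ℝ ∞ (volumeDensity n α) y :=
  (contDiffAt_metricMatrix_det hy).sqrt (metricMatrix_det_pos hy).ne'

theorem contDiffAt_metricMatrix_inv {α : M} {y : E} (hy : y ∈ (extChartAt (𝓡 n) α).target)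
    (i j : Fin n) : ContDiffAt ℝ ∞ (fun z => (metricMatrix n α z)⁻¹ i j) y := by
  simp only [Matrix.inv_def, Matrix.smul_apply, Ring.inverse_eq_inv', Matrix.adjugate_apply,
    smul_eq_mul]
  refine ((contDiffAt_metricMatrix_det hy).inv (metricMatrix_det_pos hy).ne').mul ?_
  simp only [Matrix.det_apply]
  refine ContDiffAt.sum fun σ _ => ContDiffAt.const_smul _ (contDiffAt_prod fun k _ => ?_)
  by_cases h : σ k = j
  · simp only [Matrix.updateRow_apply, h, if_true]
    exact contDiffAt_const
  · simp only [Matrix.updateRow_apply, h, if_false]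
    exact contDiffAt_metricMatrix hy _ _

/-- An instance of `weighted_divergence_change`. Differentiability is assumed in the first chart
only; in the second one the components are `dψ` applied to the first components, composed with the
inverse change of coordinates `ψ⁻¹`. -/
theorem chartDiv_chartChange {α β : M} {z : E} (hz : z ∈ chartOverlap α β)
    {X : ∀ x : M, TangentSpace (𝓡 n) x} (hX : DifferentiableAt ℝ (coordField n α X) z) :
    chartDiv α (coordField n α X) z = chartDiv β (coordField n β X) (chartChange α β z) := by
  have hz' := chartChange_mem hz
  have hXb : DifferentiableAt ℝ (coordField n β X) (chartChange α β z) := by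
    have h1 : DifferentiableAt ℝ (fun w => fderiv ℝ (chartChange α β) (chartChange β α w)
        (coordField n α X (chartChange β α w))) (chartChange α β z) := by
      have hc := (contDiffAt_chartChange hz').differentiableAt (by simp)
      have e : chartChange β α (chartChange α β z) = z := chartChange_chartChange hz
      refine DifferentiableAt.clm_apply ?_ ?_
      · refine DifferentiableAt.comp (g := fderiv ℝ (chartChange α β)) _ ?_ hc
        rw [e]
        exact ((contDiffAt_chartChange hz).fderiv_right (m := 1) (by norm_cast)).differentiableAt
          (by simp)
      · refine DifferentiableAt.comp (g := coordField n α X) _ ?_ hc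
        rwa [e]
    refine h1.congr_of_eventuallyEq ?_
    filter_upwards [(isOpen_chartOverlap β α).mem_nhds hz'] with w hw
    have := coordField_chartChange (chartChange_mem hw) X
    rwa [chartChange_chartChange hw] at this
  refine weighted_divergence_change ((contDiffAt_chartChange hz).of_le (by norm_cast))
    (fderiv_chartChange_comp hz) ?_ ?_ ?_
    ((contDiffAt_volumeDensity hz'.1).differentiableAt (by simp)) (volumeDensity_pos hz'.1).ne'
    hX hXb
  · have := fderiv_chartChange_comp hz'
    rwa [chartChange_chartChange hz] at this
  · filter_upwards [(isOpen_chartOverlap α β).mem_nhds hz] with w hw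
    exact volumeDensity_chartChange hw
  · filter_upwards [(isOpen_chartOverlap α β).mem_nhds hz] with w hw
    exact coordField_chartChange hw X

/-- The definition uses a different chart at each point. Passing to one chart `α` is what allows the
divergence to be differentiated and integrated as a function of the point. -/
theorem divergence_chart {α : M} {y : E} (hy : y ∈ (extChartAt (𝓡 n) α).target)
    {X : ∀ x : M, TangentSpace (𝓡 n) x} (hX : DifferentiableAt ℝ (coordField n α X) y) :
    divergence n X ((extChartAt (𝓡 n) α).symm y) = chartDiv α (coordField n α X) y :=
  (chartDiv_chartChange ⟨hy, mem_extChartAt_source (I := 𝓡 n) _⟩ hX).symm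

theorem contDiffAt_chartGrad {α : M} {y : E} (hy : y ∈ (extChartAt (𝓡 n) α).target)
    {F : E → ℝ} {k m : ℕ∞} (hF : ContDiffAt ℝ m F y) (hkm : k + 1 ≤ m) :
    ContDiffAt ℝ k (chartGrad α F) y := by
  rw [contDiffAt_euclidean]
  intro i
  simp only [chartGrad, Matrix.mulVec, dotProduct]
  refine ContDiffAt.sum fun j _ => ?_
  refine ((contDiffAt_metricMatrix_inv hy i j).of_le (by exact_mod_cast le_top)).mul ?_
  exact (hF.fderiv_right (m := k) (by exact_mod_cast hkm)).clm_apply contDiffAt_const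

theorem laplaceBeltrami_chart {α : M} {f : M → ℝ} {y : E}
    (hy : y ∈ (extChartAt (𝓡 n) α).target)
    (hf : ContDiffAt ℝ 2 (fun z => f ((extChartAt (𝓡 n) α).symm z)) y) :
    laplaceBeltrami n f ((extChartAt (𝓡 n) α).symm y) =
      chartDiv α (chartGrad α (fun z => f ((extChartAt (𝓡 n) α).symm z))) y := by
  have h1 : coordField n α (grad n f) =ᶠ[𝓝 y]
      chartGrad α (fun z => f ((extChartAt (𝓡 n) α).symm z)) := by
    filter_upwards [(isOpen_chart_target α).mem_nhds hy, hf.eventually (by simp)] with z hz hfz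
    exact coordField_grad hz (hfz.differentiableAt (by simp))
  have h2 : DifferentiableAt ℝ (chartGrad α (fun z => f ((extChartAt (𝓡 n) α).symm z))) y :=
    (contDiffAt_chartGrad hy (k := 1) (m := 2) hf (by norm_num)).differentiableAt (by simp)
  rw [laplaceBeltrami, divergence_chart hy (h2.congr_of_eventuallyEq h1), chartDiv_congr h1]

theorem diffusion_chart {α : M} {V f : M → ℝ} {y : E}
    (hy : y ∈ (extChartAt (𝓡 n) α).target)
    (hV : DifferentiableAt ℝ (fun z => V ((extChartAt (𝓡 n) α).symm z)) y)
    (hf : ContDiffAt ℝ 2 (fun z => f ((extChartAt (𝓡 n) α).symm z)) y) :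
    diffusion n V f ((extChartAt (𝓡 n) α).symm y) =
      chartDiffusion α (fun z => V ((extChartAt (𝓡 n) α).symm z))
        (fun z => f ((extChartAt (𝓡 n) α).symm z)) y := by
  rw [diffusion, laplaceBeltrami_chart hy hf, chartDiffusion,
    ← carreDuChamp_chart hy hV (hf.differentiableAt (by simp))]
  rfl

end Smooth

end ChartChange

/-! ### The Riemannian volume in charts. -/

section Volume

variable {n : ℕ} {M : Type*} [MetricSpace M] [MeasurableSpace M] [BorelSpace M]
  [ChartedSpace (EuclideanSpace ℝ (Fin n)) M] [IsManifold (𝓡 n) ∞ M]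
  [Bundle.RiemannianBundle (fun x : M => TangentSpace (𝓡 n) x)]
  [IsContMDiffRiemannianBundle (𝓡 n) ∞ (EuclideanSpace ℝ (Fin n))
      (fun x : M => TangentSpace (𝓡 n) x)]

local notation "E" => EuclideanSpace ℝ (Fin n)

theorem measurableSet_chart_preimage (α : M) {A : Set M} (hA : MeasurableSet A) :
    MeasurableSet ((extChartAt (𝓡 n) α).target ∩ (extChartAt (𝓡 n) α).symm ⁻¹' A) := by
  have h1 : Measurable ((extChartAt (𝓡 n) α).target.domRestrict (extChartAt (𝓡 n) α).symm) :=
    (continuousOn_extChartAt_symm α).domRestrict.measurable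
  have h2 := (isOpen_chart_target α).measurableSet.subtype_image (h1 hA)
  convert h2 using 1
  ext z
  constructor
  · rintro ⟨h, h'⟩
    exact ⟨⟨z, h⟩, h', rfl⟩
  · rintro ⟨⟨w, hw⟩, h', rfl⟩
    exact ⟨hw, h'⟩

theorem aemeasurable_volumeDensity (α : M) {S : Set E} (hS : S ⊆ (extChartAt (𝓡 n) α).target) :
    AEMeasurable (fun y => ENNReal.ofReal (volumeDensity n α y)) (volume.restrict S) := by
  have h : ContinuousOn (volumeDensity n α) (extChartAt (𝓡 n) α).target := fun y hy =>
    (contDiffAt_volumeDensity hy).continuousAt.continuousWithinAt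
  exact ((h.aemeasurable (isOpen_chart_target α).measurableSet).mono_set hS).ennreal_ofReal

theorem aemeasurable_chart_symm (α : M) {S : Set E} (hS : S ⊆ (extChartAt (𝓡 n) α).target) :
    AEMeasurable (extChartAt (𝓡 n) α).symm ((volume.restrict S).withDensity
      fun y => ENNReal.ofReal (volumeDensity n α y)) :=
  (((continuousOn_extChartAt_symm α).aemeasurable
    (isOpen_chart_target α).measurableSet).mono_set hS).mono_ac (withDensity_absolutelyContinuous _ _)

theorem map_chart_symm_apply (α : M) {S : Set E} (hS : S ⊆ (extChartAt (𝓡 n) α).target)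
    (hSm : MeasurableSet S) {A : Set M} (hA : MeasurableSet A) :
    (((volume.restrict S).withDensity fun y => ENNReal.ofReal (volumeDensity n α y)).map
      (extChartAt (𝓡 n) α).symm) A =
    ∫⁻ y in S ∩ (extChartAt (𝓡 n) α).symm ⁻¹' A, ENNReal.ofReal (volumeDensity n α y) := by
  rw [Measure.map_apply_of_aemeasurable (aemeasurable_chart_symm α hS) hA, withDensity_apply',
    Measure.restrict_restrict' hSm, inter_comm]

theorem chartVolume_apply (α : M) {A : Set M} (hA : MeasurableSet A) :
    chartVolume n α A = ∫⁻ y in (extChartAt (𝓡 n) α).target ∩ (extChartAt (𝓡 n) α).symm ⁻¹' A,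
      ENNReal.ofReal (volumeDensity n α y) :=
  map_chart_symm_apply α Subset.rfl (isOpen_chart_target α).measurableSet hA

/-- Change of variables: the Jacobian of the change of charts is the quotient of the two volume
densities. -/
theorem chartVolume_eq_of_subset {α β : M} {A : Set M} (hA : MeasurableSet A)
    (hα : A ⊆ (extChartAt (𝓡 n) α).source) (hβ : A ⊆ (extChartAt (𝓡 n) β).source) :
    chartVolume n α A = chartVolume n β A := by
  rw [chartVolume_apply α hA, chartVolume_apply β hA]
  set S := (extChartAt (𝓡 n) α).target ∩ (extChartAt (𝓡 n) α).symm ⁻¹' A with hS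
  have hSo : S ⊆ chartOverlap α β := fun z hz => ⟨hz.1, hβ hz.2⟩
  have himg : (extChartAt (𝓡 n) β).target ∩ (extChartAt (𝓡 n) β).symm ⁻¹' A =
      chartChange α β '' S := by
    ext w
    constructor
    · rintro ⟨hw, hwA⟩
      have hw' : w ∈ chartOverlap β α := ⟨hw, hα hwA⟩
      refine ⟨chartChange β α w, ⟨(chartChange_mem hw').1, ?_⟩, chartChange_chartChange hw'⟩
      rw [mem_preimage, chart_symm_chartChange hw']
      exact hwA
    · rintro ⟨z, hz, rfl⟩
      refine ⟨(chartChange_mem (hSo hz)).1, ?_⟩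
      rw [mem_preimage, chart_symm_chartChange (hSo hz)]
      exact hz.2
  rw [himg, lintegral_image_eq_lintegral_abs_det_fderiv_mul volume
    (measurableSet_chart_preimage α hA)
    (fun z hz => ((contDiffAt_chartChange (hSo hz)).differentiableAt
      (by simp)).hasFDerivAt.hasFDerivWithinAt)]
  · refine setLIntegral_congr_fun (measurableSet_chart_preimage α hA) fun z hz => ?_
    rw [volumeDensity_chartChange (hSo hz), ENNReal.ofReal_mul (abs_nonneg _)]
  · intro z hz w hw hzw
    rw [← chartChange_chartChange (hSo hz), ← chartChange_chartChange (hSo hw), hzw]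

variable [SecondCountableTopology M]

/-- Cut a countable cover by chart domains into disjoint pieces `T k` and glue the chart measures on
these pieces to a measure `ν`. On each chart domain `ν` agrees with the chart measure, and it
dominates every chart measure globally, so the supremum is squeezed between the two. -/
theorem riemannianVolume_apply_of_subset {α : M} {A : Set M} (hA : MeasurableSet A)
    (hα : A ⊆ (extChartAt (𝓡 n) α).source) : riemannianVolume n M A = chartVolume n α A := by
  obtain ⟨s, hs, hsU⟩ := TopologicalSpace.countable_cover_nhds
    (fun x : M => extChartAt_source_mem_nhds (I := 𝓡 n) x)
  have hsne : s.Nonempty := by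
    by_contra h
    rw [not_nonempty_iff_eq_empty] at h
    have := mem_univ α
    rw [← hsU, h] at this
    simp at this
  obtain ⟨c, rfl⟩ := hs.exists_eq_range hsne
  have hcov : ⋃ k, (extChartAt (𝓡 n) (c k)).source = univ := by simpa using hsU
  set T : ℕ → Set M := disjointed fun k => (extChartAt (𝓡 n) (c k)).source with hT
  have hTm : ∀ k, MeasurableSet (T k) := fun k =>
    MeasurableSet.disjointed (fun k => (isOpen_extChartAt_source (I := 𝓡 n) (c k)).measurableSet) k
  have hTs : ∀ k, T k ⊆ (extChartAt (𝓡 n) (c k)).source := fun k => disjointed_subset _ k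
  have hTd : Pairwise (Function.onFun Disjoint T) := disjoint_disjointed _
  have hTU : ⋃ k, T k = univ := by rw [hT, iUnion_disjointed, hcov]
  set ν : Measure M := Measure.sum fun k => (chartVolume n (c k)).restrict (T k) with hν
  have hsplit : ∀ (β : M) (B : Set M), MeasurableSet B → B ⊆ (extChartAt (𝓡 n) β).source →
      chartVolume n β B = ν B := by
    intro β B hB hBβ
    rw [hν, Measure.sum_apply _ hB]
    have h1 : B = ⋃ k, B ∩ T k := by rw [← inter_iUnion, hTU, inter_univ]
    conv_lhs => rw [h1]
    rw [measure_iUnion (fun i j hij => ((hTd hij).mono inter_subset_right inter_subset_right))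
      (fun k => hB.inter (hTm k))]
    refine tsum_congr fun k => ?_
    rw [Measure.restrict_apply hB]
    exact chartVolume_eq_of_subset (hB.inter (hTm k)) (inter_subset_left.trans hBβ)
      (inter_subset_right.trans (hTs k))
  refine le_antisymm ?_ (Measure.le_iff'.1 (le_iSup (fun α : M => chartVolume n α) α) A)
  rw [hsplit α A hA hα]
  refine Measure.le_iff'.1 (iSup_le fun β => ?_) A
  refine Measure.le_iff.2 fun B hB => ?_
  have hsrc := (isOpen_extChartAt_source (I := 𝓡 n) β).measurableSet
  -- Each chart measure is carried by its own chart domain.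
  have h2 : chartVolume n β B = chartVolume n β (B ∩ (extChartAt (𝓡 n) β).source) := by
    rw [chartVolume_apply β hB, chartVolume_apply β (hB.inter hsrc)]
    congr 2
    ext z
    constructor
    · rintro ⟨h, h'⟩; exact ⟨h, h', (extChartAt (𝓡 n) β).map_target h⟩
    · rintro ⟨h, h', -⟩; exact ⟨h, h'⟩
  rw [h2, hsplit β _ (hB.inter hsrc) inter_subset_right]
  exact measure_mono inter_subset_left

theorem riemannianVolume_restrict {α : M} {A : Set M} (hA : MeasurableSet A)
    (hα : A ⊆ (extChartAt (𝓡 n) α).source) :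
    (riemannianVolume n M).restrict A =
      ((volume.restrict ((extChartAt (𝓡 n) α).target ∩
        (extChartAt (𝓡 n) α).symm ⁻¹' A)).withDensity
        fun y => ENNReal.ofReal (volumeDensity n α y)).map (extChartAt (𝓡 n) α).symm := by
  ext B hB
  rw [Measure.restrict_apply hB, riemannianVolume_apply_of_subset (hB.inter hA)
    (inter_subset_right.trans hα), chartVolume_apply α (hB.inter hA),
    map_chart_symm_apply α inter_subset_left (measurableSet_chart_preimage α hA) hB]
  congr 2
  ext z
  simp only [mem_inter_iff, mem_preimage]
  tauto

theorem setIntegral_riemannianVolume {α : M} {A : Set M} (hA : MeasurableSet A)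
    (hα : A ⊆ (extChartAt (𝓡 n) α).source) {Q : M → ℝ}
    (hQ : AEStronglyMeasurable Q ((riemannianVolume n M).restrict A)) :
    ∫ x in A, Q x ∂(riemannianVolume n M) =
      ∫ y in (extChartAt (𝓡 n) α).target ∩ (extChartAt (𝓡 n) α).symm ⁻¹' A,
        volumeDensity n α y * Q ((extChartAt (𝓡 n) α).symm y) := by
  rw [riemannianVolume_restrict hA hα] at hQ ⊢
  rw [integral_map (aemeasurable_chart_symm α inter_subset_left) hQ,
    integral_withDensity_eq_integral_toReal_smul₀ (aemeasurable_volumeDensity α inter_subset_left)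
      (by simp)]
  refine integral_congr_ae (Filter.Eventually.of_forall fun y => ?_)
  have h0 : 0 ≤ volumeDensity n α y := Real.sqrt_nonneg _
  simp only [ENNReal.toReal_ofReal h0, smul_eq_mul]

theorem riemannianVolume_lt_top_of_isCompact {K : Set M} (hK : IsCompact K) :
    riemannianVolume n M K < ⊤ := by
  refine hK.measure_lt_top_of_nhdsWithin fun p _ => ?_
  have hp := mem_extChartAt_target (I := 𝓡 n) p
  have hev : ∀ᶠ y in 𝓝 (extChartAt (𝓡 n) p p), y ∈ (extChartAt (𝓡 n) p).target ∧
      volumeDensity n p y < volumeDensity n p (extChartAt (𝓡 n) p p) + 1 :=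
    ((isOpen_chart_target p).eventually_mem hp).and
      ((contDiffAt_volumeDensity hp).continuousAt.eventually (gt_mem_nhds (by linarith)))
  obtain ⟨r, hr, hball⟩ := Metric.mem_nhds_iff.1 hev
  set A : Set M := (extChartAt (𝓡 n) p).source ∩ extChartAt (𝓡 n) p ⁻¹'
    Metric.ball (extChartAt (𝓡 n) p p) r with hA
  have hAo : IsOpen A := (contMDiffOn_chart p).continuousOn.isOpen_inter_preimage
    (isOpen_extChartAt_source (I := 𝓡 n) p) Metric.isOpen_ball
  refine ⟨A, mem_nhdsWithin_of_mem_nhds (hAo.mem_nhds ⟨mem_extChartAt_source p,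
    Metric.mem_ball_self hr⟩), ?_⟩
  rw [riemannianVolume_apply_of_subset hAo.measurableSet inter_subset_left,
    chartVolume_apply p hAo.measurableSet]
  have hsub : (extChartAt (𝓡 n) p).target ∩ (extChartAt (𝓡 n) p).symm ⁻¹' A ⊆
      Metric.ball (extChartAt (𝓡 n) p p) r := by
    rintro z ⟨hz, -, hz'⟩
    rwa [mem_preimage, (extChartAt (𝓡 n) p).right_inv hz] at hz'
  refine (lintegral_mono_set hsub).trans_lt ?_
  refine (setLIntegral_mono measurable_const (fun y hy =>
    ENNReal.ofReal_le_ofReal (hball hy).2.le)).trans_lt ?_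
  rw [setLIntegral_const]
  exact ENNReal.mul_lt_top ENNReal.ofReal_lt_top measure_ball_lt_top

end Volume

/-! ### Calculus of functions on an open set with `C^k` extensions to boundary points. -/

section Extension

variable {F G : Type*} [NormedAddCommGroup F] [NormedSpace ℝ F] [NormedAddCommGroup G]
  [NormedSpace ℝ G]

/-- The function `f` on the open set `Ω` has a `C^k` extension to `S ⊇ Ω` near `y`. -/
def ExtendsC (k : ℕ) (Ω S : Set F) (y : F) (f : F → G) : Prop :=
  ∃ h : F → G, ContDiffWithinAt ℝ k h S y ∧ f =ᶠ[𝓝[Ω] y] h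

namespace ExtendsC

variable {k : ℕ} {Ω S : Set F} {y : F} {f g : F → G}

theorem of_contDiffWithinAt (h : ContDiffWithinAt ℝ k f S y) : ExtendsC k Ω S y f :=
  ⟨f, h, EventuallyEq.rfl⟩

theorem of_contDiffAt (h : ContDiffAt ℝ k f y) : ExtendsC k Ω S y f :=
  of_contDiffWithinAt h.contDiffWithinAt

theorem congr (h : ExtendsC k Ω S y f) (hfg : g =ᶠ[𝓝[Ω] y] f) : ExtendsC k Ω S y g := by
  obtain ⟨H, hH, hfH⟩ := h
  exact ⟨H, hH, hfg.trans hfH⟩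

theorem of_le {m : ℕ} (h : ExtendsC k Ω S y f) (hm : m ≤ k) : ExtendsC m Ω S y f := by
  obtain ⟨H, hH, hfH⟩ := h
  exact ⟨H, hH.of_le (by exact_mod_cast hm), hfH⟩

theorem add (hf : ExtendsC k Ω S y f) (hg : ExtendsC k Ω S y g) :
    ExtendsC k Ω S y fun z => f z + g z := by
  obtain ⟨H, hH, hfH⟩ := hf
  obtain ⟨K, hK, hgK⟩ := hg
  exact ⟨fun z => H z + K z, hH.add hK, hfH.add hgK⟩

theorem smul {c : F → ℝ} (hc : ExtendsC k Ω S y c) (hg : ExtendsC k Ω S y g) :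
    ExtendsC k Ω S y fun z => c z • g z := by
  obtain ⟨H, hH, hfH⟩ := hc
  obtain ⟨K, hK, hgK⟩ := hg
  exact ⟨fun z => H z • K z, hH.smul hK, hfH.smul hgK⟩

theorem mul {c d : F → ℝ} (hc : ExtendsC k Ω S y c) (hd : ExtendsC k Ω S y d) :
    ExtendsC k Ω S y fun z => c z * d z := hc.smul hd

theorem sum {ι : Type*} {s : Finset ι} {f : ι → F → G} (hf : ∀ i ∈ s, ExtendsC k Ω S y (f i)) :
    ExtendsC k Ω S y fun z => ∑ i ∈ s, f i z := by
  classical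
  induction s using Finset.induction_on with
  | empty => simpa using of_contDiffAt contDiffAt_const
  | insert a s ha ih =>
    simp only [Finset.sum_insert ha]
    exact (hf a (Finset.mem_insert_self a s)).add
      (ih fun i hi => hf i (Finset.mem_insert_of_mem hi))

theorem clm_comp {G' : Type*} [NormedAddCommGroup G'] [NormedSpace ℝ G'] (L : G →L[ℝ] G')
    (hf : ExtendsC k Ω S y f) : ExtendsC k Ω S y fun z => L (f z) := by
  obtain ⟨H, hH, hfH⟩ := hf
  exact ⟨fun z => L (H z), L.contDiff.comp_contDiffWithinAt hH, hfH.fun_comp L⟩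

theorem clm_apply {G' : Type*} [NormedAddCommGroup G'] [NormedSpace ℝ G'] {c : F → G →L[ℝ] G'}
    (hc : ExtendsC k Ω S y c) (hf : ExtendsC k Ω S y f) : ExtendsC k Ω S y fun z => c z (f z) := by
  obtain ⟨H, hH, hfH⟩ := hf
  obtain ⟨K, hK, hcK⟩ := hc
  refine ⟨fun z => K z (H z), hK.clm_apply hH, ?_⟩
  filter_upwards [hfH, hcK] with z h1 h2
  rw [h1, h2]

theorem euclidean {n : ℕ} {f : F → EuclideanSpace ℝ (Fin n)}
    (hf : ∀ i, ExtendsC k Ω S y fun z => f z i) : ExtendsC k Ω S y f := by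
  choose H hH hfH using hf
  refine ⟨fun z => WithLp.toLp 2 fun i => H i z, contDiffWithinAt_euclidean.2 hH, ?_⟩
  filter_upwards [eventually_all.2 hfH] with z hz
  ext i
  exact hz i

/-- At points of the open set `Ω` any derivative within `S` is the full derivative, so the
derivative field of the extension extends `fderiv ℝ f`. Unique differentiability of `S` at its
boundary is not needed. -/
theorem fderiv (hΩ : IsOpen Ω) (hΩS : Ω ⊆ S) (hy : y ∈ S) (hf : ExtendsC (k + 1) Ω S y f) :
    ExtendsC k Ω S y (fderiv ℝ f) := by
  obtain ⟨H, hH, hfH⟩ := hf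
  rw [Nat.cast_add, Nat.cast_one,
    contDiffWithinAt_succ_iff_hasFDerivWithinAt' (by simp)] at hH
  obtain ⟨u, hu, -, -, H', hH', hc⟩ := hH
  refine ⟨H', hc, ?_⟩
  rw [insert_eq_of_mem hy] at hu
  have hu' : u ∈ 𝓝[Ω] y := nhdsWithin_mono y hΩS hu
  filter_upwards [hu', eventually_eventually_nhdsWithin.2 hfH, self_mem_nhdsWithin] with z hz hfz hzΩ
  rw [hΩ.nhdsWithin_eq hzΩ] at hfz
  rw [EventuallyEq.fderiv_eq hfz]
  exact ((hH' z hz).hasFDerivAt (mem_of_superset (hΩ.mem_nhds hzΩ) hΩS)).fderiv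

theorem exists_tendsto (hΩS : Ω ⊆ S) (hf : ExtendsC 0 Ω S y f) :
    ∃ c, Tendsto f (𝓝[Ω] y) (𝓝 c) := by
  obtain ⟨H, hH, hfH⟩ := hf
  exact ⟨H y, ((hH.continuousWithinAt.mono hΩS).tendsto).congr' hfH.symm⟩

theorem eventually_norm_le (hΩS : Ω ⊆ S) (hf : ExtendsC 0 Ω S y f) :
    ∃ C, ∀ᶠ z in 𝓝[Ω] y, ‖f z‖ ≤ C := by
  obtain ⟨c, hc⟩ := hf.exists_tendsto hΩS
  refine ⟨‖c‖ + 1, ?_⟩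
  filter_upwards [hc.norm.eventually (gt_mem_nhds (by linarith : ‖c‖ < ‖c‖ + 1))] with z hz using hz.le

theorem eventually_contDiffAt (hΩ : IsOpen Ω) (hΩS : Ω ⊆ S) (hy : y ∈ S)
    (hf : ExtendsC k Ω S y f) : ∀ᶠ z in 𝓝[Ω] y, ContDiffAt ℝ k f z := by
  obtain ⟨H, hH, hfH⟩ := hf
  have h1 := hH.eventually (by simp)
  rw [insert_eq_of_mem hy] at h1
  filter_upwards [nhdsWithin_mono y hΩS h1, eventually_eventually_nhdsWithin.2 hfH,
    self_mem_nhdsWithin] with z hz hfz hzΩ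
  rw [hΩ.nhdsWithin_eq hzΩ] at hfz
  exact (hz.contDiffAt (mem_of_superset (hΩ.mem_nhds hzΩ) hΩS)).congr_of_eventuallyEq hfz

end ExtendsC

end Extension

/-! ### Extension of the chart operators up to the boundary, with the loss of derivatives recorded.
-/

section ChartExtension

variable {n : ℕ} {M : Type*} [MetricSpace M]
  [ChartedSpace (EuclideanSpace ℝ (Fin n)) M] [IsManifold (𝓡 n) ∞ M]
  [Bundle.RiemannianBundle (fun x : M => TangentSpace (𝓡 n) x)]
  [IsContMDiffRiemannianBundle (𝓡 n) ∞ (EuclideanSpace ℝ (Fin n))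
      (fun x : M => TangentSpace (𝓡 n) x)]

local notation "E" => EuclideanSpace ℝ (Fin n)

variable {α : M} {Ω S : Set (EuclideanSpace ℝ (Fin n))} {y : EuclideanSpace ℝ (Fin n)} {k : ℕ}

theorem ExtendsC.chartGrad (hΩ : IsOpen Ω) (hΩS : Ω ⊆ S) (hy : y ∈ S)
    (hyt : y ∈ (extChartAt (𝓡 n) α).target) {F : E → ℝ} (hF : ExtendsC (k + 1) Ω S y F) :
    ExtendsC k Ω S y (chartGrad α F) := by
  refine ExtendsC.euclidean fun i => ?_
  simp only [RiemannDomain.chartGrad, Matrix.mulVec, dotProduct]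
  refine ExtendsC.sum fun j _ => ExtendsC.mul ?_ ?_
  · exact ExtendsC.of_contDiffAt ((contDiffAt_metricMatrix_inv hyt i j).of_le
      (by exact_mod_cast le_top))
  · exact (hF.fderiv hΩ hΩS hy).clm_apply (ExtendsC.of_contDiffAt contDiffAt_const)

theorem ExtendsC.chartGamma (hΩ : IsOpen Ω) (hΩS : Ω ⊆ S) (hy : y ∈ S)
    (hyt : y ∈ (extChartAt (𝓡 n) α).target) {F G : E → ℝ} (hF : ExtendsC (k + 1) Ω S y F)
    (hG : ExtendsC (k + 1) Ω S y G) : ExtendsC k Ω S y (chartGamma α F G) :=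
  (hF.fderiv hΩ hΩS hy).clm_apply (hG.chartGrad hΩ hΩS hy hyt)

theorem ExtendsC.chartDiv (hΩ : IsOpen Ω) (hΩS : Ω ⊆ S) (hy : y ∈ S)
    (hyt : y ∈ (extChartAt (𝓡 n) α).target) {Y : E → E} (hY : ExtendsC (k + 1) Ω S y Y) :
    ExtendsC k Ω S y (chartDiv α Y) := by
  refine ExtendsC.mul (ExtendsC.of_contDiffAt (((contDiffAt_volumeDensity hyt).of_le
    (by exact_mod_cast le_top)).inv (volumeDensity_pos hyt).ne')) (ExtendsC.sum fun i _ => ?_)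
  refine ExtendsC.clm_apply (ExtendsC.fderiv hΩ hΩS hy (ExtendsC.mul ?_ ?_))
    (ExtendsC.of_contDiffAt contDiffAt_const)
  · exact ExtendsC.of_contDiffAt ((contDiffAt_volumeDensity hyt).of_le (by exact_mod_cast le_top))
  · exact hY.clm_comp (EuclideanSpace.proj (𝕜 := ℝ) i)

theorem ExtendsC.chartDiffusion (hΩ : IsOpen Ω) (hΩS : Ω ⊆ S) (hy : y ∈ S)
    (hyt : y ∈ (extChartAt (𝓡 n) α).target) {V F : E → ℝ} (hV : ExtendsC (k + 1) Ω S y V)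
    (hF : ExtendsC (k + 2) Ω S y F) : ExtendsC k Ω S y (chartDiffusion α V F) :=
  ((hF.chartGrad (k := k + 1) hΩ hΩS hy hyt).chartDiv hΩ hΩS hy hyt).add
    (hV.chartGamma hΩ hΩS hy hyt (hF.of_le (by omega)))

end ChartExtension

theorem two_le_infty : (2 : ℕ∞ω) ≤ ∞ := ENat.LEInfty.out

theorem three_le_infty : (3 : ℕ∞ω) ≤ ∞ := ENat.LEInfty.out

/-! ### Functions with limits along a domain: boundedness and integrability. -/

section Limits

/-- `F` has a limit along `D` at every point of the closure of `D`. -/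
def HasLimits {M : Type*} [TopologicalSpace M] (D : Set M) (F : M → ℝ) : Prop :=
  ∀ p ∈ closure D, ∃ c, Tendsto F (𝓝[D] p) (𝓝 c)

namespace HasLimits

variable {M : Type*} [TopologicalSpace M] {D : Set M} {F G : M → ℝ}

theorem of_continuousOn (h : ContinuousOn F (closure D)) : HasLimits D F := fun p hp =>
  ⟨F p, ((h p hp).mono subset_closure).tendsto⟩

theorem add (hF : HasLimits D F) (hG : HasLimits D G) : HasLimits D fun x => F x + G x :=
  fun p hp => by
    obtain ⟨c, hc⟩ := hF p hp
    obtain ⟨d, hd⟩ := hG p hp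
    exact ⟨c + d, hc.add hd⟩

theorem sub (hF : HasLimits D F) (hG : HasLimits D G) : HasLimits D fun x => F x - G x :=
  fun p hp => by
    obtain ⟨c, hc⟩ := hF p hp
    obtain ⟨d, hd⟩ := hG p hp
    exact ⟨c - d, hc.sub hd⟩

theorem mul (hF : HasLimits D F) (hG : HasLimits D G) : HasLimits D fun x => F x * G x :=
  fun p hp => by
    obtain ⟨c, hc⟩ := hF p hp
    obtain ⟨d, hd⟩ := hG p hp
    exact ⟨c * d, hc.mul hd⟩

theorem pow (hF : HasLimits D F) (k : ℕ) : HasLimits D fun x => F x ^ k :=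
  fun p hp => by
    obtain ⟨c, hc⟩ := hF p hp
    exact ⟨c ^ k, hc.pow k⟩

/-- For `p ∈ D` the filter `𝓝[D] p` sees the point `p` itself, so the limit has to be `F p`. -/
theorem continuousOn (hF : HasLimits D F) : ContinuousOn F D := by
  intro p hp
  obtain ⟨c, hc⟩ := hF p (subset_closure hp)
  have h1 : Tendsto F (pure p) (𝓝 c) := hc.mono_left (pure_le_nhdsWithin hp)
  have h2 : F p = c := pure_le_nhds_iff.1 (by simpa [Tendsto, Filter.map_pure] using h1)
  rw [ContinuousWithinAt, h2]
  exact hc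

/-- Compactness of the closure combines the local bounds. Values of `F` off `D` play no role, so
operators defined by full derivatives may be arbitrary on the boundary. -/
theorem exists_bound (hD : IsCompact (closure D)) (hF : HasLimits D F) :
    ∃ C, ∀ x ∈ D, |F x| ≤ C := by
  have h : ∃ C, ∀ x ∈ closure D ∩ D, |F x| ≤ C := by
    refine hD.induction_on (p := fun s => ∃ C, ∀ x ∈ s ∩ D, |F x| ≤ C) ⟨0, by simp⟩ ?_ ?_ ?_
    · rintro s t hst ⟨C, hC⟩
      exact ⟨C, fun x hx => hC x ⟨hst hx.1, hx.2⟩⟩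
    · rintro s t ⟨C, hC⟩ ⟨C', hC'⟩
      refine ⟨max C C', ?_⟩
      rintro x ⟨hx | hx, hxD⟩
      · exact (hC x ⟨hx, hxD⟩).trans (le_max_left _ _)
      · exact (hC' x ⟨hx, hxD⟩).trans (le_max_right _ _)
    · intro p hp
      obtain ⟨c, hc⟩ := hF p hp
      have h1 : ∀ᶠ x in 𝓝[D] p, |F x| < |c| + 1 := hc.abs.eventually (gt_mem_nhds (by linarith))
      obtain ⟨U, hU, hUs⟩ := mem_nhdsWithin_iff_exists_mem_nhds_inter.1 h1
      exact ⟨U, mem_nhdsWithin_of_mem_nhds hU, |c| + 1, fun x hx => (hUs hx).le⟩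
  obtain ⟨C, hC⟩ := h
  exact ⟨C, fun x hx => hC x ⟨subset_closure hx, hx⟩⟩

theorem integrableOn [MeasurableSpace M] [BorelSpace M]
    {μ : Measure M} (hDo : IsOpen D) (hD : IsCompact (closure D)) (hμ : μ D < ⊤)
    (hF : HasLimits D F) : IntegrableOn F D μ := by
  obtain ⟨C, hC⟩ := hF.exists_bound hD
  have : IsFiniteMeasure (μ.restrict D) := ⟨by rwa [Measure.restrict_apply_univ]⟩
  refine Integrable.of_bound (hF.continuousOn.aestronglyMeasurable hDo.measurableSet) C ?_
  filter_upwards [ae_restrict_mem hDo.measurableSet] with x hx using hC x hx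

end HasLimits

end Limits

/-! ### Regularity up to the boundary of `Γ`, `L` and `Γ₂`. -/

section ChartDomain

variable {n : ℕ} {M : Type*} [MetricSpace M]
  [ChartedSpace (EuclideanSpace ℝ (Fin n)) M] [IsManifold (𝓡 n) ∞ M]
  [Bundle.RiemannianBundle (fun x : M => TangentSpace (𝓡 n) x)]
  [IsContMDiffRiemannianBundle (𝓡 n) ∞ (EuclideanSpace ℝ (Fin n))
      (fun x : M => TangentSpace (𝓡 n) x)]

local notation "E" => EuclideanSpace ℝ (Fin n)

/-- The set `D` in the chart at `α`. -/
def chartDomain (α : M) (D : Set M) : Set (EuclideanSpace ℝ (Fin n)) :=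
  (extChartAt (𝓡 n) α).target ∩ (extChartAt (𝓡 n) α).symm ⁻¹' D

/-- The function `f` in the chart at `α`. -/
def chartFun {X : Type*} (α : M) (f : M → X) (y : EuclideanSpace ℝ (Fin n)) : X :=
  f ((extChartAt (𝓡 n) α).symm y)

theorem chartDomain_subset (α : M) (D : Set M) :
    chartDomain (n := n) α D ⊆ chartDomain α (closure D) :=
  inter_subset_inter_right _ (preimage_mono subset_closure)

theorem isOpen_chartDomain (α : M) {D : Set M} (hD : IsOpen D) :
    IsOpen (chartDomain (n := n) α D) := isOpen_chart_preimage α hD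

/-- With `Ω = S = univ`, the extension calculus also yields interior regularity, so the operators
need no second treatment. -/
theorem extendsC_univ_iff {F : Type*} [NormedAddCommGroup F] [NormedSpace ℝ F] {k : ℕ} {y : E}
    {f : E → F} : ExtendsC k univ univ y f ↔ ContDiffAt ℝ k f y := by
  refine ⟨?_, ExtendsC.of_contDiffAt⟩
  rintro ⟨H, hH, hfH⟩
  rw [nhdsWithin_univ] at hfH
  exact (contDiffWithinAt_univ.1 hH).congr_of_eventuallyEq hfH

theorem contDiffAt_chartGamma {α : M} {y : E} (hy : y ∈ (extChartAt (𝓡 n) α).target)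
    {F G : E → ℝ} {k : ℕ} (hF : ContDiffAt ℝ (k + 1 : ℕ) F y) (hG : ContDiffAt ℝ (k + 1 : ℕ) G y) :
    ContDiffAt ℝ k (chartGamma α F G) y :=
  extendsC_univ_iff.1 ((extendsC_univ_iff.2 hF).chartGamma isOpen_univ Subset.rfl (mem_univ y) hy
    (extendsC_univ_iff.2 hG))

theorem contDiffAt_chartDiffusion {α : M} {y : E} (hy : y ∈ (extChartAt (𝓡 n) α).target)
    {V F : E → ℝ} {k : ℕ} (hV : ContDiffAt ℝ (k + 1 : ℕ) V y)
    (hF : ContDiffAt ℝ (k + 2 : ℕ) F y) : ContDiffAt ℝ k (chartDiffusion α V F) y :=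
  extendsC_univ_iff.1 ((extendsC_univ_iff.2 hV).chartDiffusion isOpen_univ Subset.rfl (mem_univ y) hy
    (extendsC_univ_iff.2 hF))

/-- The operators are iterated, so the chart formulas for `Γ(u)` and `Lu` must hold on a
neighbourhood of the point. The orders suffice: `Γ(u)` is `C²` and `Lu` is `C¹` when `V` is `C²` and
`u` is `C³`. -/
theorem gammaTwo_chart {α : M} {V u : M → ℝ} {y : E} (hy : y ∈ (extChartAt (𝓡 n) α).target)
    (hV : ContDiffAt ℝ 2 (chartFun (n := n) α V) y)
    (hu : ContDiffAt ℝ 3 (chartFun (n := n) α u) y) :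
    gammaTwo n V u u ((extChartAt (𝓡 n) α).symm y) =
      (1 / 2) * (chartDiffusion α (chartFun α V) (chartGamma α (chartFun α u) (chartFun α u)) y -
        chartGamma α (chartDiffusion α (chartFun α V) (chartFun α u)) (chartFun α u) y -
        chartGamma α (chartFun α u) (chartDiffusion α (chartFun α V) (chartFun α u)) y) := by
  have hev : ∀ᶠ z in 𝓝 y, z ∈ (extChartAt (𝓡 n) α).target ∧
      ContDiffAt ℝ 2 (chartFun (n := n) α V) z ∧ ContDiffAt ℝ 3 (chartFun (n := n) α u) z :=
    ((isOpen_chart_target α).eventually_mem hy).and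
      ((hV.eventually (by simp)).and (hu.eventually (by simp)))
  have h1 : chartFun α (carreDuChamp n u u) =ᶠ[𝓝 y]
      chartGamma α (chartFun α u) (chartFun α u) := by
    filter_upwards [hev] with z hz
    exact carreDuChamp_chart hz.1 (hz.2.2.differentiableAt (by simp))
      (hz.2.2.differentiableAt (by simp))
  have h2 : chartFun α (diffusion n V u) =ᶠ[𝓝 y]
      chartDiffusion α (chartFun α V) (chartFun α u) := by
    filter_upwards [hev] with z hz
    exact diffusion_chart hz.1 (hz.2.1.differentiableAt (by simp)) (hz.2.2.of_le (by norm_num))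
  have hc1 : ContDiffAt ℝ 2 (chartGamma α (chartFun α u) (chartFun α u)) y :=
    contDiffAt_chartGamma (k := 2) hy hu hu
  have hc2 : ContDiffAt ℝ 1 (chartDiffusion α (chartFun α V) (chartFun α u)) y :=
    contDiffAt_chartDiffusion (k := 1) hy hV hu
  have hc2' : DifferentiableAt ℝ (chartFun α (diffusion n V u)) y :=
    (hc2.differentiableAt (by simp)).congr_of_eventuallyEq h2
  have hu' : DifferentiableAt ℝ (chartFun (n := n) α u) y := hu.differentiableAt (by simp)
  have e1 := diffusion_chart hy (hV.differentiableAt (by simp)) (hc1.congr_of_eventuallyEq h1)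
  have e2 := carreDuChamp_chart hy hc2' hu'
  have e3 := carreDuChamp_chart hy hu' hc2'
  rw [gammaTwo, e1, e2, e3]
  congr 2
  · congr 1
    · exact chartDiffusion_congr h1
    · exact chartGamma_congr h2 EventuallyEq.rfl
  · exact chartGamma_congr EventuallyEq.rfl h2

variable {D : Set M}

theorem tendsto_chart_nhdsWithin {α p : M} (hp : p ∈ (extChartAt (𝓡 n) α).source) :
    Tendsto (extChartAt (𝓡 n) α) (𝓝[D] p) (𝓝[chartDomain α D] (extChartAt (𝓡 n) α p)) := by
  have hsrc := (isOpen_extChartAt_source (I := 𝓡 n) α).mem_nhds hp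
  refine tendsto_nhdsWithin_iff.2 ⟨?_, ?_⟩
  · exact (((contMDiffOn_chart α).continuousOn.continuousAt hsrc).tendsto).mono_left inf_le_left
  · filter_upwards [mem_nhdsWithin_of_mem_nhds hsrc, self_mem_nhdsWithin] with x hx hxD
    refine ⟨(extChartAt (𝓡 n) α).map_source hx, ?_⟩
    rw [mem_preimage, (extChartAt (𝓡 n) α).left_inv hx]
    exact hxD

theorem tendsto_chart_symm_nhdsWithin {α : M} {y : E} (hy : y ∈ (extChartAt (𝓡 n) α).target) :
    Tendsto (extChartAt (𝓡 n) α).symm (𝓝[chartDomain α D] y)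
      (𝓝[D] ((extChartAt (𝓡 n) α).symm y)) := by
  refine tendsto_nhdsWithin_iff.2 ⟨?_, ?_⟩
  · exact ((contMDiffAt_chart_symm hy).continuousAt.tendsto).mono_left inf_le_left
  · filter_upwards [self_mem_nhdsWithin] with z hz using hz.2

theorem hasLimits_of_extendsC {F : M → ℝ}
    (h : ∀ α : M, ∀ y ∈ chartDomain (n := n) α (closure D),
      ExtendsC 0 (chartDomain α D) (chartDomain α (closure D)) y (chartFun α F)) :
    HasLimits D F := by
  intro p hp
  have hps := mem_extChartAt_source (I := 𝓡 n) p
  have hy : extChartAt (𝓡 n) p p ∈ chartDomain (n := n) p (closure D) := by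
    refine ⟨(extChartAt (𝓡 n) p).map_source hps, ?_⟩
    rw [mem_preimage, (extChartAt (𝓡 n) p).left_inv hps]
    exact hp
  obtain ⟨c, hc⟩ := (h p _ hy).exists_tendsto (chartDomain_subset p D)
  refine ⟨c, (hc.comp (tendsto_chart_nhdsWithin hps)).congr' ?_⟩
  filter_upwards [mem_nhdsWithin_of_mem_nhds
    ((isOpen_extChartAt_source (I := 𝓡 n) p).mem_nhds hps)] with x hx
  rw [Function.comp_apply, chartFun, (extChartAt (𝓡 n) p).left_inv hx]

theorem contDiffWithinAt_chartFun {f : M → ℝ} {k : ℕ∞ω} (hk : k ≤ ∞) {A : Set M}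
    (hf : ContMDiffOn (𝓡 n) 𝓘(ℝ, ℝ) k f A) {α : M} {y : E} (hy : y ∈ chartDomain α A) :
    ContDiffWithinAt ℝ k (chartFun α f) (chartDomain α A) y := by
  rw [← contMDiffWithinAt_iff_contDiffWithinAt]
  exact (hf _ hy.2).comp y (((contMDiffOn_chart_symm α) y hy.1 |>.of_le hk).mono inter_subset_left)
    (fun z hz => hz.2)

theorem extendsC_chartFun {α : M} {y : E} (hy : y ∈ chartDomain α (closure D)) (k : ℕ)
    {u : M → ℝ} (hu : ContMDiffOn (𝓡 n) 𝓘(ℝ, ℝ) ∞ u (closure D)) :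
    ExtendsC k (chartDomain α D) (chartDomain α (closure D)) y (chartFun α u) :=
  ExtendsC.of_contDiffWithinAt
    ((contDiffWithinAt_chartFun le_rfl hu hy).of_le (by exact_mod_cast le_top))

theorem extendsC_chartFun_two {α : M} {y : E} (hy : y ∈ chartDomain α (closure D))
    {V : M → ℝ} (hV : ContMDiffOn (𝓡 n) 𝓘(ℝ, ℝ) 2 V (closure D)) :
    ExtendsC 2 (chartDomain α D) (chartDomain α (closure D)) y (chartFun α V) :=
  ExtendsC.of_contDiffWithinAt (contDiffWithinAt_chartFun two_le_infty hV hy)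

theorem contDiffAt_chartFun (hD : IsOpen D) {f : M → ℝ} {k : ℕ∞ω} (hk : k ≤ ∞)
    (hf : ContMDiffOn (𝓡 n) 𝓘(ℝ, ℝ) k f (closure D)) {α : M} {y : E} (hy : y ∈ chartDomain α D) :
    ContDiffAt ℝ k (chartFun α f) y :=
  (contDiffWithinAt_chartFun hk (hf.mono subset_closure) hy).contDiffAt
    ((isOpen_chartDomain α hD).mem_nhds hy)

theorem extendsC_carreDuChamp {u v : M → ℝ} (hD : IsOpen D)
    (hu : ContMDiffOn (𝓡 n) 𝓘(ℝ, ℝ) ∞ u (closure D))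
    (hv : ContMDiffOn (𝓡 n) 𝓘(ℝ, ℝ) ∞ v (closure D))
    {α : M} {y : E} (hy : y ∈ chartDomain α (closure D)) (k : ℕ) :
    ExtendsC k (chartDomain α D) (chartDomain α (closure D)) y
      (chartFun α (carreDuChamp n u v)) := by
  refine ((extendsC_chartFun hy (k + 1) hu).chartGamma (isOpen_chartDomain α hD)
    (chartDomain_subset α D) hy hy.1 (extendsC_chartFun hy (k + 1) hv)).congr ?_
  filter_upwards [self_mem_nhdsWithin] with z hz
  exact carreDuChamp_chart hz.1 ((contDiffAt_chartFun hD le_rfl hu hz).differentiableAt (by simp))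
    ((contDiffAt_chartFun hD le_rfl hv hz).differentiableAt (by simp))

theorem extendsC_diffusion {V u : M → ℝ} (hD : IsOpen D)
    (hV : ContMDiffOn (𝓡 n) 𝓘(ℝ, ℝ) 2 V (closure D))
    (hu : ContMDiffOn (𝓡 n) 𝓘(ℝ, ℝ) ∞ u (closure D))
    {α : M} {y : E} (hy : y ∈ chartDomain α (closure D)) :
    ExtendsC 1 (chartDomain α D) (chartDomain α (closure D)) y
      (chartFun α (diffusion n V u)) := by
  refine ((extendsC_chartFun_two hy hV).chartDiffusion (isOpen_chartDomain α hD)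
    (chartDomain_subset α D) hy hy.1 (extendsC_chartFun hy 3 hu)).congr ?_
  filter_upwards [self_mem_nhdsWithin] with z hz
  exact diffusion_chart hz.1
    ((contDiffAt_chartFun hD two_le_infty hV hz).differentiableAt (by simp))
    ((contDiffAt_chartFun hD le_rfl hu hz).of_le two_le_infty)

theorem extendsC_gammaTwo {V u : M → ℝ} (hD : IsOpen D)
    (hV : ContMDiffOn (𝓡 n) 𝓘(ℝ, ℝ) 2 V (closure D))
    (hu : ContMDiffOn (𝓡 n) 𝓘(ℝ, ℝ) ∞ u (closure D))
    {α : M} {y : E} (hy : y ∈ chartDomain α (closure D)) :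
    ExtendsC 0 (chartDomain α D) (chartDomain α (closure D)) y
      (chartFun α (gammaTwo n V u u)) := by
  have hΩ := isOpen_chartDomain (n := n) α hD
  have hΩS := chartDomain_subset (n := n) α D
  have hu3 := extendsC_chartFun (n := n) hy 3 hu
  have hV2 := extendsC_chartFun_two (n := n) hy hV
  have hΓ : ExtendsC 2 _ _ y _ := hu3.chartGamma hΩ hΩS hy hy.1 hu3
  have hL : ExtendsC 1 _ _ y _ := hV2.chartDiffusion hΩ hΩS hy hy.1 hu3
  have h1 := (hV2.of_le one_le_two).chartDiffusion (k := 0) hΩ hΩS hy hy.1 hΓ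
  have h2 := hL.chartGamma hΩ hΩS hy hy.1 (hu3.of_le (by norm_num : 0 + 1 ≤ 3))
  have h3 := (hu3.of_le (by norm_num : 0 + 1 ≤ 3)).chartGamma hΩ hΩS hy hy.1 hL
  refine (((h1.add (h2.clm_comp (-ContinuousLinearMap.id ℝ ℝ))).add
    (h3.clm_comp (-ContinuousLinearMap.id ℝ ℝ))).clm_comp
      ((1 / 2 : ℝ) • ContinuousLinearMap.id ℝ ℝ)).congr ?_
  filter_upwards [self_mem_nhdsWithin] with z hz
  rw [chartFun, gammaTwo_chart hz.1 (contDiffAt_chartFun hD two_le_infty hV hz)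
    ((contDiffAt_chartFun hD le_rfl hu hz).of_le three_le_infty)]
  simp [sub_eq_add_neg]

end ChartDomain

/-! ### Differentials along rays entering a domain. -/

section Rays

variable {F : Type*} [NormedAddCommGroup F] [NormedSpace ℝ F]

theorem hasDerivAt_ray {g : F → ℝ} {y : F} (hg : DifferentiableAt ℝ g y) (v : F) :
    HasDerivAt (fun t : ℝ => g (y + t • v)) (fderiv ℝ g y v) 0 := by
  have h1 : HasDerivAt (fun t : ℝ => y + t • v) v 0 := by
    simpa using ((hasDerivAt_id (0 : ℝ)).smul_const v).const_add y
  have h2 : HasFDerivAt g (fderiv ℝ g y) (y + (0 : ℝ) • v) := by simpa using hg.hasFDerivAt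
  exact h2.comp_hasDerivAt 0 h1

theorem tendsto_ray (y v : F) : Tendsto (fun t : ℝ => y + t • v) (𝓝[>] 0) (𝓝 y) := by
  have h : Continuous fun t : ℝ => y + t • v := by fun_prop
  have h' := h.tendsto 0
  rw [zero_smul, add_zero] at h'
  exact h'.mono_left inf_le_left

theorem eventually_pos_ray {g : F → ℝ} {y v : F} (hg : DifferentiableAt ℝ g y) (hg0 : g y = 0)
    (hv : 0 < fderiv ℝ g y v) : ∀ᶠ t in 𝓝[>] (0 : ℝ), 0 < g (y + t • v) := by
  have h1 := (hasDerivAt_iff_tendsto_slope.1 (hasDerivAt_ray hg v)).mono_left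
    (nhdsWithin_mono 0 (fun t (ht : t ∈ Ioi (0 : ℝ)) => ne_of_gt ht))
  filter_upwards [h1.eventually (lt_mem_nhds hv), self_mem_nhdsWithin] with t ht ht0
  have ht0' : (0 : ℝ) < t := ht0
  simp only [slope_def_field, zero_smul, add_zero, hg0, sub_zero] at ht
  exact (div_pos_iff_of_pos_right ht0').1 ht

theorem fderiv_nonneg_of_eventually_pos_ray {g : F → ℝ} {y v : F} (hg : DifferentiableAt ℝ g y)
    (hg0 : g y = 0) (hv : ∀ᶠ t in 𝓝[>] (0 : ℝ), 0 < g (y + t • v)) : 0 ≤ fderiv ℝ g y v := by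
  by_contra h
  have h1 : 0 < fderiv ℝ (fun z => -g z) y v := by
    rw [fderiv_fun_neg]
    simpa using h
  obtain ⟨t, ht, ht'⟩ := ((eventually_pos_ray hg.neg (by simpa using hg0) h1).and hv).exists
  have ht2 : 0 < -g (y + t • v) := ht
  linarith

/-- On the affine hyperplane `φ = 1` the functional `ψ` is bounded below, so it vanishes on the
kernel of `φ`. -/
theorem eq_smul_of_pos_imp_nonneg {φ ψ : F →L[ℝ] ℝ} (hφ : φ ≠ 0)
    (h : ∀ v, 0 < φ v → 0 ≤ ψ v) : ∃ c : ℝ, ψ = c • φ := by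
  obtain ⟨w, hw⟩ : ∃ w, φ w ≠ 0 := by
    by_contra! H
    exact hφ (by ext v; simpa using H v)
  set v0 := (φ w)⁻¹ • w with hv0
  have hφ0 : φ v0 = 1 := by simp [hv0, hw]
  have hker : ∀ v, φ v = 0 → ψ v = 0 := by
    intro v hv
    have h1 : ∀ t : ℝ, 0 ≤ ψ v0 + t * ψ v := by
      intro t
      have := h (v0 + t • v) (by simp [hφ0, hv])
      simpa using this
    by_contra hne
    have := h1 (-(ψ v0 + 1) / ψ v)
    rw [div_mul_cancel₀ _ hne] at this
    linarith
  refine ⟨ψ v0, ?_⟩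
  ext v
  have := hker (v - φ v • v0) (by simp [hφ0])
  simp only [map_sub, map_smul, smul_eq_mul] at this
  simp only [smul_apply, smul_eq_mul]
  linarith

/-- Both values are the one-sided derivative of `g` along the ray. This replaces uniqueness of the
derivative within `S` at a boundary point. -/
theorem hasFDerivWithinAt_eq_of_ray {g : F → ℝ} {S : Set F} {y v : F} {L L' : F →L[ℝ] ℝ}
    (hL : HasFDerivWithinAt g L S y) (hL' : HasFDerivWithinAt g L' S y) (hy : y ∈ S)
    (hv : ∀ᶠ t in 𝓝[>] (0 : ℝ), y + t • v ∈ S) : L v = L' v := by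
  obtain ⟨δ, hδ, hsub⟩ := mem_nhdsGT_iff_exists_Ioc_subset.1 hv
  have hδ0 : (0 : ℝ) < δ := hδ
  have hmaps : MapsTo (fun t : ℝ => y + t • v) (Icc 0 δ) S := by
    intro t ht
    rcases ht.1.lt_or_eq with h | h
    · exact hsub ⟨h, ht.2⟩
    · simp only [← h, zero_smul, add_zero]; exact hy
  have h1 : HasDerivWithinAt (fun t : ℝ => y + t • v) v (Icc 0 δ) 0 := by
    have : HasDerivAt (fun t : ℝ => y + t • v) v 0 := by
      simpa using ((hasDerivAt_id (0 : ℝ)).smul_const v).const_add y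
    exact this.hasDerivWithinAt
  have e : y + (0 : ℝ) • v = y := by simp
  have a1 : HasDerivWithinAt (g ∘ fun t : ℝ => y + t • v) (L v) (Icc 0 δ) 0 :=
    HasFDerivWithinAt.comp_hasDerivWithinAt 0 (by rw [e]; exact hL) h1 hmaps
  have a2 : HasDerivWithinAt (g ∘ fun t : ℝ => y + t • v) (L' v) (Icc 0 δ) 0 :=
    HasFDerivWithinAt.comp_hasDerivWithinAt 0 (by rw [e]; exact hL') h1 hmaps
  exact (uniqueDiffOn_Icc hδ0 0 ⟨le_rfl, hδ0.le⟩).eq_deriv _ a1 a2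

end Rays

/-! ### From a vanishing normal derivative to `∇ρ · ∇f → 0` at the boundary. -/

section Neumann

variable {n : ℕ} {M : Type*} [MetricSpace M]
  [ChartedSpace (EuclideanSpace ℝ (Fin n)) M] [IsManifold (𝓡 n) ∞ M]
  [Bundle.RiemannianBundle (fun x : M => TangentSpace (𝓡 n) x)]
  [IsContMDiffRiemannianBundle (𝓡 n) ∞ (EuclideanSpace ℝ (Fin n))
      (fun x : M => TangentSpace (𝓡 n) x)]

local notation "E" => EuclideanSpace ℝ (Fin n)

/-- `f` has vanishing normal derivative on the boundary of `D`, in the sense that `∇ρ · ∇f` tends to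
zero at the boundary for all local defining functions `ρ`. -/
def NeumannCondition (n : ℕ) {M : Type*} [MetricSpace M]
    [ChartedSpace (EuclideanSpace ℝ (Fin n)) M] [IsManifold (𝓡 n) ∞ M]
    [Bundle.RiemannianBundle (fun x : M => TangentSpace (𝓡 n) x)] (D : Set M) (f : M → ℝ) : Prop :=
  ∀ p ∈ frontier D, ∀ ρ : M → ℝ, IsLocalDefiningFunction n D p ρ →
    Tendsto (carreDuChamp n ρ f) (𝓝[D] p) (𝓝 0)

theorem eq_zero_of_mem_frontier {D : Set M} (hD : IsOpen D) {p : M} (hp : p ∈ frontier D)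
    {ρ : M → ℝ} {U : Set M} (hU : IsOpen U) (hpU : p ∈ U)
    (hρ : ContMDiffOn (𝓡 n) 𝓘(ℝ, ℝ) ∞ ρ U) (hDU : D ∩ U = {q ∈ U | 0 < ρ q}) : ρ p = 0 := by
  rw [hD.frontier_eq] at hp
  refine le_antisymm ?_ ?_
  · by_contra h
    exact hp.2 ((hDU.symm ▸ ⟨hpU, not_le.1 h⟩ : p ∈ D ∩ U)).1
  · have h1 : ContinuousWithinAt ρ D p :=
      ((hρ.continuousOn.continuousAt (hU.mem_nhds hpU))).continuousWithinAt
    have : (𝓝[D] p).NeBot := mem_closure_iff_nhdsWithin_neBot.1 hp.1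
    refine ge_of_tendsto h1.tendsto ?_
    filter_upwards [self_mem_nhdsWithin, mem_nhdsWithin_of_mem_nhds (hU.mem_nhds hpU)] with q hq hqU
    exact ((hDU ▸ ⟨hq, hqU⟩ : q ∈ {q ∈ U | 0 < ρ q})).2.le

theorem contDiffAt_chartFun_of_isOpen {U : Set M} (hU : IsOpen U) {ρ : M → ℝ}
    (hρ : ContMDiffOn (𝓡 n) 𝓘(ℝ, ℝ) ∞ ρ U) {α : M} {y : E} (hy : y ∈ chartDomain α U) :
    ContDiffAt ℝ ∞ (chartFun α ρ) y :=
  (contDiffWithinAt_chartFun le_rfl hρ hy).contDiffAt ((isOpen_chartDomain α hU).mem_nhds hy)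

theorem fderiv_chartFun_ne_zero {α : M} {ρ : M → ℝ} {y : E}
    (hy : y ∈ (extChartAt (𝓡 n) α).target) (hρ : DifferentiableAt ℝ (chartFun (n := n) α ρ) y)
    (h : mvfderiv (𝓡 n) ρ ((extChartAt (𝓡 n) α).symm y) ≠ 0) :
    fderiv ℝ (chartFun (n := n) α ρ) y ≠ 0 := by
  intro h0
  apply h
  ext v
  rw [← chartFrame_chartCoframe hy v, mvfderiv_chartFrame hy (mdifferentiableAt_of_chart hy hρ)]
  change fderiv ℝ (chartFun (n := n) α ρ) y _ = _
  rw [h0]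
  rfl

theorem eventually_ray_mem_chartDomain {D : Set M} {α : M} {y v : E} {ρ : M → ℝ} {U : Set M}
    (hU : IsOpen U) (hy : y ∈ chartDomain α U) (hρ : ContMDiffOn (𝓡 n) 𝓘(ℝ, ℝ) ∞ ρ U)
    (hDU : D ∩ U = {q ∈ U | 0 < ρ q}) (hρ0 : chartFun α ρ y = 0)
    (hv : 0 < fderiv ℝ (chartFun α ρ) y v) :
    ∀ᶠ t in 𝓝[>] (0 : ℝ), y + t • v ∈ chartDomain α D := by
  have hd := (contDiffAt_chartFun_of_isOpen hU hρ hy).differentiableAt (by simp)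
  filter_upwards [eventually_pos_ray hd hρ0 hv,
    (tendsto_ray y v).eventually ((isOpen_chartDomain α hU).mem_nhds hy)] with t h1 h2
  exact ⟨h2.1, ((hDU.symm ▸ ⟨h2.2, h1⟩ :
    (extChartAt (𝓡 n) α).symm (y + t • v) ∈ D ∩ U)).1⟩

theorem hasFDerivWithinAt_chartFun {D : Set M} {f : M → ℝ} {α : M} {y : E}
    (hy : y ∈ chartDomain α D)
    (hf : MDifferentiableWithinAt (𝓡 n) 𝓘(ℝ, ℝ) f D ((extChartAt (𝓡 n) α).symm y)) :
    HasFDerivWithinAt (chartFun α f)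
      ((mvfderivWithin (𝓡 n) f D ((extChartAt (𝓡 n) α).symm y)).comp (chartFrame α y))
      (chartDomain α D) y := by
  have h1 := (mdifferentiableAt_chart_symm hy.1).hasMFDerivAt.hasMFDerivWithinAt
    (s := chartDomain α D)
  have h2 := hf.hasMFDerivWithinAt.comp y h1 (fun z hz => hz.2)
  exact h2.hasFDerivWithinAt

/-- The normal is built from one chosen defining function `σ`, whereas `ρ` is arbitrary. If `dσ(v) >
0`, the ray in direction `v` enters `D`, where `ρ > 0`, so `dρ(v) ≥ 0`; hence `dρ` is a multiple of
`dσ` at the boundary point. The rest is continuity of the extended differential of `f`. -/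
theorem tendsto_carreDuChamp_of_normal {D : Set M} (hD : IsOpen D) {f : M → ℝ}
    (hf : ContMDiffOn (𝓡 n) 𝓘(ℝ, ℝ) ∞ f (closure D)) {α : M} {y : E}
    (hy : y ∈ (extChartAt (𝓡 n) α).target) (hp : (extChartAt (𝓡 n) α).symm y ∈ frontier D)
    {ρ : M → ℝ} (hρ : IsLocalDefiningFunction n D ((extChartAt (𝓡 n) α).symm y) ρ)
    (hN : mvfderivWithin (𝓡 n) f (closure D) ((extChartAt (𝓡 n) α).symm y)
      (inwardNormal n D ((extChartAt (𝓡 n) α).symm y)) = 0) :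
    Tendsto (fun z => carreDuChamp n ρ f ((extChartAt (𝓡 n) α).symm z)) (𝓝[chartDomain α D] y)
      (𝓝 0) := by
  set p := (extChartAt (𝓡 n) α).symm y with hpdef
  have hex : ∃ ρ : M → ℝ, IsLocalDefiningFunction n D p ρ := ⟨ρ, hρ⟩
  set σ := definingFunction n D p with hσdef
  have hσ : IsLocalDefiningFunction n D p σ := by
    rw [hσdef, definingFunction, dif_pos hex]
    exact hex.choose_spec
  obtain ⟨U, hU, hpU, hρs, hρd, hρD⟩ := hρ
  obtain ⟨U', hU', hpU', hσs, hσd, hσD⟩ := hσ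
  have hyU : y ∈ chartDomain (n := n) α U := ⟨hy, hpU⟩
  have hyU' : y ∈ chartDomain (n := n) α U' := ⟨hy, hpU'⟩
  have hρ0 : chartFun (n := n) α ρ y = 0 := eq_zero_of_mem_frontier hD hp hU hpU hρs hρD
  have hσ0 : chartFun (n := n) α σ y = 0 := eq_zero_of_mem_frontier hD hp hU' hpU' hσs hσD
  have hρc := contDiffAt_chartFun_of_isOpen hU hρs hyU
  have hσc := contDiffAt_chartFun_of_isOpen hU' hσs hyU'
  have hρdiff := hρc.differentiableAt (by simp)
  have hσdiff := hσc.differentiableAt (by simp)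
  have hdρ : fderiv ℝ (chartFun (n := n) α ρ) y ≠ 0 := fderiv_chartFun_ne_zero hy hρdiff (hρd p hpU)
  have hdσ : fderiv ℝ (chartFun (n := n) α σ) y ≠ 0 :=
    fderiv_chartFun_ne_zero hy hσdiff (hσd p hpU')
  -- the two defining functions have parallel gradients
  obtain ⟨c, hc⟩ : ∃ c : ℝ, fderiv ℝ (chartFun (n := n) α ρ) y =
      c • fderiv ℝ (chartFun (n := n) α σ) y := by
    refine eq_smul_of_pos_imp_nonneg hdσ fun v hv => ?_
    refine fderiv_nonneg_of_eventually_pos_ray hρdiff hρ0 ?_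
    filter_upwards [eventually_ray_mem_chartDomain hU' hyU' hσs hσD hσ0 hv,
      (tendsto_ray y v).eventually ((isOpen_chartDomain α hU).mem_nhds hyU)] with t h1 h2
    exact ((hρD ▸ ⟨h1.2, h2.2⟩ :
      (extChartAt (𝓡 n) α).symm (y + t • v) ∈ {q ∈ U | 0 < ρ q})).2
  have hgrad : chartGrad α (chartFun (n := n) α ρ) y = c • chartGrad α (chartFun (n := n) α σ) y := by
    simp only [chartGrad, hc]
    rw [← WithLp.toLp_smul, ← Matrix.mulVec_smul]
    rfl
  have hgσ : grad n σ p = chartFrame α y (chartGrad α (chartFun (n := n) α σ) y) :=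
    grad_eq_chartFrame hy hσdiff
  have hgσ0 : grad n σ p ≠ 0 := by
    intro h0
    apply hσd p hpU'
    ext v
    rw [← inner_grad, h0]
    simp
  have hNσ : mvfderivWithin (𝓡 n) f (closure D) p (grad n σ p) = 0 := by
    have h1 : ‖grad n σ p‖⁻¹ • mvfderivWithin (𝓡 n) f (closure D) p (grad n σ p) = 0 := by
      rw [← map_smul]; exact hN
    exact (smul_eq_zero.1 h1).resolve_left (inv_ne_zero (norm_ne_zero_iff.2 hgσ0))
  have hyS : y ∈ chartDomain (n := n) α (closure D) := ⟨hy, frontier_subset_closure hp⟩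
  have hL := hasFDerivWithinAt_chartFun hyS ((hf p hyS.2).mdifferentiableWithinAt (by simp))
  -- the extension of the differential to the boundary
  have hf1 : ContDiffWithinAt ℝ 1 (chartFun (n := n) α f) (chartDomain α (closure D)) y :=
    (contDiffWithinAt_chartFun le_rfl hf hyS).of_le (by exact_mod_cast le_top)
  obtain ⟨u, hu, -, -, H', hH', hHc⟩ :=
    (contDiffWithinAt_succ_iff_hasFDerivWithinAt' (n := 0) (by simp)).1
      (by rw [zero_add]; exact hf1)
  rw [insert_eq_of_mem hyS] at hu
  have hyu : y ∈ u := mem_of_mem_nhdsWithin hyS hu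
  have hw : 0 < fderiv ℝ (chartFun (n := n) α ρ) y (chartGrad α (chartFun (n := n) α ρ) y) :=
    fderiv_chartGrad_self_pos hy hdρ
  have hray : ∀ᶠ t in 𝓝[>] (0 : ℝ), y + t • chartGrad α (chartFun (n := n) α ρ) y ∈
      chartDomain α (closure D) := by
    filter_upwards [eventually_ray_mem_chartDomain hU hyU hρs hρD hρ0 hw] with t ht
    exact chartDomain_subset α D ht
  -- `H' y` and the differential of `f` within the closure are both derivatives of `f` within the
  -- closure at `y`. They are compared only on `∇ρ`, which points into `D`.
  have hzero : H' y (chartGrad α (chartFun (n := n) α ρ) y) = 0 := by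
    rw [hasFDerivWithinAt_eq_of_ray (hH' y hyu) hL hyS hray, ContinuousLinearMap.comp_apply, hgrad,
      map_smul, map_smul, ← hgσ]
    change c • mvfderivWithin (𝓡 n) f (closure D) p (grad n σ p) = 0
    rw [hNσ, smul_zero]
  have hΩ := isOpen_chartDomain (n := n) α hD
  have hΩS := chartDomain_subset (n := n) α D
  have hlim : Tendsto (fun z => H' z (chartGrad α (chartFun (n := n) α ρ) z))
      (𝓝[chartDomain α D] y) (𝓝 0) := by
    rw [← hzero]
    have h1 : Tendsto H' (𝓝[chartDomain α D] y) (𝓝 (H' y)) :=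
      (hHc.continuousWithinAt.mono hΩS).tendsto
    have h2 : Tendsto (chartGrad α (chartFun (n := n) α ρ)) (𝓝[chartDomain α D] y)
        (𝓝 (chartGrad α (chartFun (n := n) α ρ) y)) :=
      ((contDiffAt_chartGrad hy (k := 0) (m := ⊤) hρc le_top).continuousAt.tendsto).mono_left
        inf_le_left
    exact (isBoundedBilinearMap_apply.continuous.tendsto (H' y, _)).comp (h1.prodMk_nhds h2)
  refine hlim.congr' ?_
  filter_upwards [nhdsWithin_mono y hΩS hu, self_mem_nhdsWithin,
    mem_nhdsWithin_of_mem_nhds ((isOpen_chartDomain α hU).mem_nhds hyU)] with z hzu hz hzU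
  have hfz : DifferentiableAt ℝ (chartFun (n := n) α f) z :=
    (contDiffAt_chartFun hD le_rfl hf hz).differentiableAt (by simp)
  have hρz : DifferentiableAt ℝ (chartFun (n := n) α ρ) z :=
    (contDiffAt_chartFun_of_isOpen hU hρs hzU).differentiableAt (by simp)
  rw [carreDuChamp_chart hz.1 hρz hfz, chartGamma_comm _ _ hz.1, chartGamma]
  congr 1
  exact ((hH' z hzu).hasFDerivAt (mem_of_superset (hΩ.mem_nhds hz) hΩS)).fderiv.symm

theorem neumannCondition_of_normal {D : Set M} (hD : IsOpen D) {f : M → ℝ}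
    (hf : ContMDiffOn (𝓡 n) 𝓘(ℝ, ℝ) ∞ f (closure D))
    (hN : ∀ p ∈ frontier D, mvfderivWithin (𝓡 n) f (closure D) p (inwardNormal n D p) = 0) :
    NeumannCondition n D f := by
  intro p hp ρ hρ
  have hps := mem_extChartAt_source (I := 𝓡 n) p
  have hps' := (isOpen_extChartAt_source (I := 𝓡 n) p).mem_nhds hps
  have hleft := (extChartAt (𝓡 n) p).left_inv hps
  have h := tendsto_carreDuChamp_of_normal hD hf (α := p) ((extChartAt (𝓡 n) p).map_source hps)
    (by rw [hleft]; exact hp) (ρ := ρ) (by rw [hleft]; exact hρ) (hN _ (by rw [hleft]; exact hp))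
  refine (h.comp (tendsto_chart_nhdsWithin hps)).congr' ?_
  filter_upwards [mem_nhdsWithin_of_mem_nhds hps'] with x hx
  rw [Function.comp_apply, (extChartAt (𝓡 n) p).left_inv hx]

end Neumann

/-! ### Locality of the differential operators. -/

section Germs

variable {n : ℕ} {M : Type*} [MetricSpace M]
  [ChartedSpace (EuclideanSpace ℝ (Fin n)) M] [IsManifold (𝓡 n) ∞ M]
  [Bundle.RiemannianBundle (fun x : M => TangentSpace (𝓡 n) x)]

theorem divergence_congr {X Y : ∀ x : M, TangentSpace (𝓡 n) x} {x : M}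
    (h : ∀ᶠ y in 𝓝 x, X y = Y y) : divergence n X x = divergence n Y x := by
  have hs : Tendsto (extChartAt (𝓡 n) x).symm (𝓝 (extChartAt (𝓡 n) x x)) (𝓝 x) := by
    simpa [ContinuousAt] using continuousAt_extChartAt_symm (I := 𝓡 n) x
  rw [divergence, divergence]
  congr 1
  refine Finset.sum_congr rfl fun i _ => ?_
  congr 1
  refine EventuallyEq.fderiv_eq ?_
  filter_upwards [hs.eventually h] with z hz
  rw [coordField, coordField, hz]

theorem grad_congr {f g : M → ℝ} {x : M} (h : f =ᶠ[𝓝 x] g) : grad n f x = grad n g x := by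
  have h1 : mvfderiv (𝓡 n) f x = mvfderiv (𝓡 n) g x := h.mfderiv_eq
  rw [grad, grad, h1]

theorem carreDuChamp_congr {f g u v : M → ℝ} {x : M} (h : f =ᶠ[𝓝 x] g) (h' : u =ᶠ[𝓝 x] v) :
    carreDuChamp n f u x = carreDuChamp n g v x := by
  rw [carreDuChamp, carreDuChamp, grad_congr h, grad_congr h']

theorem diffusion_congr {V f g : M → ℝ} {x : M} (h : f =ᶠ[𝓝 x] g) :
    diffusion n V f x = diffusion n V g x := by
  rw [diffusion, diffusion, laplaceBeltrami, laplaceBeltrami, grad_congr h,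
    divergence_congr (h.eventuallyEq_nhds.mono fun y hy => grad_congr hy)]

theorem gammaTwo_congr {V f g : M → ℝ} {x : M} (h : f =ᶠ[𝓝 x] g) :
    gammaTwo n V f f x = gammaTwo n V g g x := by
  have h1 : carreDuChamp n f f =ᶠ[𝓝 x] carreDuChamp n g g :=
    h.eventuallyEq_nhds.mono fun y hy => carreDuChamp_congr hy hy
  have h2 : diffusion n V f =ᶠ[𝓝 x] diffusion n V g :=
    h.eventuallyEq_nhds.mono fun y hy => diffusion_congr hy
  rw [gammaTwo, gammaTwo, diffusion_congr h1, carreDuChamp_congr h2 h, carreDuChamp_congr h h2]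

end Germs

/-! ### Green's formula under the Neumann condition. -/

section Green

variable {n : ℕ} {M : Type*} [MetricSpace M]
  [ChartedSpace (EuclideanSpace ℝ (Fin n)) M] [IsManifold (𝓡 n) ∞ M]
  [Bundle.RiemannianBundle (fun x : M => TangentSpace (𝓡 n) x)]
  [IsContMDiffRiemannianBundle (𝓡 n) ∞ (EuclideanSpace ℝ (Fin n))
      (fun x : M => TangentSpace (𝓡 n) x)]

local notation "E" => EuclideanSpace ℝ (Fin n)

/-- The field `√g e^V f ∇u` in the chart at `α`. -/
def fluxField (α : M) (V f u : M → ℝ) (z : E) : E :=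
  (Real.exp (chartFun α V z) * chartFun α f z) •
    (volumeDensity n α z • chartGrad α (chartFun α u) z)

theorem extendsC_fluxField {D : Set M} (hD : IsOpen D) {V f u : M → ℝ}
    (hV : ContMDiffOn (𝓡 n) 𝓘(ℝ, ℝ) 2 V (closure D))
    (hf : ContMDiffOn (𝓡 n) 𝓘(ℝ, ℝ) ∞ f (closure D))
    (hu : ContMDiffOn (𝓡 n) 𝓘(ℝ, ℝ) ∞ u (closure D)) {α : M} {y : E}
    (hy : y ∈ chartDomain α (closure D)) :
    ExtendsC 1 (chartDomain α D) (chartDomain α (closure D)) y (fluxField α V f u) := by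
  have hV' : ContDiffWithinAt ℝ 1 (chartFun (n := n) α V) (chartDomain α (closure D)) y :=
    (contDiffWithinAt_chartFun two_le_infty hV hy).of_le (by norm_num)
  refine ExtendsC.smul (ExtendsC.mul (ExtendsC.of_contDiffWithinAt hV'.exp)
    (extendsC_chartFun hy 1 hf)) (ExtendsC.smul (ExtendsC.of_contDiffAt
      ((contDiffAt_volumeDensity hy.1).of_le (by exact_mod_cast le_top))) ?_)
  exact (extendsC_chartFun hy 2 hu).chartGrad (isOpen_chartDomain α hD) (chartDomain_subset α D) hy
    hy.1

/-- Product rule: differentiating `√g ∇u` gives `√g Δu`, the factor `e^V` supplies the drift `∇V ·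
∇u` of `L`, and the factor `f` gives `Γ(f, u)`. -/
theorem trace_fderiv_fluxField {D : Set M} (hD : IsOpen D) {V f u : M → ℝ}
    (hV : ContMDiffOn (𝓡 n) 𝓘(ℝ, ℝ) 2 V (closure D))
    (hf : ContMDiffOn (𝓡 n) 𝓘(ℝ, ℝ) ∞ f (closure D))
    (hu : ContMDiffOn (𝓡 n) 𝓘(ℝ, ℝ) ∞ u (closure D)) {α : M} {z : E} (hz : z ∈ chartDomain α D) :
    LinearMap.trace ℝ E (fderiv ℝ (fluxField α V f u) z) =
      volumeDensity n α z * chartFun α (fun x =>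
        (f x * diffusion n V u x + carreDuChamp n f u x) * Real.exp (V x)) z := by
  have hVz : DifferentiableAt ℝ (chartFun (n := n) α V) z :=
    (contDiffAt_chartFun hD two_le_infty hV hz).differentiableAt (by simp)
  have hfz : DifferentiableAt ℝ (chartFun (n := n) α f) z :=
    (contDiffAt_chartFun hD le_rfl hf hz).differentiableAt (by simp)
  have huz : ContDiffAt ℝ 2 (chartFun (n := n) α u) z :=
    (contDiffAt_chartFun hD le_rfl hu hz).of_le two_le_infty
  have hw : DifferentiableAt ℝ (volumeDensity n α) z :=
    (contDiffAt_volumeDensity hz.1).differentiableAt (by simp)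
  have hg : DifferentiableAt ℝ (chartGrad α (chartFun (n := n) α u)) z :=
    (contDiffAt_chartGrad hz.1 (k := 1) (m := 2) huz (by norm_num)).differentiableAt (by simp)
  have hw0 := (volumeDensity_pos hz.1).ne'
  have hc : HasFDerivAt (fun z => Real.exp (chartFun (n := n) α V z) * chartFun (n := n) α f z)
      (Real.exp (chartFun (n := n) α V z) • fderiv ℝ (chartFun (n := n) α f) z +
        chartFun (n := n) α f z • (Real.exp (chartFun (n := n) α V z) •
          fderiv ℝ (chartFun (n := n) α V) z)) z :=
    hVz.hasFDerivAt.exp.fun_mul hfz.hasFDerivAt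
  have hdiv : volumeDensity n α z * chartDiv α (chartGrad α (chartFun (n := n) α u)) z =
      LinearMap.trace ℝ E (fderiv ℝ (fun z => volumeDensity n α z •
        chartGrad α (chartFun (n := n) α u) z) z) := by
    rw [trace_fderiv_smul hw hg, chartDiv, weighted_divergence_eq hw hg, mul_inv_cancel_left₀ hw0,
      add_comm]
  have e1 : chartFun α (diffusion n V u) z = _ := diffusion_chart hz.1 hVz huz
  have e2 : chartFun α (carreDuChamp n f u) z = _ :=
    carreDuChamp_chart hz.1 hfz (huz.differentiableAt (by simp))
  have e3 : fluxField α V f u = fun z => (Real.exp (chartFun α V z) * chartFun α f z) •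
    (volumeDensity n α z • chartGrad α (chartFun (n := n) α u) z) := rfl
  have e4 : chartFun α (fun x => (f x * diffusion n V u x + carreDuChamp n f u x) *
      Real.exp (V x)) z = (chartFun α f z * chartFun α (diffusion n V u) z +
        chartFun α (carreDuChamp n f u) z) * Real.exp (chartFun α V z) := rfl
  rw [e3, trace_fderiv_smul hc.differentiableAt (hw.fun_smul hg), ← hdiv, hc.fderiv, e4, e1, e2]
  simp only [add_apply, smul_apply, smul_eq_mul, map_smul, chartDiffusion, chartGamma]
  change _ = volumeDensity n α z * ((chartFun α f z * (chartDiv α (chartGrad α (chartFun α u)) z +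
    fderiv ℝ (chartFun α V) z (chartGrad α (chartFun α u) z)) +
    fderiv ℝ (chartFun α f) z (chartGrad α (chartFun α u) z)) * Real.exp (chartFun α V z))
  ring

/-- Supplies the weight `ρ` and the bound `dρ(Y) = O(ρ)` that `integral_divergence_of_tangent`
requires, in a form common to interior and boundary points. At the boundary, `dρ(Y)` is `Γ(ρ, u)`
times a factor with a limit, so it tends to zero. -/
theorem exists_boundary_weight {D : Set M} (hD : IsOpen D)
    (hDs : ∀ p ∈ frontier D, ∃ ρ : M → ℝ, IsLocalDefiningFunction n D p ρ) {V f u : M → ℝ}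
    (hV : ContMDiffOn (𝓡 n) 𝓘(ℝ, ℝ) 2 V (closure D))
    (hf : ContMDiffOn (𝓡 n) 𝓘(ℝ, ℝ) ∞ f (closure D))
    (hu : ContMDiffOn (𝓡 n) 𝓘(ℝ, ℝ) ∞ u (closure D)) (hN : NeumannCondition n D u) {α : M} {y : E}
    (hy : y ∈ chartDomain α (closure D)) :
    ∃ (ρ : E → ℝ) (W : Set E) (C : ℝ), W ∈ 𝓝 y ∧ (∀ z ∈ W, ContDiffAt ℝ 1 ρ z) ∧
      chartDomain α D ∩ W = {z ∈ W | 0 < ρ z} ∧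
      ∀ z ∈ chartDomain α D ∩ W, |fderiv ℝ ρ z (fluxField α V f u z)| ≤ C * ρ z := by
  have hΩ := isOpen_chartDomain (n := n) α hD
  have hΩS := chartDomain_subset (n := n) α D
  by_cases hyD : (extChartAt (𝓡 n) α).symm y ∈ D
  -- At an interior point the constant weight `1` serves; its differential is zero.
  · refine ⟨fun _ => 1, chartDomain α D, 0, hΩ.mem_nhds ⟨hy.1, hyD⟩,
      fun _ _ => contDiffAt_const, by ext; simp, fun z _ => by simp⟩
  have hp : (extChartAt (𝓡 n) α).symm y ∈ frontier D := by
    rw [hD.frontier_eq]; exact ⟨hy.2, hyD⟩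
  obtain ⟨ρ, U, hU, hpU, hρs, hρd, hρD⟩ := hDs _ hp
  have hyU : y ∈ chartDomain (n := n) α U := ⟨hy.1, hpU⟩
  have hρc : ∀ z ∈ chartDomain (n := n) α U, ContDiffAt ℝ ∞ (chartFun (n := n) α ρ) z := fun z hz =>
    contDiffAt_chartFun_of_isOpen hU hρs hz
  have hflux := extendsC_fluxField hD hV hf hu hy
  have hh : ExtendsC 1 (chartDomain α D) (chartDomain α (closure D)) y
      fun z => fderiv ℝ (chartFun (n := n) α ρ) z (fluxField α V f u z) := by
    refine ExtendsC.clm_apply (ExtendsC.of_contDiffAt ?_) hflux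
    exact (hρc y hyU).fderiv_right (m := 1) (by norm_cast)
  obtain ⟨C, hC⟩ := (hh.fderiv (k := 0) hΩ hΩS hy).eventually_norm_le hΩS
  obtain ⟨U1, hU1, hU1s⟩ := mem_nhdsWithin_iff_exists_mem_nhds_inter.1
    (hC.and (hh.eventually_contDiffAt hΩ hΩS hy))
  have hdom : ∀ T ⊆ chartDomain (n := n) α U,
      chartDomain α D ∩ T = {z ∈ T | 0 < chartFun (n := n) α ρ z} := by
    intro T hT
    ext z
    constructor
    · rintro ⟨h1, h2⟩
      exact ⟨h2, ((hρD ▸ ⟨h1.2, (hT h2).2⟩ :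
        (extChartAt (𝓡 n) α).symm z ∈ {q ∈ U | 0 < ρ q})).2⟩
    · rintro ⟨h1, h2⟩
      exact ⟨⟨(hT h1).1, ((hρD.symm ▸ ⟨(hT h1).2, h2⟩ :
        (extChartAt (𝓡 n) α).symm z ∈ D ∩ U)).1⟩, h1⟩
  have hyUn := (isOpen_chartDomain α hU).mem_nhds hyU
  obtain ⟨C', W, hW, hWC⟩ := abs_le_mul_of_tendsto_zero_boundary (Ω := chartDomain α D)
    (U := U1 ∩ chartDomain α U) (y := y) (ρ := chartFun α ρ)
    (h := fun z => fderiv ℝ (chartFun (n := n) α ρ) z (fluxField α V f u z)) (C := C)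
    (inter_mem hU1 hyUn) ((hρc y hyU).of_le (by exact_mod_cast le_top))
    (eq_zero_of_mem_frontier hD hp hU hpU hρs hρD)
    (fderiv_chartFun_ne_zero hy.1 ((hρc y hyU).differentiableAt (by simp)) (hρd _ hpU))
    (hdom _ inter_subset_right)
    (fun z hz => (hU1s ⟨hz.2.1, hz.1⟩).2.differentiableAt (by simp))
    (fun z hz => (hU1s ⟨hz.2.1, hz.1⟩).1)
    (by
      intro z hz hz0
      have hzt := tendsto_chart_symm_nhdsWithin (D := D) hz.2.1
      by_cases hzS : (extChartAt (𝓡 n) α).symm z ∈ closure D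
      · have hzf : (extChartAt (𝓡 n) α).symm z ∈ frontier D := by
          rw [hD.frontier_eq]
          refine ⟨hzS, fun hzD => ?_⟩
          have h1 : (extChartAt (𝓡 n) α).symm z ∈ {q ∈ U | 0 < ρ q} := hρD ▸ ⟨hzD, hz.2.2⟩
          exact h1.2.ne' hz0
        have h1 := (hN _ hzf ρ ⟨U, hU, hz.2.2, hρs, hρd, hρD⟩).comp hzt
        have hzS' : z ∈ chartDomain (n := n) α (closure D) := ⟨hz.2.1, hzS⟩
        have hV' : ContDiffWithinAt ℝ 0 (chartFun (n := n) α V) (chartDomain α (closure D)) z :=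
          (contDiffWithinAt_chartFun two_le_infty hV hzS').of_le (by norm_num)
        have h2 : ExtendsC 0 (chartDomain α D) (chartDomain α (closure D)) z fun z =>
            (Real.exp (chartFun (n := n) α V z) * chartFun (n := n) α f z) *
              volumeDensity n α z :=
          ((ExtendsC.of_contDiffWithinAt hV'.exp).mul (extendsC_chartFun hzS' 0 hf)).mul
            (ExtendsC.of_contDiffAt ((contDiffAt_volumeDensity hz.2.1).of_le
              (by exact_mod_cast le_top)))
        obtain ⟨c, hc⟩ := h2.exists_tendsto hΩS
        have h3 := hc.mul h1
        rw [mul_zero] at h3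
        refine h3.congr' ?_
        filter_upwards [self_mem_nhdsWithin, mem_nhdsWithin_of_mem_nhds
          ((isOpen_chartDomain α hU).mem_nhds hz.2)] with w hw hwU
        have e1 : carreDuChamp n ρ u ((extChartAt (𝓡 n) α).symm w) = _ :=
          carreDuChamp_chart hw.1 ((hρc w hwU).differentiableAt (by simp))
            ((contDiffAt_chartFun hD le_rfl hu hw).differentiableAt (by simp))
        rw [Function.comp_apply, e1, fluxField, map_smul, map_smul]
        simp only [smul_eq_mul, chartGamma]
        rw [mul_assoc]
        rfl
      -- A zero of `ρ` outside the closure of `D` is not excluded, but there the limit along `D` is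
      -- vacuous.
      · have h1 : 𝓝[D] ((extChartAt (𝓡 n) α).symm z) = ⊥ :=
          not_neBot.1 fun h => hzS (mem_closure_iff_nhdsWithin_neBot.2 h)
        rw [h1] at hzt
        have h2 : 𝓝[chartDomain α D] z = ⊥ := Filter.map_eq_bot_iff.1 (le_bot_iff.1 hzt)
        rw [h2]
        exact tendsto_bot)
  refine ⟨chartFun α ρ, W ∩ chartDomain α U, C', inter_mem hW hyUn, fun z hz => ?_,
    hdom _ inter_subset_right, fun z hz => hWC z ⟨hz.1, hz.2.1⟩⟩
  exact (hρc z hz.2).of_le (by exact_mod_cast le_top)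

/-- A smooth function on `M` supported in a compact subset of a chart domain, in coordinates. -/
theorem exists_contDiff_chart_extension {α : M} {χ : M → ℝ} (hχ : ContMDiff (𝓡 n) 𝓘(ℝ, ℝ) ∞ χ)
    (hχc : HasCompactSupport χ) {W : Set E} (hW : W ⊆ (extChartAt (𝓡 n) α).target)
    (hχW : tsupport χ ⊆ (extChartAt (𝓡 n) α).source ∩ extChartAt (𝓡 n) α ⁻¹' W) :
    ∃ χ' : E → ℝ, ContDiff ℝ 1 χ' ∧ HasCompactSupport χ' ∧ tsupport χ' ⊆ W ∧
      ∀ z ∈ (extChartAt (𝓡 n) α).target, χ' =ᶠ[𝓝 z] chartFun α χ := by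
  set K : Set E := extChartAt (𝓡 n) α '' tsupport χ with hK
  have hKc : IsCompact K := hχc.image_of_continuousOn
    ((contMDiffOn_chart α).continuousOn.mono (hχW.trans inter_subset_left))
  have hKW : K ⊆ W := by
    rintro _ ⟨x, hx, rfl⟩
    exact (hχW hx).2
  set χ' : E → ℝ := (extChartAt (𝓡 n) α).target.indicator (chartFun α χ) with hχ'
  have hev : ∀ z ∈ (extChartAt (𝓡 n) α).target, χ' =ᶠ[𝓝 z] chartFun α χ := by
    intro z hz
    filter_upwards [(isOpen_chart_target α).mem_nhds hz] with w hw
    rw [hχ', indicator_of_mem hw]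
  have hsupp : Function.support χ' ⊆ K := by
    intro z hz
    by_cases hzt : z ∈ (extChartAt (𝓡 n) α).target
    · refine ⟨(extChartAt (𝓡 n) α).symm z, subset_tsupport χ ?_, (extChartAt (𝓡 n) α).right_inv hzt⟩
      rw [Function.mem_support, (hev z hzt).eq_of_nhds] at hz
      exact hz
    · exact absurd (indicator_of_notMem hzt _) hz
  refine ⟨χ', ?_, HasCompactSupport.of_support_subset_isCompact hKc hsupp,
    (closure_minimal hsupp hKc.isClosed).trans hKW, hev⟩
  rw [contDiff_iff_contDiffAt]
  intro z
  by_cases hzt : z ∈ (extChartAt (𝓡 n) α).target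
  · have h1 : ContDiffAt ℝ ∞ (chartFun (n := n) α χ) z :=
      contDiffAt_chartFun_of_isOpen isOpen_univ hχ.contMDiffOn ⟨hzt, mem_univ _⟩
    exact (h1.of_le (by exact_mod_cast le_top)).congr_of_eventuallyEq (hev z hzt)
  · have hzK : z ∉ K := fun h => hzt (hW (hKW h))
    refine contDiffAt_const (c := (0 : ℝ)) |>.congr_of_eventuallyEq ?_
    filter_upwards [hKc.isClosed.isOpen_compl.mem_nhds hzK] with w hw
    by_contra h
    exact hw (hsupp h)

theorem carreDuChamp_eq_zero_of_eventuallyEq_const {f : M → ℝ} {x : M} {c : ℝ}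
    (h : f =ᶠ[𝓝 x] fun _ => c) (u : M → ℝ) : carreDuChamp n f u x = 0 := by
  rw [carreDuChamp_congr h (EventuallyEq.refl _ u), carreDuChamp, inner_grad, mvfderiv_const]
  rfl

section Integral

variable [MeasurableSpace M] [BorelSpace M] [SecondCountableTopology M]

/-- Local Green formula: the integrand is the weighted divergence of `χ f ∇u`. The neighbourhood is
chosen before `χ`, so that a partition of unity can be subordinated to such neighbourhoods. -/
theorem exists_nhds_integral_green {D : Set M} (hD : IsOpen D) (hDc : IsCompact (closure D))
    (hDs : ∀ p ∈ frontier D, ∃ ρ : M → ℝ, IsLocalDefiningFunction n D p ρ) {V f u : M → ℝ}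
    (hV : ContMDiffOn (𝓡 n) 𝓘(ℝ, ℝ) 2 V (closure D))
    (hf : ContMDiffOn (𝓡 n) 𝓘(ℝ, ℝ) ∞ f (closure D))
    (hu : ContMDiffOn (𝓡 n) 𝓘(ℝ, ℝ) ∞ u (closure D)) (hN : NeumannCondition n D u) {p : M}
    (hp : p ∈ closure D) :
    ∃ N : Set M, IsOpen N ∧ p ∈ N ∧ ∀ χ : M → ℝ, ContMDiff (𝓡 n) 𝓘(ℝ, ℝ) ∞ χ →
      HasCompactSupport χ → tsupport χ ⊆ N →
      IntegrableOn (fun x => (χ x * (f x * diffusion n V u x + carreDuChamp n f u x) +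
        f x * carreDuChamp n χ u x) * Real.exp (V x)) D (riemannianVolume n M) ∧
      ∫ x in D, (χ x * (f x * diffusion n V u x + carreDuChamp n f u x) +
        f x * carreDuChamp n χ u x) * Real.exp (V x) ∂(riemannianVolume n M) = 0 := by
  have hps := mem_extChartAt_source (I := 𝓡 n) p
  have hy : extChartAt (𝓡 n) p p ∈ chartDomain (n := n) p (closure D) := by
    refine ⟨(extChartAt (𝓡 n) p).map_source hps, ?_⟩
    rw [mem_preimage, (extChartAt (𝓡 n) p).left_inv hps]
    exact hp
  set y := extChartAt (𝓡 n) p p with hydef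
  have hΩ := isOpen_chartDomain (n := n) p hD
  have hΩS := chartDomain_subset (n := n) p D
  obtain ⟨ρ, W, C, hW, hρ, hWD, hWC⟩ := exists_boundary_weight hD hDs hV hf hu hN hy
  have hflux := extendsC_fluxField hD hV hf hu hy
  obtain ⟨C1, hC1⟩ := (hflux.of_le zero_le_one).eventually_norm_le hΩS
  have htr : ExtendsC 0 (chartDomain p D) (chartDomain p (closure D)) y fun z =>
      LinearMap.trace ℝ E (fderiv ℝ (fluxField p V f u) z) := by
    simp only [clm_trace_eq_sum]
    exact ExtendsC.sum fun i _ => ((hflux.fderiv (k := 0) hΩ hΩS hy).clm_apply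
      (ExtendsC.of_contDiffAt contDiffAt_const)).clm_comp (EuclideanSpace.proj (𝕜 := ℝ) i)
  obtain ⟨C2, hC2⟩ := htr.eventually_norm_le hΩS
  obtain ⟨U1, hU1, hU1s⟩ := mem_nhdsWithin_iff_exists_mem_nhds_inter.1
    ((hC1.and hC2).and (hflux.eventually_contDiffAt hΩ hΩS hy))
  obtain ⟨W', hW's, hW'o, hyW'⟩ := mem_nhds_iff.1
    (inter_mem (inter_mem hW hU1) ((isOpen_chart_target p).mem_nhds hy.1))
  refine ⟨(extChartAt (𝓡 n) p).source ∩ extChartAt (𝓡 n) p ⁻¹' W',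
    (contMDiffOn_chart p).continuousOn.isOpen_inter_preimage
      (isOpen_extChartAt_source (I := 𝓡 n) p) hW'o, ⟨hps, hyW'⟩, fun χ hχ hχc hχN => ?_⟩
  obtain ⟨χ', hχ', hχ'c, hχ'W, hχ'e⟩ := exists_contDiff_chart_extension hχ hχc
    (fun z hz => (hW's hz).2) hχN
  set C3 := max C (max C1 C2) with hC3
  have hmain : ∫ z in chartDomain p D, (χ' z * LinearMap.trace ℝ E (fderiv ℝ (fluxField p V f u) z) +
      fderiv ℝ χ' z (fluxField p V f u z)) = 0 := by
    refine integral_divergence_of_tangent (W := W') (ρ := ρ) (C := C3) hΩ hW'o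
      (fun z hz => (hρ z (hW's hz).1.1).contDiffWithinAt) ?_ ?_ ?_ ?_ ?_ hχ' hχ'c hχ'W
    · ext z
      constructor
      · rintro ⟨h1, h2⟩
        exact ⟨h2, ((hWD ▸ ⟨h1, (hW's h2).1.1⟩ : z ∈ {z ∈ W | 0 < ρ z})).2⟩
      · rintro ⟨h1, h2⟩
        exact ⟨((hWD.symm ▸ ⟨(hW's h1).1.1, h2⟩ : z ∈ chartDomain p D ∩ W)).1, h1⟩
    · intro z hz
      exact (hU1s ⟨(hW's hz.2).1.2, hz.1⟩).2.contDiffWithinAt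
    · intro z hz
      exact (hU1s ⟨(hW's hz.2).1.2, hz.1⟩).1.1.trans
        ((le_max_left _ _).trans (le_max_right _ _))
    · intro z hz
      exact (hU1s ⟨(hW's hz.2).1.2, hz.1⟩).1.2.trans
        ((le_max_right _ _).trans (le_max_right _ _))
    · intro z hz
      have hzW : z ∈ chartDomain p D ∩ W := ⟨hz.1, (hW's hz.2).1.1⟩
      refine (hWC z hzW).trans (mul_le_mul_of_nonneg_right (le_max_left _ _) ?_)
      exact ((hWD ▸ hzW : z ∈ {z ∈ W | 0 < ρ z})).2.le
  have hlimits : HasLimits D (fun x => (χ x * (f x * diffusion n V u x + carreDuChamp n f u x) +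
        f x * carreDuChamp n χ u x) * Real.exp (V x)) := by
    have l1 : HasLimits D (diffusion n V u) := hasLimits_of_extendsC fun α y hy =>
      (extendsC_diffusion hD hV hu hy).of_le zero_le_one
    have l2 : HasLimits D (carreDuChamp n f u) := hasLimits_of_extendsC fun α y hy =>
      extendsC_carreDuChamp hD hf hu hy 0
    have l3 : HasLimits D (carreDuChamp n χ u) := hasLimits_of_extendsC fun α y hy =>
      extendsC_carreDuChamp hD hχ.contMDiffOn hu hy 0
    have l4 : HasLimits D f := .of_continuousOn hf.continuousOn
    have l5 : HasLimits D χ := .of_continuousOn hχ.continuous.continuousOn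
    have l6 : HasLimits D fun x => Real.exp (V x) :=
      .of_continuousOn (Real.continuous_exp.comp_continuousOn hV.continuousOn)
    exact ((l5.mul ((l4.mul l1).add l2)).add (l4.mul l3)).mul l6
  have hvol : riemannianVolume n M D < ⊤ :=
    (measure_mono subset_closure).trans_lt (riemannianVolume_lt_top_of_isCompact hDc)
  have hint := hlimits.integrableOn (μ := riemannianVolume n M) hD hDc hvol
  refine ⟨hint, ?_⟩
  have hsrc := isOpen_extChartAt_source (I := 𝓡 n) p
  have hzero : ∀ x ∈ D \ (D ∩ (extChartAt (𝓡 n) p).source),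
      (χ x * (f x * diffusion n V u x + carreDuChamp n f u x) +
        f x * carreDuChamp n χ u x) * Real.exp (V x) = 0 := by
    rintro x ⟨hx, hx'⟩
    have hxs : x ∉ tsupport χ := fun h => hx' ⟨hx, (hχN h).1⟩
    have h0 : χ =ᶠ[𝓝 x] fun _ => 0 := notMem_tsupport_iff_eventuallyEq.1 hxs
    have h1 : carreDuChamp n χ u x = 0 := carreDuChamp_eq_zero_of_eventuallyEq_const h0 u
    rw [h0.eq_of_nhds, h1]
    ring
  rw [setIntegral_eq_of_subset_of_forall_sdiff_eq_zero hD.measurableSet inter_subset_left hzero,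
    setIntegral_riemannianVolume (hD.inter hsrc).measurableSet inter_subset_right
      (hint.aestronglyMeasurable.mono_measure (Measure.restrict_mono inter_subset_left le_rfl)),
    ← hmain]
  have hset : (extChartAt (𝓡 n) p).target ∩ (extChartAt (𝓡 n) p).symm ⁻¹'
      (D ∩ (extChartAt (𝓡 n) p).source) = chartDomain p D := by
    ext z
    exact ⟨fun h => ⟨h.1, h.2.1⟩, fun h => ⟨h.1, h.2, (extChartAt (𝓡 n) p).map_target h.1⟩⟩
  rw [hset]
  refine setIntegral_congr_fun hΩ.measurableSet fun z hz => ?_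
  have hχz : DifferentiableAt ℝ (chartFun (n := n) p χ) z :=
    (contDiffAt_chartFun hD le_rfl hχ.contMDiffOn hz).differentiableAt (by simp)
  have huz : DifferentiableAt ℝ (chartFun (n := n) p u) z :=
    (contDiffAt_chartFun hD le_rfl hu hz).differentiableAt (by simp)
  have e1 : carreDuChamp n χ u ((extChartAt (𝓡 n) p).symm z) = fderiv ℝ (chartFun (n := n) p χ) z
    (chartGrad p (chartFun (n := n) p u) z) := carreDuChamp_chart hz.1 hχz huz
  rw [trace_fderiv_fluxField hD hV hf hu hz, (hχ'e z hz.1).eq_of_nhds, (hχ'e z hz.1).fderiv_eq, e1,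
    fluxField, map_smul, map_smul]
  simp only [chartFun, smul_eq_mul]
  ring

/-- The differentials of a partition of unity add up to the differential of `1`; this removes the
terms `f Γ(χ_i, u)` from the sum of the local formulas. -/
theorem sum_carreDuChamp {ι : Type*} (s : Finset ι) {χ : ι → M → ℝ} {x : M}
    (hχ : ∀ i ∈ s, MDifferentiableAt (𝓡 n) 𝓘(ℝ, ℝ) (χ i) x)
    (hsum : (fun x => ∑ i ∈ s, χ i x) =ᶠ[𝓝 x] fun _ => 1) (u : M → ℝ) :
    ∑ i ∈ s, carreDuChamp n (χ i) u x = 0 := by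
  classical
  have key : ∀ t ⊆ s, MDifferentiableAt (𝓡 n) 𝓘(ℝ, ℝ) (fun x => ∑ i ∈ t, χ i x) x ∧
      ∑ i ∈ t, carreDuChamp n (χ i) u x = carreDuChamp n (fun x => ∑ i ∈ t, χ i x) u x := by
    intro t
    induction t using Finset.induction_on with
    | empty =>
      intro _
      refine ⟨by simpa using mdifferentiableAt_const, ?_⟩
      simp only [Finset.sum_empty, carreDuChamp, inner_grad, mvfderiv_const]
      rfl
    | insert a t ha ih =>
      intro hts
      obtain ⟨h1, h2⟩ := ih ((Finset.subset_insert a t).trans hts)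
      have h3 := hχ a (hts (Finset.mem_insert_self a t))
      simp only [Finset.sum_insert ha, h2]
      refine ⟨h3.add h1, ?_⟩
      have h4 := mvfderiv_add h3 h1
      simp only [carreDuChamp, inner_grad]
      change _ = mvfderiv (𝓡 n) (χ a + fun x => ∑ i ∈ t, χ i x) x _
      rw [h4]
      rfl
  rw [(key s subset_rfl).2]
  exact carreDuChamp_eq_zero_of_eventuallyEq_const hsum u

/-- Green's formula for the weighted measure, without boundary term. -/
theorem integral_green {D : Set M} (hD : IsOpen D) (hDc : IsCompact (closure D))
    (hDs : ∀ p ∈ frontier D, ∃ ρ : M → ℝ, IsLocalDefiningFunction n D p ρ) {V f u : M → ℝ}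
    (hV : ContMDiffOn (𝓡 n) 𝓘(ℝ, ℝ) 2 V (closure D))
    (hf : ContMDiffOn (𝓡 n) 𝓘(ℝ, ℝ) ∞ f (closure D))
    (hu : ContMDiffOn (𝓡 n) 𝓘(ℝ, ℝ) ∞ u (closure D)) (hN : NeumannCondition n D u) :
    weightedIntegral n V D (fun x => f x * diffusion n V u x + carreDuChamp n f u x) = 0 := by
  have : LocallyCompactSpace M := ChartedSpace.locallyCompactSpace E M
  choose N hNo hpN hNint using fun p : closure D =>
    exists_nhds_integral_green hD hDc hDs hV hf hu hN p.2
  -- The compact neighbourhoods force the functions of the partition of unity to have compact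
  -- support.
  choose K hKc hKp using fun p : closure D => exists_compact_mem_nhds (p : M)
  obtain ⟨χ, hχ⟩ := SmoothPartitionOfUnity.exists_isSubordinate (𝓡 n) isClosed_closure
    (fun p : closure D => N p ∩ interior (K p)) (fun p => (hNo p).inter isOpen_interior)
    (fun p hp => mem_iUnion.2 ⟨⟨p, hp⟩, hpN ⟨p, hp⟩, mem_interior_iff_mem_nhds.2 (hKp ⟨p, hp⟩)⟩)
  have hfin := χ.locallyFinite.finite_nonempty_inter_compact hDc
  set s : Finset (closure D) := hfin.toFinset with hs
  have hsum : ∀ x ∈ closure D, ∑ i ∈ s, χ i x = 1 := by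
    intro x hx
    rw [← χ.sum_eq_one hx]
    refine (finsum_eq_sum_of_support_subset _ ?_).symm
    intro i hi
    simp only [hs, Finite.coe_toFinset]
    exact ⟨x, hi, hx⟩
  have hcs : ∀ i, HasCompactSupport (χ i) := fun i =>
    HasCompactSupport.of_support_subset_isCompact (hKc i)
      ((subset_tsupport _).trans ((hχ i).trans (inter_subset_right.trans interior_subset)))
  have hi := fun i => hNint i (χ i) (χ i).contMDiff (hcs i) ((hχ i).trans inter_subset_left)
  rw [weightedIntegral]
  have hpt : ∀ x ∈ D, (f x * diffusion n V u x + carreDuChamp n f u x) * Real.exp (V x) =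
      ∑ i ∈ s, (χ i x * (f x * diffusion n V u x + carreDuChamp n f u x) +
        f x * carreDuChamp n (χ i) u x) * Real.exp (V x) := by
    intro x hx
    have h1 : ∑ i ∈ s, carreDuChamp n (χ i) u x = 0 := by
      refine sum_carreDuChamp s
        (fun i _ => ((χ i).contMDiff x).mdifferentiableAt (by simp)) ?_ u
      filter_upwards [hD.mem_nhds hx] with w hw using hsum w (subset_closure hw)
    rw [← Finset.sum_mul, Finset.sum_add_distrib, ← Finset.sum_mul, ← Finset.mul_sum, h1,
      hsum x (subset_closure hx)]
    ring
  rw [setIntegral_congr_fun hD.measurableSet hpt, integral_finsetSum _ fun i _ => (hi i).1]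
  exact Finset.sum_eq_zero fun i _ => (hi i).2

end Integral

end Green

/-! ### One-sided derivatives of `Φ` on an interval. -/

section OneVariable

variable {J : Set ℝ} {Φ : ℝ → ℝ}

theorem secondDeriv_eq (J : Set ℝ) (Φ : ℝ → ℝ) :
    secondDeriv J Φ = derivWithin (derivWithin Φ J) J := by
  rw [secondDeriv, iteratedDerivWithin_succ, iteratedDerivWithin_one]

/-- A one-point interval is excluded because `derivWithin` takes the default value `0` where
derivatives are not unique; every other nonempty interval has nonempty interior. -/
theorem uniqueDiffOn_of_secondDeriv_ne_zero (hJ : J.OrdConnected)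
    (h : ∀ r ∈ J, secondDeriv J Φ r ≠ 0) : UniqueDiffOn ℝ J := by
  rcases J.subsingleton_or_nontrivial with hs | hs
  · intro r hr
    by_contra hu
    exact h r hr (by rw [secondDeriv_eq, derivWithin_zero_of_not_uniqueDiffWithinAt hu])
  · exact uniqueDiffOn_convex hJ.convex (hJ.convex.nontrivial_iff_nonempty_interior.1 hs)

theorem contDiffOn_derivWithin (hJ : UniqueDiffOn ℝ J) (hΦ : ContDiffOn ℝ ∞ Φ J) :
    ContDiffOn ℝ ∞ (derivWithin Φ J) J :=
  hΦ.derivWithin hJ (by simp)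

theorem contDiffOn_secondDeriv (hJ : UniqueDiffOn ℝ J) (hΦ : ContDiffOn ℝ ∞ Φ J) :
    ContDiffOn ℝ ∞ (secondDeriv J Φ) J := by
  rw [secondDeriv_eq]
  exact contDiffOn_derivWithin hJ (contDiffOn_derivWithin hJ hΦ)

theorem secondDeriv_nonpos_of_concaveOn (hΦ : DifferentiableOn ℝ Φ J) (hc : ConcaveOn ℝ J Φ)
    (r : ℝ) : secondDeriv J Φ r ≤ 0 := by
  rw [secondDeriv_eq]
  exact (hc.antitoneOn_derivWithin hΦ).derivWithin_nonpos

end OneVariable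

/-! ### Localizing the curvature-dimension condition, and the chain rule. -/

section Localization

variable {n : ℕ} {M : Type*} [MetricSpace M]
  [ChartedSpace (EuclideanSpace ℝ (Fin n)) M] [IsManifold (𝓡 n) ∞ M]
  [Bundle.RiemannianBundle (fun x : M => TangentSpace (𝓡 n) x)]

/-- Multiply by a bump function at `x` supported in `D`. The curvature-dimension condition tests
only functions smooth on all of `M`, and its terms depend only on the germ at `x`. -/
theorem exists_contMDiff_eventuallyEq [SecondCountableTopology M] {D : Set M} (hD : IsOpen D)
    {u : M → ℝ} (hu : ContMDiffOn (𝓡 n) 𝓘(ℝ, ℝ) ∞ u D) {x : M} (hx : x ∈ D) :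
    ∃ φ : M → ℝ, ContMDiff (𝓡 n) 𝓘(ℝ, ℝ) ∞ φ ∧ φ =ᶠ[𝓝 x] u := by
  have : LocallyCompactSpace M := ChartedSpace.locallyCompactSpace (EuclideanSpace ℝ (Fin n)) M
  obtain ⟨t, ht, htc, htD⟩ := exists_mem_nhds_isClosed_subset (hD.mem_nhds hx)
  obtain ⟨χ, h1, h0, -⟩ := exists_contMDiffMap_one_nhds_of_subset_interior (𝓡 n) (n := (⊤ : ℕ∞))
    (isClosed_singleton (x := x)) (singleton_subset_iff.2 (mem_interior_iff_mem_nhds.2 ht))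
  rw [nhdsSet_singleton] at h1
  refine ⟨fun y => χ y * u y, fun y => ?_, ?_⟩
  · by_cases hy : y ∈ D
    · exact (χ.contMDiff y).mul (hu.contMDiffAt (hD.mem_nhds hy))
    · refine contMDiffAt_const (c := (0 : ℝ)) |>.congr_of_eventuallyEq ?_
      filter_upwards [htc.isOpen_compl.mem_nhds fun h => hy (htD h)] with z hz
      rw [h0 z hz, zero_mul]
  · filter_upwards [h1] with y hy
    rw [hy, one_mul]

/-- The curvature-dimension condition for functions that are smooth on `D` only. -/
theorem CurvatureDimension.of_contMDiffOn [SecondCountableTopology M] {D : Set M} (hD : IsOpen D)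
    {V : M → ℝ} {K m : ℝ} (h : CurvatureDimension n V D K m) {u : M → ℝ}
    (hu : ContMDiffOn (𝓡 n) 𝓘(ℝ, ℝ) ∞ u D) {x : M} (hx : x ∈ D) :
    K * carreDuChamp n u u x + (1 / m) * diffusion n V u x ^ 2 ≤ gammaTwo n V u u x := by
  obtain ⟨φ, hφ, hφu⟩ := exists_contMDiff_eventuallyEq hD hu hx
  have := h φ hφ x hx
  rwa [carreDuChamp_congr hφu hφu, diffusion_congr hφu, gammaTwo_congr hφu] at this

theorem grad_comp {D : Set M} (hD : IsOpen D) {J : Set ℝ} {g : ℝ → ℝ}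
    (hg : DifferentiableOn ℝ g J) {f : M → ℝ} (hfJ : MapsTo f D J) {x : M} (hx : x ∈ D)
    (hf : MDifferentiableAt (𝓡 n) 𝓘(ℝ, ℝ) f x) :
    grad n (fun y => g (f y)) x = derivWithin g J (f x) • grad n f x := by
  have h1 : HasMFDerivWithinAt 𝓘(ℝ, ℝ) 𝓘(ℝ, ℝ) g J (f x)
      (ContinuousLinearMap.toSpanSingleton ℝ (derivWithin g J (f x))) :=
    (hg (f x) (hfJ hx)).hasDerivWithinAt.hasFDerivWithinAt.hasMFDerivWithinAt
  have h2 := (h1.comp x hf.hasMFDerivAt.hasMFDerivWithinAt hfJ).hasMFDerivAt (hD.mem_nhds hx)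
  have h3 : mvfderiv (𝓡 n) (fun y => g (f y)) x =
      derivWithin g J (f x) • mvfderiv (𝓡 n) f x := by
    ext v
    have := congrArg (fun L => L v) h2.mfderiv
    exact this.trans (mul_comm (mvfderiv (𝓡 n) f x v) (derivWithin g J (f x)))
  rw [grad, grad, h3, map_smulₛₗ]
  rfl

end Localization

/-! ### Integration of the pointwise inequality. -/

section Integral

variable {n : ℕ} {M : Type*} [MetricSpace M]
  [ChartedSpace (EuclideanSpace ℝ (Fin n)) M] [IsManifold (𝓡 n) ∞ M]
  [Bundle.RiemannianBundle (fun x : M => TangentSpace (𝓡 n) x)]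
  [IsContMDiffRiemannianBundle (𝓡 n) ∞ (EuclideanSpace ℝ (Fin n))
      (fun x : M => TangentSpace (𝓡 n) x)]

theorem hasLimits_carreDuChamp {D : Set M} (hD : IsOpen D) {u v : M → ℝ}
    (hu : ContMDiffOn (𝓡 n) 𝓘(ℝ, ℝ) ∞ u (closure D))
    (hv : ContMDiffOn (𝓡 n) 𝓘(ℝ, ℝ) ∞ v (closure D)) : HasLimits D (carreDuChamp n u v) :=
  hasLimits_of_extendsC fun _ _ hy => extendsC_carreDuChamp hD hu hv hy 0

theorem hasLimits_diffusion {D : Set M} (hD : IsOpen D) {V u : M → ℝ}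
    (hV : ContMDiffOn (𝓡 n) 𝓘(ℝ, ℝ) 2 V (closure D))
    (hu : ContMDiffOn (𝓡 n) 𝓘(ℝ, ℝ) ∞ u (closure D)) : HasLimits D (diffusion n V u) :=
  hasLimits_of_extendsC fun _ _ hy => (extendsC_diffusion hD hV hu hy).of_le zero_le_one

theorem hasLimits_gammaTwo {D : Set M} (hD : IsOpen D) {V u : M → ℝ}
    (hV : ContMDiffOn (𝓡 n) 𝓘(ℝ, ℝ) 2 V (closure D))
    (hu : ContMDiffOn (𝓡 n) 𝓘(ℝ, ℝ) ∞ u (closure D)) : HasLimits D (gammaTwo n V u u) :=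
  hasLimits_of_extendsC fun _ _ hy => extendsC_gammaTwo hD hV hu hy

variable [MeasurableSpace M] [BorelSpace M]

/-- The boundary term of a convex domain is nonnegative. -/
theorem integral_secondFundamentalForm_nonneg {D : Set M} (hconvex : IsConvexDomain n D)
    (V : M → ℝ) {a f : M → ℝ} (ha : ∀ p ∈ frontier D, 0 ≤ a p)
    (hN : ∀ p ∈ frontier D, mvfderivWithin (𝓡 n) f (closure D) p (inwardNormal n D p) = 0) :
    0 ≤ ∫ p, Real.exp (V p) * a p *
      secondFundamentalForm n D p (gradWithin n (closure D) f p) (gradWithin n (closure D) f p)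
        ∂(boundaryArea n D) := by
  refine integral_nonneg_of_ae ?_
  filter_upwards [ae_restrict_mem isClosed_frontier.measurableSet] with p hp
  refine mul_nonneg (mul_nonneg (Real.exp_pos _).le (ha p hp)) (hconvex p hp _ ?_)
  -- The product of the gradient with the normal is the normal derivative, so `hN` makes `∇f`
  -- tangent and the convexity hypothesis applies to it.
  rw [real_inner_comm]
  exact (InnerProductSpace.toDual_symm_apply).trans (hN p hp)

/-- Cauchy-Schwarz from a nonnegative quadratic polynomial, evaluated at its minimizer `q / C`. For
`C = 0` the left side is `0` by the convention for division, and `t = 0` gives `B ≥ 0`. -/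
theorem two_div_mul_sq_le {B C m q : ℝ} (hm : 0 < m) (hC : 0 ≤ C)
    (h : ∀ t : ℝ, 0 ≤ t ^ 2 * C - 2 * t * q + B) : 2 / (m * C) * q ^ 2 ≤ 2 / m * B := by
  rcases hC.eq_or_lt with rfl | hC
  · have := h 0
    simp only [mul_zero, div_zero, zero_mul]
    have : 0 ≤ B := by linarith
    positivity
  · have h1 := h (q / C)
    have h2 : (q / C) ^ 2 * C - 2 * (q / C) * q + B = B - q ^ 2 / C := by
      field_simp
      ring
    have h3 : 2 / (m * C) * q ^ 2 = 2 / m * (q ^ 2 / C) := by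
      field_simp
    rw [h3]
    exact mul_le_mul_of_nonneg_left (by linarith) (by positivity)

theorem weightedIntegral_mono {D : Set M} (hD : IsOpen D) (hDc : IsCompact (closure D))
    [SecondCountableTopology M] {V F G : M → ℝ} (hV : ContinuousOn V (closure D))
    (hF : HasLimits D F) (hG : HasLimits D G) (h : ∀ x ∈ D, F x ≤ G x) :
    weightedIntegral n V D F ≤ weightedIntegral n V D G := by
  have hvol : riemannianVolume n M D < ⊤ :=
    (measure_mono subset_closure).trans_lt (riemannianVolume_lt_top_of_isCompact hDc)
  have hw : HasLimits D fun x => Real.exp (V x) :=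
    .of_continuousOn (Real.continuous_exp.comp_continuousOn hV)
  exact setIntegral_mono_on ((hF.mul hw).integrableOn hD hDc hvol)
    ((hG.mul hw).integrableOn hD hDc hvol) hD.measurableSet fun x hx =>
      mul_le_mul_of_nonneg_right (h x hx) (Real.exp_pos _).le

theorem weightedIntegral_add {D : Set M} (hD : IsOpen D) (hDc : IsCompact (closure D))
    [SecondCountableTopology M] {V F G : M → ℝ} (hV : ContinuousOn V (closure D))
    (hF : HasLimits D F) (hG : HasLimits D G) :
    weightedIntegral n V D (fun x => F x + G x) =
      weightedIntegral n V D F + weightedIntegral n V D G := by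
  have hvol : riemannianVolume n M D < ⊤ :=
    (measure_mono subset_closure).trans_lt (riemannianVolume_lt_top_of_isCompact hDc)
  have hw : HasLimits D fun x => Real.exp (V x) :=
    .of_continuousOn (Real.continuous_exp.comp_continuousOn hV)
  simp only [weightedIntegral, add_mul]
  exact integral_add ((hF.mul hw).integrableOn hD hDc hvol) ((hG.mul hw).integrableOn hD hDc hvol)

theorem weightedIntegral_const_mul (c : ℝ) (V : M → ℝ) (D : Set M) (F : M → ℝ) :
    weightedIntegral n V D (fun x => c * F x) = c * weightedIntegral n V D F := by
  simp only [weightedIntegral, mul_assoc]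
  exact integral_const_mul _ _

theorem weightedIntegral_nonneg {D : Set M} (hD : IsOpen D) {V F : M → ℝ}
    (h : ∀ x ∈ D, 0 ≤ F x) : 0 ≤ weightedIntegral n V D F :=
  setIntegral_nonneg hD.measurableSet fun x hx => mul_nonneg (h x hx) (Real.exp_pos _).le

theorem weightedIntegral_congr {D : Set M} (hD : IsOpen D) {V F G : M → ℝ}
    (h : ∀ x ∈ D, F x = G x) : weightedIntegral n V D F = weightedIntegral n V D G :=
  setIntegral_congr_fun hD.measurableSet fun x hx => by simp only [h x hx]

theorem integralCurvatureDimension_of_curvatureDimension [SecondCountableTopology M] {D : Set M}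
    (hD : IsOpen D) (hDc : IsCompact (closure D))
    (hDs : ∀ p ∈ frontier D, ∃ ρ : M → ℝ, IsLocalDefiningFunction n D p ρ) {V : M → ℝ}
    (hV : ContMDiffOn (𝓡 n) 𝓘(ℝ, ℝ) 2 V (closure D)) {J : Set ℝ} (hJ : UniqueDiffOn ℝ J)
    {Φ : ℝ → ℝ} (hΦ : ContDiffOn ℝ ∞ Φ J) (hpos : ∀ r ∈ J, 0 < secondDeriv J Φ r)
    (hinv : ConcaveOn ℝ J fun r => 1 / secondDeriv J Φ r) {K m : ℝ} (hm : 0 < m)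
    (hconvex : IsConvexDomain n D) (hCD : CurvatureDimension n V D K m) :
    IntegralCurvatureDimension n V D J Φ K m := by
  intro f hf hfJ hN
  have hfD : MapsTo f D J := hfJ.mono_left subset_closure
  have hg := contDiffOn_derivWithin hJ hΦ
  have hs := contDiffOn_secondDeriv hJ hΦ
  have hi : ContDiffOn ℝ ∞ (fun r => 1 / secondDeriv J Φ r) J :=
    contDiffOn_const.div hs fun r hr => (hpos r hr).ne'
  have hu : ContMDiffOn (𝓡 n) 𝓘(ℝ, ℝ) ∞ (fun y => derivWithin Φ J (f y)) (closure D) :=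
    hg.contMDiffOn.comp hf hfJ
  set u : M → ℝ := fun y => derivWithin Φ J (f y) with hudef
  have hgrad : ∀ x ∈ D, grad n u x = secondDeriv J Φ (f x) • grad n f x := by
    intro x hx
    rw [secondDeriv_eq]
    exact grad_comp hD (hg.differentiableOn (by simp)) hfD hx
      (((hf x (subset_closure hx)).contMDiffAt
        (mem_of_superset (hD.mem_nhds hx) subset_closure)).mdifferentiableAt (by simp))
  have hΓρ : ∀ (ρ : M → ℝ), ∀ x ∈ D,
      carreDuChamp n ρ u x = secondDeriv J Φ (f x) * carreDuChamp n ρ f x := by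
    intro ρ x hx
    rw [carreDuChamp, hgrad x hx, inner_smul_right, carreDuChamp]
  have hΓu : ∀ x ∈ D, carreDuChamp n u u x =
      secondDeriv J Φ (f x) ^ 2 * carreDuChamp n f f x := by
    intro x hx
    rw [hΓρ u x hx, carreDuChamp, hgrad x hx, real_inner_smul_left, carreDuChamp]
    ring
  have lcomp : ∀ {h : ℝ → ℝ}, ContinuousOn h J → HasLimits D fun x => h (f x) := fun hh =>
    .of_continuousOn (hh.comp hf.continuousOn hfJ)
  have ls := lcomp hs.continuousOn
  have li := lcomp hi.continuousOn
  have lhh := lcomp (contDiffOn_secondDeriv hJ hi).continuousOn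
  have lf : HasLimits D f := .of_continuousOn hf.continuousOn
  have lΓ := hasLimits_carreDuChamp hD hf hf
  have lL := hasLimits_diffusion hD hV hu
  have lG2 := hasLimits_gammaTwo hD hV hu
  -- `Γ(ρ, u) = Φ''(f) Γ(ρ, f)`, and the first factor has a limit at the boundary.
  have hNu : NeumannCondition n D u := by
    intro p hp ρ hρ
    obtain ⟨c, hc⟩ := ls p (frontier_subset_closure hp)
    have h1 := hc.mul (neumannCondition_of_normal hD hf hN p hp ρ hρ)
    rw [mul_zero] at h1
    refine h1.congr' ?_
    filter_upwards [self_mem_nhdsWithin] with x hx using (hΓρ ρ x hx).symm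
  have hgreen := integral_green hD hDc hDs hV hf hu hNu
  have hVc := hV.continuousOn
  set q := qPhi n V D J Φ f with hq
  set C := cPhi n V D J Φ f with hC
  set B := weightedIntegral n V D fun x =>
    diffusion n V u x ^ 2 * (1 / secondDeriv J Φ (f x)) with hB
  have hqL : weightedIntegral n V D (fun x => f x * diffusion n V u x) = -q := by
    rw [weightedIntegral_add hD hDc hVc (lf.mul lL) (hasLimits_carreDuChamp hD hf hu),
      weightedIntegral_congr hD (hΓρ f)] at hgreen
    exact eq_neg_of_add_eq_zero_left hgreen
  -- The polynomial is the integral of `Φ''(f) (t f + Lu / Φ''(f))²`; its middle coefficient is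
  -- Green's formula `∫ f Lu dμ = -q`.
  have hquad : ∀ t : ℝ, 0 ≤ t ^ 2 * C - 2 * t * q + B := by
    intro t
    have l1 : HasLimits D fun x => t ^ 2 * (f x ^ 2 * secondDeriv J Φ (f x)) :=
      .mul (.of_continuousOn continuousOn_const) ((lf.pow 2).mul ls)
    have l2 : HasLimits D fun x => (2 * t) * (f x * diffusion n V u x) :=
      .mul (.of_continuousOn continuousOn_const) (lf.mul lL)
    have e : weightedIntegral n V D (fun x => t ^ 2 * (f x ^ 2 * secondDeriv J Φ (f x)) +
        (2 * t) * (f x * diffusion n V u x) +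
        diffusion n V u x ^ 2 * (1 / secondDeriv J Φ (f x))) = t ^ 2 * C - 2 * t * q + B := by
      rw [weightedIntegral_add hD hDc hVc (l1.add l2) ((lL.pow 2).mul li),
        weightedIntegral_add hD hDc hVc l1 l2, weightedIntegral_const_mul,
        weightedIntegral_const_mul, hqL, ← hB]
      change t ^ 2 * C + 2 * t * -q + B = _
      ring
    rw [← e]
    refine weightedIntegral_nonneg hD fun x hx => ?_
    have hp := hpos _ (hfD hx)
    have e2 : t ^ 2 * (f x ^ 2 * secondDeriv J Φ (f x)) + (2 * t) * (f x * diffusion n V u x) +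
        diffusion n V u x ^ 2 * (1 / secondDeriv J Φ (f x)) =
        secondDeriv J Φ (f x) * (t * f x + diffusion n V u x / secondDeriv J Φ (f x)) ^ 2 := by
      field_simp
      ring
    rw [e2]
    positivity
  have hC0 : 0 ≤ C := weightedIntegral_nonneg hD fun x hx =>
    mul_nonneg (sq_nonneg _) (hpos _ (hfD hx)).le
  have hbdry := integral_secondFundamentalForm_nonneg hconvex V (f := f)
    (a := fun p => secondDeriv J Φ (f p))
    (fun p hp => (hpos _ (hfJ (frontier_subset_closure hp))).le) hN
  have hint : 2 * K * q + 2 / m * B ≤ weightedIntegral n V D fun x =>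
      2 * gammaTwo n V u u x / secondDeriv J Φ (f x) -
        secondDeriv J (fun r => 1 / secondDeriv J Φ r) (f x) *
          (secondDeriv J Φ (f x) * carreDuChamp n f f x) ^ 2 := by
    have l1 : HasLimits D fun x => (2 * K) * (secondDeriv J Φ (f x) * carreDuChamp n f f x) :=
      .mul (.of_continuousOn continuousOn_const) (ls.mul lΓ)
    have l2 : HasLimits D fun x =>
        (2 / m) * (diffusion n V u x ^ 2 * (1 / secondDeriv J Φ (f x))) :=
      .mul (.of_continuousOn continuousOn_const) ((lL.pow 2).mul li)
    have e : weightedIntegral n V D (fun x =>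
        (2 * K) * (secondDeriv J Φ (f x) * carreDuChamp n f f x) +
        (2 / m) * (diffusion n V u x ^ 2 * (1 / secondDeriv J Φ (f x)))) =
        2 * K * q + 2 / m * B := by
      rw [weightedIntegral_add hD hDc hVc l1 l2, weightedIntegral_const_mul,
        weightedIntegral_const_mul]
      rfl
    rw [← e]
    have l3 : HasLimits D fun x => 2 * gammaTwo n V u u x / secondDeriv J Φ (f x) := by
      simpa only [mul_one_div] using
        (HasLimits.mul (.of_continuousOn continuousOn_const) lG2 :
          HasLimits D fun x => 2 * gammaTwo n V u u x).mul li
    refine weightedIntegral_mono hD hDc hVc (l1.add l2)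
      (l3.sub (lhh.mul ((ls.mul lΓ).pow 2))) fun x hx => ?_
    have hp := hpos _ (hfD hx)
    have h1 := hCD.of_contMDiffOn hD (hu.mono subset_closure) hx
    -- Concavity of `1/Φ''` gives the sign of the term that is discarded.
    have h2 := mul_nonneg (neg_nonneg.2 (secondDeriv_nonpos_of_concaveOn
      (hi.differentiableOn (by simp)) hinv (f x)))
      (sq_nonneg (secondDeriv J Φ (f x) * carreDuChamp n f f x))
    rw [hΓu x hx] at h1
    -- The factor `2 / Φ''(f)` turns `K Γ(u) = K Φ''(f)² Γ(f)` into the integrand of `2K q`.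
    have h3 := mul_le_mul_of_nonneg_left h1 (by positivity : 0 ≤ 2 / secondDeriv J Φ (f x))
    have e2 : 2 / secondDeriv J Φ (f x) * (K * (secondDeriv J Φ (f x) ^ 2 * carreDuChamp n f f x) +
        1 / m * diffusion n V u x ^ 2) =
        (2 * K) * (secondDeriv J Φ (f x) * carreDuChamp n f f x) +
        (2 / m) * (diffusion n V u x ^ 2 * (1 / secondDeriv J Φ (f x))) := by
      field_simp
    have e3 : 2 / secondDeriv J Φ (f x) * gammaTwo n V u u x =
        2 * gammaTwo n V u u x / secondDeriv J Φ (f x) := by ring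
    rw [e2, e3] at h3
    linarith
  have := two_div_mul_sq_le hm hC0 hquad
  linarith

end Integral

end RiemannDomain

end

theorem proposition3p2 {n : ℕ} {M : Type*} [MetricSpace M] [SecondCountableTopology M]
    [MeasurableSpace M] [BorelSpace M]
    [ChartedSpace (EuclideanSpace ℝ (Fin n)) M] [IsManifold (𝓡 n) ∞ M]
    [Bundle.RiemannianBundle (fun x : M => TangentSpace (𝓡 n) x)]
    [IsContMDiffRiemannianBundle (𝓡 n) ∞ (EuclideanSpace ℝ (Fin n))
      (fun x : M => TangentSpace (𝓡 n) x)]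
    [IsRiemannianManifold (𝓡 n) M] [CompleteSpace M]
    (D : Set M) (hD : RiemannDomain.IsBoundedSmoothDomain n D)
    (V : M → ℝ) (hV : ContMDiffOn (𝓡 n) 𝓘(ℝ, ℝ) 2 V (closure D))
    (J : Set ℝ) (hJ : J.OrdConnected) (Φ : ℝ → ℝ)
    (hΦ_smooth : ContDiffOn ℝ ∞ Φ J) (hΦ_convex : ConvexOn ℝ J Φ)
    (hΦ_pos : ∀ r ∈ J, 0 < RiemannDomain.secondDeriv J Φ r)
    (hΦ_convex_second : ConvexOn ℝ J (RiemannDomain.secondDeriv J Φ))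
    (hΦ_convex_inv : ConvexOn ℝ J (fun r => -1 / RiemannDomain.secondDeriv J Φ r))
    (K m : ℝ) (hm : 0 < m)
    (hconvex : RiemannDomain.IsConvexDomain n D)
    (hCD : RiemannDomain.CurvatureDimension n V D K m) :
    RiemannDomain.IntegralCurvatureDimension n V D J Φ K m := by
  have hinv : ConcaveOn ℝ J fun r => 1 / RiemannDomain.secondDeriv J Φ r := by
    refine neg_convexOn_iff.1 (hΦ_convex_inv.congr fun r _ => ?_)
    simp [neg_div]
  exact RiemannDomain.integralCurvatureDimension_of_curvatureDimension hD.isOpen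
    (RiemannDomain.isCompact_closure_of_isBounded (n := n) hD.isBounded) hD.smooth_boundary hV
    (RiemannDomain.uniqueDiffOn_of_secondDeriv_ne_zero hJ fun r hr => (hΦ_pos r hr).ne')
    hΦ_smooth hΦ_pos hinv hm hconvex hCD
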